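/- **Setting.** Let $B\ge 1$, $d\ge1$ and, for $k\in\{1,\dots,B\}$, let $N_k\ge 1$, $\mu_k\in\mathbb R^d$ and let $\Sigma_k\in\mathbb R^{d\times d}$ be positive semidefinite, with $\Sigma_1\neq 0$. Let $X^{(k)}_i$ ($1\le k\le B$, $1\le i\le N_k$) be independent, with $X^{(k)}_i\sim\mathcal N(\mu_k,\Sigma_k)$. Write $\hat\mu_k=\frac1{N_k}\sum_{i}X_i^{(k)}$, $s_k^2=\operatorname{Tr}\Sigma_k/N_k$ and $d^e_1=\operatorname{Tr}\Sigma_1/\|\Sigma_1\|_\infty$, where $\|\cdot\|_\infty$ is the operator norm. Let $\mathcal S_B$ be the probability simplex in $\mathbb R^B$. *Estimator.* Put $$\hat s_1^2=\frac1{N_1(N_1-1)}\sum_{i}\|X^{(1)}_i-\hat\mu_1\|^2,\qquad \hat q_k=\frac1{N_1-1}\sum_{i}\langle\hat\mu_1-\hat\mu_k,\,X^{(1)}_i-\hat\mu_1\rangle^2,$$ $$\hat L_1(\omega)=\Big\|\sum_{k\ge2}\omega_k(\hat\mu_k-\hat\mu_1)\Big\|^2+(2\omega_1-1)\hat s_1^2,\qquad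 \hat Q_1(\omega)=\sum_{k\ge2}\omega_k\sqrt{\hat q_k/N_1}.$$ For $u_0\ge0$ let $\hat\omega\in\arg\min_{\omega\in\mathcal S_B}\big(\hat L_1(\omega)+16\sqrt{u_0}\,\hat Q_1(\omega)\big)$ (any measurable choice), and let $R_1(\hat\omega)=\mathbb E\big\|\sum_k\hat\omega_k\hat\mu_k-\mu_1\big\|^2$ be the risk of the Q-aggregation estimator of $\mu_1$. *Oracle.* For $\tau>0$ let $V_\tau=\{k:\|\mu_k-\mu_1\|^2\le\tau s_1^2\}$, and let $V_0=\{1\}$. For $\varsigma\ge1$ let $V_{\tau,\varsigma}=\{k\in V_\tau:\|\Sigma_k\|_2/N_k\le\varsigma\|\Sigma_1\|_2/N_1\}$ with $\|\Sigma\|_2=\sqrt{\operatorname{Tr}\Sigma^2}$. Let $\nu(U)=s_1^{-2}\big(\sum_{k\in U}s_k^{-2}\big)^{-1}$ (equal to $0$ if $s_k=0$ for some $k\in U$) and $$\mathcal B(\tau,\nu)=\frac{\tau}{1+\tau}+\frac1{1+\tau}\cdot\frac{\nu}{1+\tau(1-\nu)}.$$ **(i) Risk bound.** There is an absolute constant $C>0$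 such that, in every such setting and for every $u_0$ with $\log(17B)\le u_0\le (N_1-1)/2$, the loss of $\hat\omega$ is integrable and $$\frac{R_1(\hat\omega)}{s_1^2}\le\big(1+CBe^{-u_0/2}\big)\inf_{\tau\ge0,\ \varsigma\ge1}\Big[\mathcal B\big(\tau,\nu(V_{\tau,\varsigma})\big)+C\varsigma\sqrt{\frac{u_0}{d^e_1}}\Big].$$ **(ii) Oracle-consistency, adaptively over $\tau$ and $\varsigma$.** Consider a sequence of such settings (all parameters may vary with the index $n$, which is omitted) with $d^e_1\to\infty$ and, for all large $n$, $N_1\ge 1+4\log(Bd^e_1)$, and let $\hat\omega$ be computed with $u_0=2\log(Bd^e_1)$. Then for all sequences $\tau>0$ and $\varsigma\ge1$ (on which $\hat\omega$ does not depend) with $\varsigma\sqrt{\log(Bd^e_1)/d^e_1}=o\big(\tau/(1+\tau)\big)$ there are factors $c_n\to1$ such that, for all large $n$, $$\frac{R_1(\hat\omega)}{s_1^2}\le c_n\,\mathcal B\big(\tau,\nu(V_{\tau,\varsigma})\big).$$ -/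

import Mathlib

/-- The parameters of a multiple-mean estimation problem in the Gaussian setting: `B ≥ 1` tasks in
`ℝ^d`; task `k` is the distribution `N(mean k, cov k)`, from which a bag of `N k ≥ 1` points is
drawn.  Tasks are indexed by `Fin B`, and the target task is `0`.  Covariances may be singular. -/
structure GaussianTasks where
  d : ℕ
  B : ℕ
  [neZero : NeZero B]
  N : Fin B → ℕ
  N_pos : ∀ k, 0 < N k
  mean : Fin B → EuclideanSpace ℝ (Fin d)
  cov : Fin B → Matrix (Fin d) (Fin d) ℝ
  cov_posSemidef : ∀ k, (cov k).PosSemidef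

namespace GaussianTasks

attribute [instance] GaussianTasks.neZero

/-- A realisation of all the bags: `x k i` is the `i`-th point of the bag `k`. -/
abbrev Data (T : GaussianTasks) : Type :=
  (k : Fin T.B) → Fin (T.N k) → EuclideanSpace ℝ (Fin T.d)

noncomputable section

/-! ### Population quantities -/

/-- The naive risk `s_k² = Tr Σ_k / N_k`. -/
def naiveRisk (T : GaussianTasks) (k : Fin T.B) : ℝ :=
  (T.cov k).trace / (T.N k : ℝ)

/-- The Schatten 2-norm `‖Σ_k‖₂ = (Tr Σ_k²)^{1/2}`. -/
def schattenTwo (T : GaussianTasks) (k : Fin T.B) : ℝ :=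
  Real.sqrt (T.cov k * T.cov k).trace

/-- The effective dimension `d^e_k = Tr Σ_k / ‖Σ_k‖_∞`, where `‖·‖_∞` is the operator norm. -/
def effDim (T : GaussianTasks) (k : Fin T.B) : ℝ :=
  (T.cov k).trace / ‖Matrix.toEuclideanCLM (n := Fin T.d) (𝕜 := ℝ) (T.cov k)‖

open Classical in
/-- The set `V_τ` of `τ`-neighbouring tasks of the target, with the convention `V_0 = {target}`. -/
def neighbours (T : GaussianTasks) (τ : ℝ) : Finset (Fin T.B) :=
  if τ = 0 then {0}
  else Finset.univ.filter fun k => ‖T.mean k - T.mean 0‖ ^ 2 ≤ τ * T.naiveRisk 0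

open Classical in
/-- The set `W_ς` of the tasks with `‖Σ_k‖₂ / N_k ≤ ς ‖Σ_1‖₂ / N_1`. -/
def lowVariance (T : GaussianTasks) (ς : ℝ) : Finset (Fin T.B) :=
  Finset.univ.filter fun k =>
    T.schattenTwo k / (T.N k : ℝ) ≤ ς * (T.schattenTwo 0 / (T.N 0 : ℝ))

open Classical in
/-- `V_{τ,ς} = V_τ ∩ W_ς`. -/
def trimmedNeighbours (T : GaussianTasks) (τ ς : ℝ) : Finset (Fin T.B) :=
  T.neighbours τ ∩ T.lowVariance ς

/-- `s²(U) = (∑_{k ∈ U} 1 / s_k²)⁻¹`, computed in `[0, ∞]`, so that `s²(U) = 0` as soon as some task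
in `U` has `s_k² = 0`. -/
def aggVariance (T : GaussianTasks) (U : Finset (Fin T.B)) : ENNReal :=
  (∑ k ∈ U, (ENNReal.ofReal (T.naiveRisk k))⁻¹)⁻¹

/-- The relative aggregated variance `ν(U) = s²(U) / s_1²`. -/
def relAggVariance (T : GaussianTasks) (U : Finset (Fin T.B)) : ℝ :=
  (T.aggVariance U).toReal / T.naiveRisk 0

/-- The function `ℬ(τ, ν)`. -/
def oracleRisk (τ ν : ℝ) : ℝ :=
  τ / (1 + τ) + 1 / (1 + τ) * (ν / (1 + τ * (1 - ν)))

/-! ### Estimators -/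

/-- The naive estimator of task `k`, i.e. the empirical mean of its bag. -/
def naive (T : GaussianTasks) (x : T.Data) (k : Fin T.B) : EuclideanSpace ℝ (Fin T.d) :=
  (T.N k : ℝ)⁻¹ • ∑ i, x k i

/-- The aggregation `∑_k w_k μ̂_k` of the naive estimators. -/
def aggregate (T : GaussianTasks) (x : T.Data) (w : Fin T.B → ℝ) : EuclideanSpace ℝ (Fin T.d) :=
  ∑ k, w k • T.naive x k

/-- The squared loss for the target task of the aggregation with weights `w`. -/
def loss (T : GaussianTasks) (x : T.Data) (w : Fin T.B → ℝ) : ℝ :=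
  ‖T.aggregate x w - T.mean 0‖ ^ 2

/-- The unbiased estimator of the naive risk `s_1²`. -/
def naiveRiskHat (T : GaussianTasks) (x : T.Data) : ℝ :=
  1 / ((T.N 0 : ℝ) * ((T.N 0 : ℝ) - 1)) * ∑ i, ‖x 0 i - T.naive x 0‖ ^ 2

/-- `L̂_1(w)`. -/
def lossHat (T : GaussianTasks) (x : T.Data) (w : Fin T.B → ℝ) : ℝ :=
  ‖∑ k ∈ Finset.univ.erase 0, w k • (T.naive x k - T.naive x 0)‖ ^ 2
    + (2 * w 0 - 1) * T.naiveRiskHat x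

/-- `q̂_k`. -/
def qHat (T : GaussianTasks) (x : T.Data) (k : Fin T.B) : ℝ :=
  1 / ((T.N 0 : ℝ) - 1)
    * ∑ i, (inner ℝ (T.naive x 0 - T.naive x k) (x 0 i - T.naive x 0)) ^ 2

/-- `Q̂_1(w)`. -/
def penaltyHat (T : GaussianTasks) (x : T.Data) (w : Fin T.B → ℝ) : ℝ :=
  ∑ k ∈ Finset.univ.erase 0, w k * Real.sqrt (T.qHat x k / (T.N 0 : ℝ))

/-- `w` minimises `L̂_1 + 16 √u₀ Q̂_1` over the probability simplex. -/
def IsQAggregation (T : GaussianTasks) (u₀ : ℝ) (x : T.Data) (w : Fin T.B → ℝ) : Prop :=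
  w ∈ stdSimplex ℝ (Fin T.B) ∧
    IsMinOn (fun v => T.lossHat x v + 16 * Real.sqrt u₀ * T.penaltyHat x v)
      (stdSimplex ℝ (Fin T.B)) w

/-! ### Probabilistic model -/

/-- The random bags `X` follow the model: the points of the bag `k` have the law
`N(mean k, cov k)`, and all the points of all the bags are independent. -/
def IsSample (T : GaussianTasks) {Ω : Type*} [MeasurableSpace Ω] (P : MeasureTheory.Measure Ω)
    (X : (k : Fin T.B) → Fin (T.N k) → Ω → EuclideanSpace ℝ (Fin T.d)) : Prop :=
  (∀ k i, ProbabilityTheory.HasLaw (X k i)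
      (ProbabilityTheory.multivariateGaussian (T.mean k) (T.cov k)) P) ∧
    ProbabilityTheory.iIndepFun (fun p : (k : Fin T.B) × Fin (T.N k) => X p.1 p.2) P

/-- `what` is a Q-aggregation weight vector: a random vector that almost surely is a minimiser of
the criterion computed from the bags `X`. -/
def IsQAggregationEstimator (T : GaussianTasks) (u₀ : ℝ) {Ω : Type*} [MeasurableSpace Ω]
    (P : MeasureTheory.Measure Ω)
    (X : (k : Fin T.B) → Fin (T.N k) → Ω → EuclideanSpace ℝ (Fin T.d))
    (what : Ω → Fin T.B → ℝ) : Prop :=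
  AEMeasurable what P ∧ ∀ᵐ a ∂P, T.IsQAggregation u₀ (fun k i => X k i a) (what a)

/-- The risk `R_1(what)`, the expected loss of the aggregation with random weights `what`. -/
def risk (T : GaussianTasks) {Ω : Type*} [MeasurableSpace Ω] (P : MeasureTheory.Measure Ω)
    (X : (k : Fin T.B) → Fin (T.N k) → Ω → EuclideanSpace ℝ (Fin T.d))
    (what : Ω → Fin T.B → ℝ) : ℝ :=
  ∫ a, T.loss (fun k i => X k i a) (what a) ∂P

end

end GaussianTasks

/-!
The loss of a weight vector `w` is `‖∑ k, w k • m k‖²`, where `m k = μ̂_k - μ_1`.  Up to a constant,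
the criterion that `ŵ` minimises is this loss, minus the cross term `2 ⟪∑ k, w k • m k, m 0⟫`, whose
part `2 w_1 ‖m 0‖²` is compensated by the estimate `2 w_1 ŝ_1²`, plus a linear penalty.  Minimality
over a convex set therefore bounds the loss of `ŵ` by the loss of any fixed `z` in the simplex, up to
the linear noise terms `⟪m k, m 0⟫`, the penalty of `z`, and `|‖m 0‖² - ŝ_1²|`; the strong convexity
of the quadratic part even leaves a negative term `-‖∑ k, (ŵ k - z k) • m k‖²`
(`norm_sq_le_of_isMinOn`).

The noise `m 0` is a Gaussian vector, independent of the other errors `m k` and of the residuals of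
the target bag (`GaussianTasks.map_errors_eq_prod`).  Conditionally on `m k`, the term `⟪m k, m 0⟫`
is Gaussian of variance `⟪m k, Σ_1 m k⟫ / N_1`, and with high probability `q̂_k` does not
underestimate the variance of the target in the direction `m 0 - m k` by more than a constant factor
(a lower tail bound for a chi-square variable, `measure_sum_inner_residual_sq_lt_le`).  Hence, outside
an event of small probability, the penalty absorbs the noise terms of `ŵ`
(`norm_sq_le_of_isMinOn_of_inner_le`).  On the exceptional event the noise terms are instead absorbed
by the negative quadratic term, at the price of the squared norm of the projection of `m 0` on the
span of the other `m k` (`norm_sq_le_of_isMinOn_of_projection`).  This projection involves at most `B`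
directions, so that its expectation on the exceptional event is at most of order
`B e^{-u/2} s_1² / √d^e_1` (`GaussianTasks.lintegral_exceptionalLoss_le`).

It remains to choose `z`: sharing the weight between the target and the tasks of `V_{τ,ς}`, the
latter with weights proportional to `1 / s_k²`, gives an expected loss of at most `s_1² ℬ(τ, ν)`
(`GaussianTasks.exists_oracleWeights`).  The weight `A` of the other tasks satisfies `A² τ ≤ 1`,
which keeps the noise terms and the penalty of `z` of order `ς √u s_1² / √d^e_1` uniformly in `τ`.
Oracle consistency follows, since `ℬ(τ, ν) ≥ τ / (1 + τ)` dominates the remainder.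
-/

open Matrix MeasureTheory ProbabilityTheory

/-! ### Quadratic forms and traces of positive semidefinite matrices -/

/-- The quadratic form `w ↦ ⟨w, M w⟩` of a matrix `M`. -/
noncomputable def quadForm {d : ℕ} (M : Matrix (Fin d) (Fin d) ℝ)
    (w : EuclideanSpace ℝ (Fin d)) : ℝ :=
  inner ℝ w (toEuclideanCLM (n := Fin d) (𝕜 := ℝ) M w)

section QuadForm

variable {d : ℕ} {M M' : Matrix (Fin d) (Fin d) ℝ}

lemma quadForm_eq_dotProduct (M : Matrix (Fin d) (Fin d) ℝ) (w : EuclideanSpace ℝ (Fin d)) :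
    quadForm M w = w.ofLp ⬝ᵥ M *ᵥ w.ofLp :=
  Matrix.inner_toEuclideanCLM _ _ _

lemma quadForm_eq_sum (M : Matrix (Fin d) (Fin d) ℝ) (w : EuclideanSpace ℝ (Fin d)) :
    quadForm M w = ∑ i, ∑ j, M i j * (w i * w j) := by
  rw [quadForm_eq_dotProduct]
  simp only [dotProduct, mulVec, Finset.mul_sum]
  exact Finset.sum_congr rfl fun i _ => Finset.sum_congr rfl fun j _ => by ring

@[fun_prop]
lemma measurable_quadForm : Measurable (quadForm M) := by
  unfold quadForm; fun_prop

lemma quadForm_smul (c : ℝ) (w : EuclideanSpace ℝ (Fin d)) :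
    quadForm (c • M) w = c * quadForm M w := by
  simp [quadForm, map_smul, inner_smul_right]

lemma quadForm_le (M : Matrix (Fin d) (Fin d) ℝ) (w : EuclideanSpace ℝ (Fin d)) :
    quadForm M w ≤ ‖toEuclideanCLM (n := Fin d) (𝕜 := ℝ) M‖ * ‖w‖ ^ 2 := by
  calc quadForm M w ≤ ‖w‖ * ‖toEuclideanCLM (n := Fin d) (𝕜 := ℝ) M w‖ := real_inner_le_norm _ _
    _ ≤ ‖w‖ * (‖toEuclideanCLM (n := Fin d) (𝕜 := ℝ) M‖ * ‖w‖) := by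
        gcongr; exact ContinuousLinearMap.le_opNorm _ _
    _ = _ := by ring

open scoped MatrixOrder in
/-- A positive semidefinite form is the square of a Euclidean seminorm. -/
lemma exists_quadForm_eq_norm_sq (hM : M.PosSemidef) :
    ∃ A : EuclideanSpace ℝ (Fin d) →L[ℝ] EuclideanSpace ℝ (Fin d),
      ∀ w, quadForm M w = ‖A w‖ ^ 2 := by
  refine ⟨toEuclideanCLM (n := Fin d) (𝕜 := ℝ) (CFC.sqrt M), fun w => ?_⟩
  have hs : IsSelfAdjoint (toEuclideanCLM (n := Fin d) (𝕜 := ℝ) (CFC.sqrt M)) :=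
    (CFC.sqrt_nonneg M).isSelfAdjoint.map _
  rw [← real_inner_self_eq_norm_sq, ← ContinuousLinearMap.adjoint_inner_right, hs.adjoint_eq,
    ← ContinuousLinearMap.comp_apply, ← ContinuousLinearMap.mul_def, ← map_mul,
    CFC.sqrt_mul_sqrt_self _ hM.nonneg, quadForm]

lemma quadForm_nonneg (hM : M.PosSemidef) (w : EuclideanSpace ℝ (Fin d)) : 0 ≤ quadForm M w := by
  obtain ⟨A, hA⟩ := exists_quadForm_eq_norm_sq hM
  rw [hA]; positivity

lemma sqrt_quadForm_le (hM : M.PosSemidef) (v w : EuclideanSpace ℝ (Fin d)) :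
    √(quadForm M v) ≤ √(quadForm M (w - v)) + √(quadForm M w) := by
  obtain ⟨A, hA⟩ := exists_quadForm_eq_norm_sq hM
  simp only [hA, Real.sqrt_sq (norm_nonneg _)]
  have : A v = A w - A (w - v) := by simp
  rw [this, add_comm]
  exact norm_sub_le _ _

lemma quadForm_sub_le (hM : M.PosSemidef) (v w : EuclideanSpace ℝ (Fin d)) :
    quadForm M (v - w) ≤ 2 * quadForm M v + 2 * quadForm M w := by
  obtain ⟨A, hA⟩ := exists_quadForm_eq_norm_sq hM
  simp only [hA, map_sub]
  have h1 := norm_sub_le (A v) (A w)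
  have h2 := norm_nonneg (A v - A w)
  nlinarith [sq_nonneg (‖A v‖ - ‖A w‖)]

lemma trace_mul_self_eq_sum (hM : M.PosSemidef) :
    (M * M).trace = ∑ i, ∑ j, M i j ^ 2 := by
  simp only [trace, diag, mul_apply]
  refine Finset.sum_congr rfl fun i _ => Finset.sum_congr rfl fun j _ => ?_
  have := hM.isHermitian.apply i j
  simp only [star_trivial] at this
  rw [this, sq]

lemma trace_mul_self_nonneg (hM : M.PosSemidef) : 0 ≤ (M * M).trace := by
  rw [trace_mul_self_eq_sum hM]; positivity

/-- The Cauchy–Schwarz inequality for the Frobenius inner product. -/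
lemma trace_mul_le_sqrt_mul_sqrt (hM : M.PosSemidef) (hM' : M'.PosSemidef) :
    (M * M').trace ≤ √(M * M).trace * √(M' * M').trace := by
  rw [trace_mul_self_eq_sum hM, trace_mul_self_eq_sum hM']
  have h : (M * M').trace = ∑ p : Fin d × Fin d, M p.1 p.2 * M' p.1 p.2 := by
    rw [Fintype.sum_prod_type]
    simp only [trace, diag, mul_apply]
    refine Finset.sum_congr rfl fun i _ => Finset.sum_congr rfl fun j _ => ?_
    have := hM'.isHermitian.apply i j
    simp only [star_trivial] at this
    rw [this]
  rw [h, ← Fintype.sum_prod_type', ← Fintype.sum_prod_type']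
  exact Real.sum_mul_le_sqrt_mul_sqrt _ _ _

lemma toEuclideanCLM_eigenvectorBasis (hM : M.IsHermitian) (i : Fin d) :
    toEuclideanCLM (n := Fin d) (𝕜 := ℝ) M (hM.eigenvectorBasis i)
      = hM.eigenvalues i • hM.eigenvectorBasis i := by
  ext j
  have := congrFun (hM.mulVec_eigenvectorBasis i) j
  simpa using this

lemma trace_mul_self_eq_sum_eigenvalues (hM : M.IsHermitian) :
    (M * M).trace = ∑ i, hM.eigenvalues i ^ 2 := by
  have h1 : (M * M).trace = LinearMap.trace ℝ (EuclideanSpace ℝ (Fin d))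
      (toEuclideanLin (M * M)) := by
    rw [← Matrix.trace_toLin_eq (M * M) (PiLp.basisFun 2 ℝ (Fin d))]
    congr 1
  rw [h1, LinearMap.trace_eq_sum_inner _ hM.eigenvectorBasis]
  refine Finset.sum_congr rfl fun i _ => ?_
  rw [← Matrix.coe_toEuclideanCLM_eq_toEuclideanLin, map_mul]
  simp only [ContinuousLinearMap.coe_coe, ContinuousLinearMap.mul_def, ContinuousLinearMap.comp_apply,
    toEuclideanCLM_eigenvectorBasis, map_smul, inner_smul_right]
  simp [sq]

lemma eigenvalues_le_opNorm (hM : M.PosSemidef) (i : Fin d) :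
    hM.isHermitian.eigenvalues i ≤ ‖toEuclideanCLM (n := Fin d) (𝕜 := ℝ) M‖ := by
  have h := (toEuclideanCLM (n := Fin d) (𝕜 := ℝ) M).le_opNorm (hM.isHermitian.eigenvectorBasis i)
  rw [toEuclideanCLM_eigenvectorBasis, norm_smul, Real.norm_of_nonneg (hM.eigenvalues_nonneg i)] at h
  simpa using h

lemma trace_mul_self_le (hM : M.PosSemidef) :
    (M * M).trace ≤ ‖toEuclideanCLM (n := Fin d) (𝕜 := ℝ) M‖ * M.trace := by
  rw [trace_mul_self_eq_sum_eigenvalues hM.isHermitian,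
    hM.isHermitian.trace_eq_sum_eigenvalues, Finset.mul_sum]
  refine Finset.sum_le_sum fun i _ => ?_
  rw [sq]
  exact mul_le_mul_of_nonneg_right (eigenvalues_le_opNorm hM i) (hM.eigenvalues_nonneg i)

lemma opNorm_le_trace (hM : M.PosSemidef) :
    ‖toEuclideanCLM (n := Fin d) (𝕜 := ℝ) M‖ ≤ M.trace := by
  refine ContinuousLinearMap.opNorm_le_bound _ hM.trace_nonneg fun w => ?_
  have hb := hM.isHermitian.eigenvectorBasis.sum_repr' w
  have hx : toEuclideanCLM (n := Fin d) (𝕜 := ℝ) M w = ∑ i,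
      (inner ℝ (hM.isHermitian.eigenvectorBasis i) w * hM.isHermitian.eigenvalues i) •
        hM.isHermitian.eigenvectorBasis i := by
    conv_lhs => rw [← hb]
    simp only [map_sum, map_smul, toEuclideanCLM_eigenvectorBasis, smul_smul]
  rw [hx, hM.isHermitian.trace_eq_sum_eigenvalues, Finset.sum_mul]
  refine norm_sum_le_of_le _ fun i _ => ?_
  rw [norm_smul, norm_mul, Real.norm_of_nonneg (hM.eigenvalues_nonneg i)]
  have := norm_inner_le_norm (𝕜 := ℝ) (hM.isHermitian.eigenvectorBasis i) w
  simp only [OrthonormalBasis.norm_eq_one, one_mul, mul_one] at this ⊢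
  rw [mul_comm]
  exact mul_le_mul_of_nonneg_left this (hM.eigenvalues_nonneg i)

lemma quadForm_eigenvectorBasis (hM : M.IsHermitian) (i : Fin d) :
    quadForm M (hM.eigenvectorBasis i) = hM.eigenvalues i := by
  rw [quadForm, toEuclideanCLM_eigenvectorBasis, inner_smul_right]
  simp

end QuadForm

/-! ### Moments and tails of Gaussian vectors -/

section RealGaussian

open NNReal

lemma integrable_pow_gaussianReal (v : ℝ≥0) (n : ℕ) :
    Integrable (fun x : ℝ => x ^ n) (gaussianReal 0 v) := by
  rcases Nat.eq_zero_or_pos n with rfl | hn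
  · simp
  have h := (memLp_id_gaussianReal (μ := 0) (v := v) n).integrable_norm_pow
    (by exact_mod_cast hn.ne')
  refine (integrable_norm_iff (by fun_prop)).1 ?_
  simpa using h

lemma integral_sq_gaussianReal (v : ℝ≥0) : ∫ x, x ^ 2 ∂gaussianReal 0 v = v := by
  have h := variance_fun_id_gaussianReal (μ := 0) (v := v)
  rw [variance_eq_integral measurable_id'.aemeasurable] at h
  simpa using h

lemma map_sqrt_mul_gaussianReal (v : ℝ≥0) :
    (gaussianReal 0 1).map (fun x => √(v : ℝ) * x) = gaussianReal 0 v := by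
  rw [gaussianReal_map_const_mul]
  congr 1
  · simp
  · ext; simp

/-- The fourth moment is estimated through `x ^ 4 ≤ 12 (exp x + exp (-x))`. -/
lemma integral_pow_four_gaussianReal_le (v : ℝ≥0) :
    ∫ x, x ^ 4 ∂gaussianReal 0 v ≤ 40 * (v : ℝ) ^ 2 := by
  have h1 : ∫ x, x ^ 4 ∂gaussianReal 0 1 ≤ 40 := by
    have hb : ∀ x : ℝ, x ^ 4 ≤ 12 * (Real.exp (1 * x) + Real.exp ((-1) * x)) := by
      intro x
      rw [one_mul, neg_one_mul]
      have key : ∀ y : ℝ, 0 ≤ y → y ^ 4 ≤ 12 * (Real.exp y + Real.exp (-y)) := by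
        intro y hy
        have hc : Real.exp y + Real.exp (-y) = 2 * Real.cosh y := by rw [Real.cosh_eq]; ring
        have hs := Real.hasSum_cosh y
        have := hs.summable.sum_le_tsum {2} (fun n _ => by positivity)
        rw [hs.tsum_eq] at this
        simp [Nat.factorial] at this
        rw [hc]; linarith
      rcases le_total 0 x with hx | hx
      · exact key x hx
      · have := key (-x) (by linarith)
        rw [neg_neg] at this
        calc x ^ 4 = (-x) ^ 4 := by ring
          _ ≤ _ := by linarith
    calc ∫ x, x ^ 4 ∂gaussianReal 0 1
        ≤ ∫ x, 12 * (Real.exp (1 * x) + Real.exp ((-1) * x)) ∂gaussianReal 0 1 := by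
          refine integral_mono (integrable_pow_gaussianReal 1 4) ?_ hb
          exact ((integrable_exp_mul_gaussianReal 1).add
            (integrable_exp_mul_gaussianReal (-1))).const_mul 12
      _ = 24 * Real.exp (1 / 2) := by
          rw [integral_const_mul, integral_add (integrable_exp_mul_gaussianReal 1)
            (integrable_exp_mul_gaussianReal (-1))]
          have e1 := congrFun (mgf_fun_id_gaussianReal (μ := 0) (v := 1)) 1
          have e2 := congrFun (mgf_fun_id_gaussianReal (μ := 0) (v := 1)) (-1)
          simp only [mgf] at e1 e2
          rw [e1, e2]
          norm_num
          ring
      _ ≤ 40 := by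
          have : Real.exp (1 / 2) ^ 2 = Real.exp 1 := by rw [← Real.exp_nat_mul]; norm_num
          have h3 := Real.exp_one_lt_d9
          have h4 := Real.exp_pos (1 / 2)
          nlinarith
  rw [← map_sqrt_mul_gaussianReal v, integral_map (by fun_prop) (by fun_prop)]
  have h3 : ∀ x : ℝ, (√(v : ℝ) * x) ^ 4 = (v : ℝ) ^ 2 * x ^ 4 := fun x => by
    rw [mul_pow, show √(v : ℝ) ^ 4 = (√(v : ℝ) ^ 2) ^ 2 by ring, Real.sq_sqrt v.coe_nonneg]
  simp only [h3, integral_const_mul]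
  nlinarith [sq_nonneg (v : ℝ)]

lemma gaussianReal_tail_le (v : ℝ≥0) {t : ℝ} (ht : 0 ≤ t) :
    gaussianReal 0 v {x | t * √(v : ℝ) < |x|} ≤ ENNReal.ofReal (2 * Real.exp (-t ^ 2 / 2)) := by
  rw [← map_sqrt_mul_gaussianReal v, Measure.map_apply (by fun_prop)
    (measurableSet_lt (by fun_prop) (by fun_prop))]
  have hsub : (fun x => √(v : ℝ) * x) ⁻¹' {x | t * √(v : ℝ) < |x|} ⊆
      {x | t ≤ x} ∪ {x | t ≤ -x} := by
    intro x hx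
    simp only [Set.mem_preimage, Set.mem_ofPred_eq, abs_mul, abs_of_nonneg (Real.sqrt_nonneg _)] at hx
    have : t < |x| := by
      by_contra! h
      nlinarith [Real.sqrt_nonneg (v : ℝ)]
    rcases lt_abs.1 this with h | h
    · exact Or.inl h.le
    · exact Or.inr h.le
  have e1 : (gaussianReal 0 1).real {x : ℝ | t ≤ x} ≤ Real.exp (-t ^ 2 / 2) := by
    refine (measure_ge_le_exp_mul_mgf (X := fun x => x) t ht
      (integrable_exp_mul_gaussianReal t)).trans (le_of_eq ?_)
    rw [mgf_fun_id_gaussianReal, ← Real.exp_add]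
    simp; ring
  have e2 : (gaussianReal 0 1).real {x : ℝ | t ≤ -x} ≤ Real.exp (-t ^ 2 / 2) := by
    refine (measure_ge_le_exp_mul_mgf (X := fun x => -x) t ht ?_).trans (le_of_eq ?_)
    · simpa using integrable_exp_mul_gaussianReal (μ := 0) (v := 1) (-t)
    have : mgf (fun x : ℝ => -x) (gaussianReal 0 1) t = mgf (fun x => x) (gaussianReal 0 1) (-t) := by
      simp [mgf]
    rw [this, mgf_fun_id_gaussianReal, ← Real.exp_add]
    simp; ring
  calc _ ≤ gaussianReal 0 1 ({x | t ≤ x} ∪ {x | t ≤ -x}) := measure_mono hsub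
    _ ≤ gaussianReal 0 1 {x | t ≤ x} + gaussianReal 0 1 {x | t ≤ -x} := measure_union_le _ _
    _ = ENNReal.ofReal ((gaussianReal 0 1).real {x | t ≤ x}
          + (gaussianReal 0 1).real {x | t ≤ -x}) := by
        rw [ENNReal.ofReal_add (by positivity) (by positivity)]
        simp [measureReal_def]
    _ ≤ _ := ENNReal.ofReal_le_ofReal (by linarith)

lemma integral_exp_neg_mul_sq_gaussianReal (v : ℝ≥0) {r : ℝ} (hr : 0 ≤ r) :
    ∫ x, Real.exp (-(r * x ^ 2)) ∂gaussianReal 0 v = (√(1 + 2 * r * v))⁻¹ := by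
  by_cases hv : v = 0
  · subst hv; simp
  have hv' : 0 < (v : ℝ) := by positivity
  rw [integral_gaussianReal_eq_integral_smul hv]
  have : ∀ x : ℝ, gaussianPDFReal 0 v x • Real.exp (-(r * x ^ 2))
      = (√(2 * Real.pi * v))⁻¹ * Real.exp (-(r + 1 / (2 * v)) * x ^ 2) := by
    intro x
    rw [gaussianPDFReal, smul_eq_mul, mul_assoc, ← Real.exp_add]
    congr 2
    field_simp
    ring
  simp only [this, integral_const_mul, integral_gaussian]
  rw [← Real.sqrt_inv, ← Real.sqrt_inv, ← Real.sqrt_mul (by positivity)]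
  congr 1
  field_simp
  ring

end RealGaussian

section Multivariate

variable {d : ℕ} {M : Matrix (Fin d) (Fin d) ℝ} {m : EuclideanSpace ℝ (Fin d)}

lemma multivariateGaussian_map_inner (hM : M.PosSemidef) (w : EuclideanSpace ℝ (Fin d)) :
    (multivariateGaussian 0 M).map (fun x => inner ℝ w x)
      = gaussianReal 0 (quadForm M w).toNNReal := by
  have h := IsGaussian.map_eq_gaussianReal (μ := multivariateGaussian 0 M) (innerSL ℝ w)
  rw [ContinuousLinearMap.integral_comp_id_comm (IsGaussian.integrable_id),
    integral_id_multivariateGaussian, map_zero] at h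
  have hv : Var[innerSL ℝ w; multivariateGaussian 0 M] = quadForm M w := by
    rw [quadForm_eq_dotProduct, ← covarianceBilin_multivariateGaussian (μ := 0) hM,
      covarianceBilin_apply_eq_cov IsGaussian.memLp_two_id, covariance_self (by fun_prop)]
    rfl
  rw [hv] at h
  exact h

lemma multivariateGaussian_map_sub (a : EuclideanSpace ℝ (Fin d)) :
    (multivariateGaussian m M).map (fun x => x - a) = multivariateGaussian (m - a) M := by
  rw [multivariateGaussian, Measure.map_map (by fun_prop) (by fun_prop), multivariateGaussian]
  congr 1
  ext x : 1
  simp only [Function.comp_apply]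
  abel

lemma integrable_inner_pow (hM : M.PosSemidef) (w : EuclideanSpace ℝ (Fin d)) (n : ℕ) :
    Integrable (fun x => inner ℝ w x ^ n) (multivariateGaussian 0 M) := by
  have h := integrable_pow_gaussianReal (quadForm M w).toNNReal n
  rw [← multivariateGaussian_map_inner hM w,
    integrable_map_measure (by fun_prop) (by fun_prop)] at h
  exact h

lemma integral_inner_sq (hM : M.PosSemidef) (w : EuclideanSpace ℝ (Fin d)) :
    ∫ x, inner ℝ w x ^ 2 ∂multivariateGaussian 0 M = quadForm M w := by
  have h := integral_sq_gaussianReal (quadForm M w).toNNReal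
  rw [← multivariateGaussian_map_inner hM w, integral_map (by fun_prop) (by fun_prop),
    Real.coe_toNNReal _ (quadForm_nonneg hM w)] at h
  exact h

lemma integral_inner_pow_four_le (hM : M.PosSemidef) (w : EuclideanSpace ℝ (Fin d)) :
    ∫ x, inner ℝ w x ^ 4 ∂multivariateGaussian 0 M ≤ 40 * quadForm M w ^ 2 := by
  have h := integral_pow_four_gaussianReal_le (quadForm M w).toNNReal
  rw [← multivariateGaussian_map_inner hM w, integral_map (by fun_prop) (by fun_prop),
    Real.coe_toNNReal _ (quadForm_nonneg hM w)] at h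
  exact h

lemma lintegral_inner_sq (hM : M.PosSemidef) (w : EuclideanSpace ℝ (Fin d)) :
    ∫⁻ x, ENNReal.ofReal (inner ℝ w x ^ 2) ∂multivariateGaussian 0 M
      = ENNReal.ofReal (quadForm M w) := by
  rw [← ofReal_integral_eq_lintegral_ofReal (integrable_inner_pow hM w 2)
    (ae_of_all _ fun x => sq_nonneg _), integral_inner_sq hM]

lemma multivariateGaussian_tail_le (hM : M.PosSemidef) (w : EuclideanSpace ℝ (Fin d)) {t : ℝ}
    (ht : 0 ≤ t) :
    multivariateGaussian 0 M {x | t * √(quadForm M w) < |inner ℝ w x|}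
      ≤ ENNReal.ofReal (2 * Real.exp (-t ^ 2 / 2)) := by
  have h := gaussianReal_tail_le (quadForm M w).toNNReal ht
  rw [← multivariateGaussian_map_inner hM w, Measure.map_apply (by fun_prop)
    (measurableSet_lt (by fun_prop) (by fun_prop)),
    Real.coe_toNNReal _ (quadForm_nonneg hM w)] at h
  exact h

lemma integral_mul_coord (hM : M.PosSemidef) (i j : Fin d) :
    ∫ x, x i * x j ∂multivariateGaussian m M = m i * m j + M i j := by
  have h := covariance_eval_multivariateGaussian (μ := m) hM i j
  have hmem : ∀ i : Fin d, MemLp (fun x : EuclideanSpace ℝ (Fin d) => x i) 2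
      (multivariateGaussian m M) := fun i =>
    ((IsGaussian.hasGaussianLaw_id (μ := multivariateGaussian m M)).map_fun
      (EuclideanSpace.proj i)).memLp_two
  have hint : ∀ i : Fin d, ∫ x : EuclideanSpace ℝ (Fin d), x i ∂(multivariateGaussian m M) = m i := by
    intro i
    have := (EuclideanSpace.proj i : EuclideanSpace ℝ (Fin d) →L[ℝ] ℝ).integral_comp_id_comm
      (μ := multivariateGaussian m M) IsGaussian.integrable_id
    rw [integral_id_multivariateGaussian] at this
    exact this
  rw [covariance_eq_sub (hmem i) (hmem j), hint, hint] at h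
  have h2 : ∫ x, x i * x j ∂multivariateGaussian m M
      = (multivariateGaussian m M)[(fun x : EuclideanSpace ℝ (Fin d) => x i) *
        (fun x : EuclideanSpace ℝ (Fin d) => x j)] := rfl
  rw [h2]; linarith

lemma integrable_mul_coord (i j : Fin d) :
    Integrable (fun x : EuclideanSpace ℝ (Fin d) => x i * x j) (multivariateGaussian m M) := by
  have hmem : ∀ i : Fin d, MemLp (fun x : EuclideanSpace ℝ (Fin d) => x i) 2
      (multivariateGaussian m M) := fun i =>
    ((IsGaussian.hasGaussianLaw_id (μ := multivariateGaussian m M)).map_fun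
      (EuclideanSpace.proj i)).memLp_two
  exact (hmem i).integrable_mul (hmem j)

lemma lintegral_quadForm {A : Matrix (Fin d) (Fin d) ℝ} (hA : A.PosSemidef) (hM : M.PosSemidef) :
    ∫⁻ x, ENNReal.ofReal (quadForm A x) ∂multivariateGaussian m M
      = ENNReal.ofReal (quadForm A m + (A * M).trace) := by
  have hint2 : ∀ i j, Integrable (fun x : EuclideanSpace ℝ (Fin d) => A i j * (x i * x j))
      (multivariateGaussian m M) := fun i j => (integrable_mul_coord i j).const_mul _
  have hint1 : ∀ i, Integrable (fun x : EuclideanSpace ℝ (Fin d) => ∑ j, A i j * (x i * x j))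
      (multivariateGaussian m M) := fun i => integrable_finsetSum _ fun j _ => hint2 i j
  have hint : Integrable (fun x => quadForm A x) (multivariateGaussian m M) := by
    simp only [quadForm_eq_sum]
    exact integrable_finsetSum _ fun i _ => hint1 i
  rw [← ofReal_integral_eq_lintegral_ofReal hint (ae_of_all _ fun x => quadForm_nonneg hA x)]
  congr 1
  simp only [quadForm_eq_sum]
  rw [integral_finsetSum _ fun i _ => hint1 i]
  simp only [integral_finsetSum _ fun j _ => hint2 _ j,
    integral_const_mul, integral_mul_coord hM, mul_add, Finset.sum_add_distrib]
  congr 1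
  simp only [trace, diag, mul_apply]
  refine Finset.sum_congr rfl fun i _ => Finset.sum_congr rfl fun j _ => ?_
  have := hM.isHermitian.apply i j
  simp only [star_trivial] at this
  rw [this]

lemma quadForm_one (w : EuclideanSpace ℝ (Fin d)) : quadForm 1 w = ‖w‖ ^ 2 := by
  simp [quadForm]

lemma lintegral_norm_sub_sq (hM : M.PosSemidef) (a : EuclideanSpace ℝ (Fin d)) :
    ∫⁻ x, ENNReal.ofReal (‖x - a‖ ^ 2) ∂multivariateGaussian m M
      = ENNReal.ofReal (‖m - a‖ ^ 2 + M.trace) := by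
  have h := lintegral_quadForm (m := m - a) (M := M) PosSemidef.one hM
  rw [← multivariateGaussian_map_sub, lintegral_map (by fun_prop) (by fun_prop)] at h
  simpa only [quadForm_one, one_mul] using h

/-- The coordinates of a Gaussian vector in an eigenbasis of its covariance are independent, so
that the variance of its squared norm is the sum of the variances of their squares. -/
lemma lintegral_abs_norm_sq_sub_trace_le (hM : M.PosSemidef) :
    ∫⁻ x, ENNReal.ofReal |‖x‖ ^ 2 - M.trace| ∂multivariateGaussian 0 M
      ≤ ENNReal.ofReal (7 * √(M * M).trace) := by
  set γ := multivariateGaussian 0 M with hγ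
  set b := hM.isHermitian.eigenvectorBasis with hb
  have hcov : ∀ x y, cov[fun u => inner ℝ x u, fun u => inner ℝ y u; γ]
      = inner ℝ x (toEuclideanCLM (n := Fin d) (𝕜 := ℝ) M y) := by
    intro x y
    rw [Matrix.inner_toEuclideanCLM, ← covarianceBilin_multivariateGaussian (μ := 0) hM,
      covarianceBilin_apply_eq_cov IsGaussian.memLp_two_id]
  have hind : iIndepFun (fun i x => inner ℝ (b i) x) γ := by
    refine HasGaussianLaw.iIndepFun_of_covariance_eq_zero ?_ ?_
    · exact (IsGaussian.hasGaussianLaw_id (μ := γ)).map_fun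
        (ContinuousLinearMap.pi fun i => innerSL ℝ (b i))
    · intro i j hij
      rw [hcov, toEuclideanCLM_eigenvectorBasis, inner_smul_right,
        b.orthonormal.2 hij, mul_zero]
  have hmem : ∀ i, MemLp (fun x => inner ℝ (b i) x ^ 2) 2 γ := by
    intro i
    rw [memLp_two_iff_integrable_sq (by fun_prop)]
    have := integrable_inner_pow hM (b i) 4
    simpa [← pow_mul] using this
  have hsum : (fun x : EuclideanSpace ℝ (Fin d) => ‖x‖ ^ 2) =
      ∑ i, fun x => inner ℝ (b i) x ^ 2 := by
    ext x
    rw [Finset.sum_apply, b.sum_sq_inner_right]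
  have hvar : Var[fun x => ‖x‖ ^ 2; γ] ≤ 49 * (M * M).trace := by
    rw [hsum, IndepFun.variance_sum (fun i _ => hmem i)]
    · rw [trace_mul_self_eq_sum_eigenvalues hM.isHermitian, Finset.mul_sum]
      refine Finset.sum_le_sum fun i _ => ?_
      calc Var[fun x => inner ℝ (b i) x ^ 2; γ]
          ≤ ∫ x, (inner ℝ (b i) x ^ 2) ^ 2 ∂γ := variance_le_expectation_sq (by fun_prop)
        _ = ∫ x, inner ℝ (b i) x ^ 4 ∂γ := by simp only [← pow_mul]
        _ ≤ 40 * quadForm M (b i) ^ 2 := integral_inner_pow_four_le hM _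
        _ ≤ _ := by
            rw [hb, quadForm_eigenvectorBasis]
            nlinarith [sq_nonneg (hM.isHermitian.eigenvalues i)]
    · intro i _ j _ hij
      exact (hind.indepFun hij).comp (φ := fun x : ℝ => x ^ 2) (ψ := fun x : ℝ => x ^ 2)
        (by fun_prop) (by fun_prop)
  have hmemn : MemLp (fun x : EuclideanSpace ℝ (Fin d) => ‖x‖ ^ 2) 2 γ := by
    rw [hsum]; exact memLp_finsetSum' _ fun i _ => hmem i
  have hmean : ∫ x, ‖x‖ ^ 2 ∂γ = M.trace := by
    have hi : Integrable (fun x : EuclideanSpace ℝ (Fin d) => ‖x‖ ^ 2) γ :=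
      hmemn.integrable (by norm_num)
    have h := lintegral_norm_sub_sq (m := 0) hM 0
    simp only [sub_zero] at h
    rw [← hγ, ← ofReal_integral_eq_lintegral_ofReal hi (ae_of_all _ fun x => sq_nonneg _),
      ENNReal.ofReal_eq_ofReal_iff (integral_nonneg fun x => sq_nonneg _)
        (by have := hM.trace_nonneg; positivity)] at h
    simpa using h
  have hmem2 : MemLp (fun x : EuclideanSpace ℝ (Fin d) => ‖x‖ ^ 2 - M.trace) 2 γ :=
    hmemn.sub (memLp_const _)
  have hint : Integrable (fun x : EuclideanSpace ℝ (Fin d) => ‖x‖ ^ 2 - M.trace) γ :=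
    hmem2.integrable (by norm_num)
  rw [← ofReal_integral_eq_lintegral_ofReal hint.abs (ae_of_all _ fun x => abs_nonneg _)]
  refine ENNReal.ofReal_le_ofReal ?_
  have hsq : (∫ x, |‖x‖ ^ 2 - M.trace| ∂γ) ^ 2 ≤ 49 * (M * M).trace := by
    have h1 := variance_nonneg (fun x : EuclideanSpace ℝ (Fin d) => |‖x‖ ^ 2 - M.trace|) γ
    rw [variance_eq_sub (X := fun x : EuclideanSpace ℝ (Fin d) => |‖x‖ ^ 2 - M.trace|) hmem2.abs] at h1
    have h2 : γ[(fun x : EuclideanSpace ℝ (Fin d) => |‖x‖ ^ 2 - M.trace|) ^ 2]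
        = Var[fun x => ‖x‖ ^ 2; γ] := by
      rw [variance_eq_integral (by fun_prop), hmean]
      simp only [Pi.pow_apply, sq_abs]
    linarith
  have h0 := trace_mul_self_nonneg hM
  refine abs_le_of_sq_le_sq' ?_ (by positivity) |>.2
  rw [mul_pow, Real.sq_sqrt h0]
  linarith

end Multivariate

/-! ### Minimisers of a penalised quadratic function over the simplex -/

section Deterministic

lemma abs_sub_le_one_of_mem_stdSimplex {ι : Type*} [Fintype ι] (o : ι) {w z : ι → ℝ}
    (hw : w ∈ stdSimplex ℝ ι) (hz : z ∈ stdSimplex ℝ ι) : |w o - z o| ≤ 1 := by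
  have h1 := hw.1 o
  have h2 := hz.1 o
  have h3 : w o ≤ 1 := hw.2 ▸ Finset.single_le_sum (fun k _ => hw.1 k) (Finset.mem_univ o)
  have h4 : z o ≤ 1 := hz.2 ▸ Finset.single_le_sum (fun k _ => hz.1 k) (Finset.mem_univ o)
  rw [abs_le]; constructor <;> linarith

variable {ι : Type*} [Fintype ι] [DecidableEq ι]
  {E : Type*} [NormedAddCommGroup E] [InnerProductSpace ℝ E]

/-- If `w` minimises a quadratic function over the simplex, its value at a competitor `z` exceeds
the minimum by at least the quadratic part of the function at `z - w`.  The outcome is stated for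
the squared norm of `∑ k, w k • m k`, with `m o` playing the part of the noise of the target. -/
lemma norm_sq_le_of_isMinOn (o : ι) (m : ι → E) (s : ℝ) (p w z : ι → ℝ)
    (hw : w ∈ stdSimplex ℝ ι) (hz : z ∈ stdSimplex ℝ ι)
    (hmin : IsMinOn (fun v : ι → ℝ => ‖∑ k ∈ Finset.univ.erase o, v k • (m k - m o)‖ ^ 2
      + (2 * v o - 1) * s + ∑ k ∈ Finset.univ.erase o, v k * p k) (stdSimplex ℝ ι) w) :
    ‖∑ k, w k • m k‖ ^ 2 + ‖∑ k, (w k - z k) • m k‖ ^ 2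
      ≤ ‖∑ k, z k • m k‖ ^ 2 + 2 * inner ℝ (∑ k, (w k - z k) • m k) (m o)
        - 2 * (w o - z o) * s + ∑ k ∈ Finset.univ.erase o, z k * p k
        - ∑ k ∈ Finset.univ.erase o, w k * p k := by
  set F : (ι → ℝ) → E := fun v => ∑ k ∈ Finset.univ.erase o, v k • (m k - m o) with hF
  set l : (ι → ℝ) → ℝ := fun v => ∑ k ∈ Finset.univ.erase o, v k * p k with hl
  have hFs : ∀ v : ι → ℝ, F v = ∑ k, v k • m k - (∑ k, v k) • m o := by
    intro v
    have : F v = ∑ k, v k • (m k - m o) := by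
      rw [← Finset.add_sum_erase _ _ (Finset.mem_univ o)]; simp [hF]
    rw [this]
    simp only [smul_sub, Finset.sum_sub_distrib, Finset.sum_smul]
  have hlin : ∀ t : ℝ, F (w + t • (z - w)) = F w + t • F (z - w) := by
    intro t
    simp only [hF, Finset.smul_sum, ← Finset.sum_add_distrib, smul_smul, ← add_smul]
    rfl
  have hllin : ∀ t : ℝ, l (w + t • (z - w)) = l w + t * l (z - w) := by
    intro t
    simp only [hl, Finset.mul_sum, ← Finset.sum_add_distrib]
    refine Finset.sum_congr rfl fun k _ => ?_
    simp only [Pi.add_apply, Pi.smul_apply, Pi.sub_apply, smul_eq_mul]; ring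
  set c : ℝ := 2 * inner ℝ (F w) (F (z - w)) + 2 * (z o - w o) * s + l (z - w) with hc
  set q : ℝ := ‖F (z - w)‖ ^ 2 with hq
  have hexp : ∀ t : ℝ, 0 < t → t ≤ 1 → 0 ≤ c + t * q := by
    intro t ht0 ht1
    have hmem : w + t • (z - w) ∈ stdSimplex ℝ ι :=
      (convex_stdSimplex ℝ ι).add_smul_sub_mem hw hz ⟨ht0.le, ht1⟩
    have h := hmin hmem
    simp only [Set.mem_ofPred_eq] at h
    change ‖F w‖ ^ 2 + (2 * w o - 1) * s + l w ≤ ‖F (w + t • (z - w))‖ ^ 2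
      + (2 * (w + t • (z - w)) o - 1) * s + l (w + t • (z - w)) at h
    rw [hlin, hllin, norm_add_sq_real, inner_smul_right, norm_smul, mul_pow,
      Real.norm_eq_abs, sq_abs] at h
    simp only [Pi.add_apply, Pi.smul_apply, Pi.sub_apply, smul_eq_mul] at h
    have h2 : 0 ≤ t * (c + t * q) := by rw [hc, hq]; nlinarith
    exact nonneg_of_mul_nonneg_right h2 ht0
  have hq0 : 0 ≤ q := by positivity
  have hc0 : 0 ≤ c := by
    by_contra! hneg
    have hpos : 0 < q - 2 * c := by linarith
    have h := hexp (-c / (q - 2 * c)) (by apply div_pos <;> linarith)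
      (by rw [div_le_one hpos]; linarith)
    have hne := hpos.ne'
    have h2 : c + -c / (q - 2 * c) * q = -2 * c ^ 2 / (q - 2 * c) := by
      rw [eq_div_iff hne, add_mul, div_mul_eq_mul_div, div_mul_cancel₀ _ hne]; ring
    rw [h2] at h
    have h3 : -2 * c ^ 2 / (q - 2 * c) < 0 := div_neg_of_neg_of_pos (by nlinarith) hpos
    linarith
  have hD : F (z - w) = -∑ k, (w k - z k) • m k := by
    rw [hFs]
    have : ∑ k, (z - w) k = 0 := by simp [Finset.sum_sub_distrib, hw.2, hz.2]
    rw [this, zero_smul, sub_zero, ← Finset.sum_neg_distrib]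
    refine Finset.sum_congr rfl fun k _ => ?_
    rw [← neg_smul]; congr 1; simp
  have hFw : F w = ∑ k, w k • m k - m o := by rw [hFs, hw.2, one_smul]
  have hzw : ∑ k, z k • m k = ∑ k, w k • m k - ∑ k, (w k - z k) • m k := by
    simp only [sub_smul, Finset.sum_sub_distrib]; abel
  have hlz : l (z - w) = l z - l w := by
    simp only [hl, ← Finset.sum_sub_distrib]
    refine Finset.sum_congr rfl fun k _ => ?_
    simp only [Pi.sub_apply]; ring
  rw [hD, hFw, hlz, inner_neg_right, inner_sub_left] at hc
  rw [hzw, norm_sub_sq_real, real_inner_comm (m o)]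
  change _ ≤ _ + l z - l w
  nlinarith

variable (o : ι) (m : ι → E) (s : ℝ) (p w z : ι → ℝ)

lemma inner_sum_sub_smul_eq : inner ℝ (∑ k, (w k - z k) • m k) (m o)
      = (w o - z o) * ‖m o‖ ^ 2
        + ∑ k ∈ Finset.univ.erase o, (w k - z k) * inner ℝ (m k) (m o) := by
  rw [sum_inner, ← Finset.add_sum_erase _ _ (Finset.mem_univ o)]
  simp only [real_inner_smul_left, real_inner_self_eq_norm_sq]

variable {w z}

/-- When the penalties dominate the noise, the cross terms of the minimiser are absorbed. -/
lemma norm_sq_le_of_isMinOn_of_inner_le (hw : w ∈ stdSimplex ℝ ι) (hz : z ∈ stdSimplex ℝ ι)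
    (hmin : IsMinOn (fun v : ι → ℝ => ‖∑ k ∈ Finset.univ.erase o, v k • (m k - m o)‖ ^ 2
      + (2 * v o - 1) * s + ∑ k ∈ Finset.univ.erase o, v k * p k) (stdSimplex ℝ ι) w)
    {e : ℝ} (he : 0 ≤ e) (hgood : ∀ k ≠ o, 2 * inner ℝ (m k) (m o) ≤ p k + e) :
    ‖∑ k, w k • m k‖ ^ 2 ≤ ‖∑ k, z k • m k‖ ^ 2
      + 2 * (∑ k ∈ Finset.univ.erase o, z k * |inner ℝ (m k) (m o)|)
      + ∑ k ∈ Finset.univ.erase o, z k * p k + e + 2 * |‖m o‖ ^ 2 - s| := by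
  have h := norm_sq_le_of_isMinOn o m s p w z hw hz hmin
  rw [inner_sum_sub_smul_eq] at h
  simp only [sub_mul, Finset.sum_sub_distrib] at h
  have h1 : 2 * (∑ k ∈ Finset.univ.erase o, w k * inner ℝ (m k) (m o))
      ≤ ∑ k ∈ Finset.univ.erase o, w k * p k + e := by
    have hle : ∑ k ∈ Finset.univ.erase o, w k ≤ 1 :=
      hw.2 ▸ Finset.sum_le_sum_of_subset_of_nonneg (Finset.erase_subset _ _)
        fun k _ _ => hw.1 k
    calc 2 * (∑ k ∈ Finset.univ.erase o, w k * inner ℝ (m k) (m o))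
        = ∑ k ∈ Finset.univ.erase o, w k * (2 * inner ℝ (m k) (m o)) := by
          rw [Finset.mul_sum]; exact Finset.sum_congr rfl fun k _ => by ring
      _ ≤ ∑ k ∈ Finset.univ.erase o, w k * (p k + e) :=
          Finset.sum_le_sum fun k hk =>
            mul_le_mul_of_nonneg_left (hgood k (Finset.ne_of_mem_erase hk)) (hw.1 k)
      _ = ∑ k ∈ Finset.univ.erase o, w k * p k + (∑ k ∈ Finset.univ.erase o, w k) * e := by
          simp only [mul_add, Finset.sum_add_distrib, Finset.sum_mul]
      _ ≤ _ := by nlinarith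
  have h2 : -(∑ k ∈ Finset.univ.erase o, z k * inner ℝ (m k) (m o))
      ≤ ∑ k ∈ Finset.univ.erase o, z k * |inner ℝ (m k) (m o)| := by
    rw [← Finset.sum_neg_distrib]
    refine Finset.sum_le_sum fun k _ => ?_
    rw [← mul_neg]
    exact mul_le_mul_of_nonneg_left (neg_le_abs _) (hz.1 k)
  have h3 : (w o - z o) * (‖m o‖ ^ 2 - s) ≤ |‖m o‖ ^ 2 - s| := by
    calc _ ≤ |(w o - z o) * (‖m o‖ ^ 2 - s)| := le_abs_self _
      _ = |w o - z o| * |‖m o‖ ^ 2 - s| := abs_mul _ _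
      _ ≤ 1 * |‖m o‖ ^ 2 - s| := by
          gcongr; exact abs_sub_le_one_of_mem_stdSimplex o hw hz
      _ = _ := one_mul _
  nlinarith [sq_nonneg ‖∑ k, (w k - z k) • m k‖]

/-- Unconditionally, the cross terms are dominated by the quadratic part, at the price of the squared
norm of the projection of the noise on the span of the other means. -/
lemma norm_sq_le_of_isMinOn_of_projection (hw : w ∈ stdSimplex ℝ ι) (hz : z ∈ stdSimplex ℝ ι)
    (hp : ∀ k, 0 ≤ p k)
    (hmin : IsMinOn (fun v : ι → ℝ => ‖∑ k ∈ Finset.univ.erase o, v k • (m k - m o)‖ ^ 2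
      + (2 * v o - 1) * s + ∑ k ∈ Finset.univ.erase o, v k * p k) (stdSimplex ℝ ι) w)
    {Y : ℝ} (hY0 : 0 ≤ Y)
    (hY : ∀ c : ι → ℝ, inner ℝ (∑ k ∈ Finset.univ.erase o, c k • m k) (m o) ^ 2
      ≤ Y * ‖∑ k ∈ Finset.univ.erase o, c k • m k‖ ^ 2) :
    ‖∑ k, w k • m k‖ ^ 2 ≤ ‖∑ k, z k • m k‖ ^ 2
      + ∑ k ∈ Finset.univ.erase o, z k * p k + 2 * |‖m o‖ ^ 2 - s| + 4 * Y := by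
  have h := norm_sq_le_of_isMinOn o m s p w z hw hz hmin
  set D' : E := ∑ k ∈ Finset.univ.erase o, (w k - z k) • m k with hD'
  have hD : ∑ k, (w k - z k) • m k = (w o - z o) • m o + D' := by
    rw [← Finset.add_sum_erase _ _ (Finset.mem_univ o)]
  set a : ℝ := w o - z o with ha
  have habs : |a| ≤ 1 := abs_sub_le_one_of_mem_stdSimplex o hw hz
  have hab := abs_le.1 habs
  have hpw : 0 ≤ ∑ k ∈ Finset.univ.erase o, w k * p k :=
    Finset.sum_nonneg fun k _ => mul_nonneg (hw.1 k) (hp k)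
  have hYD := hY (fun k => w k - z k)
  change inner ℝ D' (m o) ^ 2 ≤ Y * ‖D'‖ ^ 2 at hYD
  rw [hD, inner_add_left, norm_add_sq_real, inner_smul_left, inner_smul_left,
    real_inner_self_eq_norm_sq, norm_smul, mul_pow, Real.norm_eq_abs, sq_abs,
    real_inner_comm] at h
  simp only [conj_trivial] at h
  set g := inner ℝ D' (m o) with hg
  have h3 : a * (‖m o‖ ^ 2 - s) ≤ |‖m o‖ ^ 2 - s| := by
    calc _ ≤ |a * (‖m o‖ ^ 2 - s)| := le_abs_self _
      _ = |a| * |‖m o‖ ^ 2 - s| := abs_mul _ _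
      _ ≤ 1 * |‖m o‖ ^ 2 - s| := by gcongr
      _ = _ := one_mul _
  -- Young's inequality, with a factor `(1 - a) ^ 2 ≤ 4`
  have h4 : 2 * (1 - a) * g ≤ ‖D'‖ ^ 2 + 4 * Y := by
    have hb : ((1 - a) * g) ^ 2 ≤ (4 * Y) * ‖D'‖ ^ 2 := by
      rw [mul_pow]
      have : (1 - a) ^ 2 ≤ 4 := by nlinarith
      calc (1 - a) ^ 2 * g ^ 2 ≤ 4 * g ^ 2 := by gcongr
        _ ≤ _ := by nlinarith
    have : |(2 * (1 - a) * g)| ≤ ‖D'‖ ^ 2 + 4 * Y := by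
      refine abs_le_of_sq_le_sq ?_ (by positivity)
      nlinarith [sq_nonneg (‖D'‖ ^ 2 - 4 * Y)]
    exact (le_abs_self _).trans this
  nlinarith [sq_nonneg a, sq_nonneg ‖m o‖, mul_nonneg (sq_nonneg a) (sq_nonneg ‖m o‖)]

end Deterministic

/-! ### The mean and the residuals of a Gaussian sample -/

section Sample

variable {d : ℕ} {Ω : Type*} [MeasurableSpace Ω] {P : Measure Ω}

/-- Linear combinations of independent Gaussian vectors are Gaussian. -/
lemma hasLaw_sum_smul_multivariateGaussian {κ : Type*} [Fintype κ]
    {X : κ → Ω → EuclideanSpace ℝ (Fin d)} {m : κ → EuclideanSpace ℝ (Fin d)}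
    {M : κ → Matrix (Fin d) (Fin d) ℝ} (hM : ∀ k, (M k).PosSemidef)
    (hX : ∀ k, HasLaw (X k) (multivariateGaussian (m k) (M k)) P) (hind : iIndepFun X P)
    (c : κ → ℝ) :
    HasLaw (fun ω => ∑ k, c k • X k ω)
      (multivariateGaussian (∑ k, c k • m k) (∑ k, c k ^ 2 • M k)) P := by
  have hae : ∀ k, AEMeasurable (fun ω => c k • X k ω) P :=
    fun k => (hX k).aemeasurable.const_smul (c k)
  have : IsProbabilityMeasure P := hind.isProbabilityMeasure
  have hsum : AEMeasurable (fun ω => ∑ k, c k • X k ω) P :=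
    Finset.aemeasurable_fun_sum _ fun k _ => hae k
  refine ⟨hsum, ?_⟩
  have : IsProbabilityMeasure (P.map fun ω => ∑ k, c k • X k ω) :=
    Measure.isProbabilityMeasure_map hsum
  have hpsd : (∑ k, c k ^ 2 • M k).PosSemidef :=
    Matrix.posSemidef_sum _ fun k _ => (hM k).smul (sq_nonneg (c k))
  refine Measure.ext_of_charFun ?_
  have hind' : iIndepFun (fun k ω => c k • X k ω) P :=
    hind.comp (fun k x => c k • x) fun k => measurable_const_smul (c k)
  rw [iIndepFun.charFun_map_fun_sum_eq_prod hae hind']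
  ext t
  rw [Finset.prod_apply, charFun_multivariateGaussian hpsd]
  have hk : ∀ k, charFun (P.map fun ω => c k • X k ω) t
      = Complex.exp ((c k * inner ℝ t (m k) : ℝ) * Complex.I
        - (c k ^ 2 * quadForm (M k) t : ℝ) / 2) := by
    intro k
    rw [charFun_map_smul_comp (hX k).aemeasurable, (hX k).map_eq,
      charFun_multivariateGaussian (hM k), ← quadForm_eq_dotProduct]
    congr 2
    · rw [real_inner_smul_left]
    · congr 2
      simp only [quadForm, map_smul, real_inner_smul_left, real_inner_smul_right]
      ring
  simp only [hk]
  rw [← Complex.exp_sum, ← quadForm_eq_dotProduct, Finset.sum_sub_distrib, ← Finset.sum_mul,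
    ← Finset.sum_div, ← Complex.ofReal_sum, ← Complex.ofReal_sum]
  congr 3
  · rw [inner_sum]; simp only [real_inner_smul_right]
  · congr 1
    simp only [quadForm, map_sum, map_smul, _root_.sum_apply, inner_sum,
      _root_.smul_apply, real_inner_smul_right]

/-- The empirical mean of a bag of points. -/
noncomputable def bagMean {N : ℕ} (y : Fin N → EuclideanSpace ℝ (Fin d)) :
    EuclideanSpace ℝ (Fin d) :=
  (N : ℝ)⁻¹ • ∑ i, y i

/-- The deviations of the points of a bag from their empirical mean. -/
noncomputable def bagResidual {N : ℕ} (y : Fin N → EuclideanSpace ℝ (Fin d)) :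
    Fin N → EuclideanSpace ℝ (Fin d) :=
  fun i => y i - bagMean y

@[fun_prop]
lemma measurable_bagMean {N : ℕ} :
    Measurable (bagMean : (Fin N → EuclideanSpace ℝ (Fin d)) → _) := by
  unfold bagMean; fun_prop

@[fun_prop]
lemma measurable_bagResidual {N : ℕ} :
    Measurable (bagResidual : (Fin N → EuclideanSpace ℝ (Fin d)) → _) := by
  unfold bagResidual; fun_prop

lemma sum_eq_smul_bagMean {N : ℕ} (hN : 0 < N) (y : Fin N → EuclideanSpace ℝ (Fin d)) :
    ∑ i, y i = (N : ℝ) • bagMean y := by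
  have : (N : ℝ) ≠ 0 := by positivity
  rw [bagMean, smul_smul, mul_inv_cancel₀ this, one_smul]

lemma sum_inner_residual_sq {N : ℕ} (hN : 0 < N) (y : Fin N → EuclideanSpace ℝ (Fin d))
    (w : EuclideanSpace ℝ (Fin d)) :
    ∑ i, inner ℝ w (bagResidual y i) ^ 2
      = ∑ i, inner ℝ w (y i) ^ 2 - N * inner ℝ w (bagMean y) ^ 2 := by
  have h : ∑ i, inner ℝ w (y i) = N * inner ℝ w (bagMean y) := by
    rw [← inner_sum, sum_eq_smul_bagMean hN, inner_smul_right]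
  simp only [bagResidual, inner_sub_right, sub_sq, Finset.sum_add_distrib, Finset.sum_sub_distrib,
    ← Finset.sum_mul, mul_assoc, ← Finset.mul_sum, h]
  simp
  ring

lemma sum_norm_residual_sq {N : ℕ} (hN : 0 < N) (y : Fin N → EuclideanSpace ℝ (Fin d)) :
    ∑ i, ‖bagResidual y i‖ ^ 2 = ∑ i, ‖y i‖ ^ 2 - N * ‖bagMean y‖ ^ 2 := by
  have h : ∑ i, inner ℝ (y i) (bagMean y) = N * ‖bagMean y‖ ^ 2 := by
    rw [← sum_inner, sum_eq_smul_bagMean hN, real_inner_smul_left, real_inner_self_eq_norm_sq]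
  simp only [bagResidual, norm_sub_sq_real, Finset.sum_add_distrib, Finset.sum_sub_distrib,
    ← Finset.mul_sum, h]
  simp
  ring

variable {N : ℕ} {S : Matrix (Fin d) (Fin d) ℝ} {Y : Fin N → Ω → EuclideanSpace ℝ (Fin d)}

lemma hasLaw_bagMean (hN : 0 < N) (hS : S.PosSemidef)
    (hY : ∀ i, HasLaw (Y i) (multivariateGaussian 0 S) P) (hind : iIndepFun Y P) :
    HasLaw (fun ω => bagMean fun i => Y i ω) (multivariateGaussian 0 ((N : ℝ)⁻¹ • S)) P := by
  have h := hasLaw_sum_smul_multivariateGaussian (fun _ => hS) hY hind fun _ => (N : ℝ)⁻¹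
  have hN' : (N : ℝ) ≠ 0 := by positivity
  have e1 : ∑ _k : Fin N, ((N : ℝ)⁻¹) ^ 2 • S = (N : ℝ)⁻¹ • S := by
    rw [Finset.sum_const, Finset.card_univ, Fintype.card_fin, ← Nat.cast_smul_eq_nsmul ℝ, smul_smul]
    congr 1; field_simp
  rw [e1] at h
  simpa only [smul_zero, Finset.sum_const_zero, bagMean, Finset.smul_sum] using h

/-- The mean and the residuals of a Gaussian sample are jointly Gaussian and uncorrelated. -/
lemma indepFun_bagMean_residual (hN : 0 < N)
    (hY : ∀ i, HasLaw (Y i) (multivariateGaussian 0 S) P) (hind : iIndepFun Y P) :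
    IndepFun (fun ω => bagMean fun i => Y i ω) (fun ω => bagResidual fun i => Y i ω) P := by
  have : IsProbabilityMeasure P := hind.isProbabilityMeasure
  have hN' : (N : ℝ) ≠ 0 := by positivity
  let pr : Fin N → (Fin N → EuclideanSpace ℝ (Fin d)) →L[ℝ] EuclideanSpace ℝ (Fin d) :=
    ContinuousLinearMap.proj
  let Lm : (Fin N → EuclideanSpace ℝ (Fin d)) →L[ℝ] EuclideanSpace ℝ (Fin d) :=
    (N : ℝ)⁻¹ • ∑ i, pr i
  have hLm : ∀ y, Lm y = bagMean y := fun y => by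
    simp [Lm, pr, bagMean, _root_.sum_apply]
  have hG : HasGaussianLaw (fun ω i => Y i ω) P :=
    hind.hasGaussianLaw fun i => (hY i).hasGaussianLaw
  have hpair : HasGaussianLaw
      (fun ω => (bagMean fun i => Y i ω, bagResidual fun i => Y i ω)) P := by
    have h := hG.map_fun (Lm.prod (ContinuousLinearMap.pi fun i => pr i - Lm))
    have e : (fun ω => (bagMean fun i => Y i ω, bagResidual fun i => Y i ω))
        = fun ω => Lm.prod (ContinuousLinearMap.pi fun i => pr i - Lm) fun i => Y i ω := by
      ext1 ω
      refine Prod.ext (hLm _).symm ?_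
      ext1 i
      change _ = Y i ω - Lm fun i => Y i ω
      rw [hLm]; rfl
    rw [e]
    exact h
  refine hpair.indepFun_of_covariance_strongDual fun L₁ L₂ => ?_
  let G₀ : Fin N → StrongDual ℝ (EuclideanSpace ℝ (Fin d)) := fun i =>
    L₂.comp (ContinuousLinearMap.single ℝ (fun _ : Fin N => EuclideanSpace ℝ (Fin d)) i)
  have hL₂ : ∀ z, L₂ z = ∑ i, G₀ i (z i) := by
    intro z
    simp only [G₀, ContinuousLinearMap.comp_apply, ← map_sum]
    congr 1
    exact (Finset.univ_sum_single z).symm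
  let G : Fin N → StrongDual ℝ (EuclideanSpace ℝ (Fin d)) := fun i =>
    G₀ i - (N : ℝ)⁻¹ • ∑ l, G₀ l
  have hGsum : ∑ i, G i = 0 := by
    simp only [G, Finset.sum_sub_distrib, Finset.sum_const, Finset.card_univ, Fintype.card_fin]
    rw [← Nat.cast_smul_eq_nsmul ℝ, smul_smul, mul_inv_cancel₀ hN', one_smul, sub_self]
  have e1 : L₁ ∘ (fun ω => bagMean fun i => Y i ω)
      = fun ω => ∑ j, (((N : ℝ)⁻¹ • L₁) ∘ Y j) ω := by
    ext ω
    simp [bagMean, Finset.mul_sum]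
  have e2 : L₂ ∘ (fun ω => bagResidual fun i => Y i ω) = fun ω => ∑ i, (G i ∘ Y i) ω := by
    ext ω
    simp only [Function.comp_apply, hL₂, bagResidual, map_sub, Finset.sum_sub_distrib, G,
      _root_.sub_apply]
    congr 1
    simp only [_root_.smul_apply, _root_.sum_apply, bagMean, map_smul,
      map_sum, ← Finset.smul_sum]
    rw [Finset.sum_comm]
  have hm1 : ∀ (L : StrongDual ℝ (EuclideanSpace ℝ (Fin d))) (i : Fin N), MemLp (L ∘ Y i) 2 P :=
    fun L i => ((hY i).hasGaussianLaw.map L).memLp_two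
  rw [e1, e2, covariance_fun_sum_fun_sum (fun j => hm1 _ j) (fun i => hm1 _ i)]
  have hterm : ∀ i j, cov[((N : ℝ)⁻¹ • L₁) ∘ Y i, G j ∘ Y j; P]
      = if i = j then cov[(N : ℝ)⁻¹ • L₁, G j; multivariateGaussian 0 S] else 0 := by
    intro i j
    split_ifs with hij
    · subst hij
      exact (hY i).covariance_comp (by fun_prop) (by fun_prop)
    · exact ((hind.indepFun hij).comp (by fun_prop) (by fun_prop)).covariance_eq_zero
        (hm1 _ _) (hm1 _ _)
  simp only [hterm, Finset.sum_ite_eq, Finset.mem_univ, if_true]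
  have hmem : ∀ L : StrongDual ℝ (EuclideanSpace ℝ (Fin d)),
      MemLp L 2 (multivariateGaussian 0 S) := fun L =>
    ((IsGaussian.hasGaussianLaw_id (μ := multivariateGaussian 0 S)).map L).memLp_two
  have hs := covariance_fun_sum_right (X := fun i => ⇑(G i)) (Y := ⇑((N : ℝ)⁻¹ • L₁))
    (μ := multivariateGaussian 0 S) (fun i => hmem _) (hmem _)
  have hz : (fun x => ∑ i, G i x) = fun _ => (0 : ℝ) := by
    ext x
    rw [← _root_.sum_apply, hGsum]; rfl
  rw [hz, covariance_const_right] at hs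
  exact hs.symm

/-- The Laplace transform of the residual sum of squares in the direction `w`: that of the sum of
squares, `N` factors, divided by that of the square of the mean, one factor. -/
lemma integral_exp_neg_sum_inner_residual_sq (hN : 0 < N) (hS : S.PosSemidef)
    (hY : ∀ i, HasLaw (Y i) (multivariateGaussian 0 S) P) (hind : iIndepFun Y P)
    (w : EuclideanSpace ℝ (Fin d)) {r : ℝ} (hr : 0 ≤ r) :
    ∫ ω, Real.exp (-(r * ∑ i, inner ℝ w (bagResidual (fun i => Y i ω) i) ^ 2)) ∂P
      = (√(1 + 2 * r * quadForm S w))⁻¹ ^ (N - 1) := by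
  have hN' : (N : ℝ) ≠ 0 := by positivity
  have hq := quadForm_nonneg hS w
  have hpos : 0 < √(1 + 2 * r * quadForm S w) := Real.sqrt_pos.2 (by positivity)
  have hgauss : ∀ {M : Matrix (Fin d) (Fin d) ℝ} (_ : M.PosSemidef) {Z : Ω → EuclideanSpace ℝ (Fin d)}
      (_ : HasLaw Z (multivariateGaussian 0 M) P) {r' : ℝ} (_ : 0 ≤ r'),
      ∫ ω, Real.exp (-(r' * inner ℝ w (Z ω) ^ 2)) ∂P = (√(1 + 2 * r' * quadForm M w))⁻¹ := by
    intro M hM Z hZ r' hr'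
    have h := integral_exp_neg_mul_sq_gaussianReal (quadForm M w).toNNReal hr'
    rw [← multivariateGaussian_map_inner hM w, integral_map (by fun_prop) (by fun_prop),
      Real.coe_toNNReal _ (quadForm_nonneg hM w)] at h
    rw [← h, ← hZ.integral_comp (by fun_prop)]
    rfl
  have haeY : AEMeasurable (fun ω i => Y i ω) P :=
    aemeasurable_pi_lambda _ fun i => (hY i).aemeasurable
  have h1 : ∫ ω, ∏ i, Real.exp (-(r * inner ℝ w (Y i ω) ^ 2)) ∂P
      = (√(1 + 2 * r * quadForm S w))⁻¹ ^ N := by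
    have hi : iIndepFun (fun i ω => Real.exp (-(r * inner ℝ w (Y i ω) ^ 2))) P :=
      hind.comp (fun _ x => Real.exp (-(r * inner ℝ w x ^ 2))) fun _ => by fun_prop
    rw [hi.integral_fun_prod_eq_prod_integral]
    · simp [hgauss hS (hY _) hr]
    · intro i
      have := (hY i).aemeasurable
      fun_prop
  have h2 : ∫ ω, ∏ i, Real.exp (-(r * inner ℝ w (Y i ω) ^ 2)) ∂P
      = (∫ ω, Real.exp (-(r * ∑ i, inner ℝ w (bagResidual (fun i => Y i ω) i) ^ 2)) ∂P)
        * ∫ ω, Real.exp (-(r * N * inner ℝ w (bagMean fun i => Y i ω) ^ 2)) ∂P := by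
    have hi : IndepFun
        (fun ω => Real.exp (-(r * ∑ i, inner ℝ w (bagResidual (fun i => Y i ω) i) ^ 2)))
        (fun ω => Real.exp (-(r * N * inner ℝ w (bagMean fun i => Y i ω) ^ 2))) P :=
      (indepFun_bagMean_residual hN hY hind).symm.comp
        (φ := fun z : Fin N → EuclideanSpace ℝ (Fin d) =>
          Real.exp (-(r * ∑ i, inner ℝ w (z i) ^ 2)))
        (ψ := fun x => Real.exp (-(r * N * inner ℝ w x ^ 2))) (by fun_prop) (by fun_prop)
    rw [← hi.integral_fun_mul_eq_mul_integral (AEMeasurable.aestronglyMeasurable (by fun_prop))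
      (AEMeasurable.aestronglyMeasurable (by fun_prop))]
    congr 1
    ext ω
    rw [← Real.exp_sum, ← Real.exp_add, sum_inner_residual_sq hN, Finset.sum_neg_distrib,
      ← Finset.mul_sum]
    congr 1
    ring
  have h3 := hgauss (hS.smul (inv_nonneg.2 (Nat.cast_nonneg N))) (hasLaw_bagMean hN hS hY hind)
    (mul_nonneg hr (Nat.cast_nonneg N))
  have h4 : 1 + 2 * (r * N) * quadForm ((N : ℝ)⁻¹ • S) w = 1 + 2 * r * quadForm S w := by
    rw [quadForm_smul]; field_simp
  rw [h4] at h3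
  rw [h1, h3] at h2
  obtain ⟨n, rfl⟩ := Nat.exists_eq_succ_of_ne_zero hN.ne'
  rw [pow_succ] at h2
  simpa using (mul_right_cancel₀ (inv_ne_zero hpos.ne') h2).symm

/-- Chernoff's bound for the lower tail of the `χ²` distribution, with the optimal exponent
`15 / (2 σ²)` for the threshold `1 / 16`. -/
lemma measure_sum_inner_residual_sq_lt_le (hN : 0 < N) (hS : S.PosSemidef)
    (hY : ∀ i, HasLaw (Y i) (multivariateGaussian 0 S) P) (hind : iIndepFun Y P)
    (w : EuclideanSpace ℝ (Fin d)) :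
    P {ω | ∑ i, inner ℝ w (bagResidual (fun i => Y i ω) i) ^ 2
        < 1 / 16 * ((N : ℝ) - 1) * quadForm S w}
      ≤ ENNReal.ofReal (Real.exp (-(3 / 4 * ((N : ℝ) - 1)))) := by
  have : IsProbabilityMeasure P := hind.isProbabilityMeasure
  have haeY : AEMeasurable (fun ω i => Y i ω) P :=
    aemeasurable_pi_lambda _ fun i => (hY i).aemeasurable
  rcases (quadForm_nonneg hS w).eq_or_lt with h0 | hq
  · have : {ω | ∑ i, inner ℝ w (bagResidual (fun i => Y i ω) i) ^ 2
        < 1 / 16 * ((N : ℝ) - 1) * quadForm S w} = ∅ := by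
      rw [← h0, mul_zero]
      refine Set.eq_empty_of_forall_notMem fun ω hω => ?_
      rw [Set.mem_ofPred_eq] at hω
      exact absurd hω (not_lt.2 (Finset.sum_nonneg fun i _ => sq_nonneg _))
    rw [this]; simp
  set Q : Ω → ℝ := fun ω => ∑ i, inner ℝ w (bagResidual (fun i => Y i ω) i) ^ 2 with hQ
  set v := quadForm S w with hv
  have hr : 0 ≤ 15 / (2 * v) := by positivity
  have hint : Integrable (fun ω => Real.exp (-(15 / (2 * v)) * Q ω)) P := by
    refine Integrable.mono' (integrable_const (1 : ℝ))
      (AEMeasurable.aestronglyMeasurable (by simp only [hQ]; fun_prop)) (ae_of_all _ fun ω => ?_)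
    rw [Real.norm_of_nonneg (Real.exp_nonneg _), Real.exp_le_one_iff, neg_mul]
    have : 0 ≤ Q ω := Finset.sum_nonneg fun i _ => sq_nonneg _
    simpa using mul_nonneg hr this
  have hch := measure_le_le_exp_mul_mgf (X := Q) (μ := P) (t := -(15 / (2 * v)))
    (1 / 16 * ((N : ℝ) - 1) * v) (by simpa using hr) hint
  have hmgf : mgf Q P (-(15 / (2 * v))) = (1 / 4) ^ (N - 1) := by
    have h := integral_exp_neg_sum_inner_residual_sq hN hS hY hind w hr
    have e : 1 + 2 * (15 / (2 * v)) * v = 4 ^ 2 := by field_simp; norm_num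
    rw [← hv, e, Real.sqrt_sq (by norm_num)] at h
    rw [mgf, one_div, ← h]
    congr 1; ext ω; simp only [neg_mul, hQ]
  obtain ⟨n, rfl⟩ := Nat.exists_eq_succ_of_ne_zero hN.ne'
  have hexp : Real.exp (-(-(15 / (2 * v))) * (1 / 16 * (((n + 1 : ℕ) : ℝ) - 1) * v))
      = Real.exp (15 / 32) ^ n := by
    rw [← Real.exp_nat_mul]
    congr 1
    push_cast
    field_simp
    ring
  rw [Nat.succ_eq_add_one, hmgf, hexp, Nat.succ_sub_one, ← mul_pow] at hch
  have hnum : Real.exp (15 / 32) * (1 / 4) ≤ Real.exp (-(3 / 4)) := by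
    have h1 : Real.exp (39 / 32) ≤ 4 := by
      have h2 : Real.exp (39 / 32) ^ 32 ≤ (4 : ℝ) ^ 32 := by
        rw [← Real.exp_nat_mul]
        have h3 := Real.exp_one_lt_d9
        calc Real.exp (((32 : ℕ) : ℝ) * (39 / 32)) = Real.exp 1 ^ 39 := by
              rw [← Real.exp_nat_mul]; norm_num
          _ ≤ 2.7182818286 ^ 39 := pow_le_pow_left₀ (Real.exp_nonneg _) h3.le _
          _ ≤ _ := by norm_num
      exact le_of_pow_le_pow_left₀ (by norm_num) (by norm_num) h2
    have h2 : Real.exp (15 / 32) = Real.exp (39 / 32) * Real.exp (-(3 / 4)) := by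
      rw [← Real.exp_add]; norm_num
    rw [h2]
    nlinarith [Real.exp_pos (-(3 / 4))]
  calc P {ω | Q ω < 1 / 16 * (((n + 1 : ℕ) : ℝ) - 1) * v}
      ≤ P {ω | Q ω ≤ 1 / 16 * (((n + 1 : ℕ) : ℝ) - 1) * v} :=
        measure_mono fun ω hω => by rw [Set.mem_ofPred_eq] at hω ⊢; exact hω.le
    _ = ENNReal.ofReal (P.real {ω | Q ω ≤ 1 / 16 * (((n + 1 : ℕ) : ℝ) - 1) * v}) := by
        simp [measureReal_def]
    _ ≤ ENNReal.ofReal ((Real.exp (15 / 32) * (1 / 4)) ^ n) := ENNReal.ofReal_le_ofReal hch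
    _ ≤ ENNReal.ofReal (Real.exp (-(3 / 4)) ^ n) := by gcongr
    _ = _ := by
        rw [← Real.exp_nat_mul]; congr 2; push_cast; ring

lemma lintegral_sum_inner_residual_sq_le (hN : 0 < N) (hS : S.PosSemidef)
    (hY : ∀ i, HasLaw (Y i) (multivariateGaussian 0 S) P) (w : EuclideanSpace ℝ (Fin d)) :
    ∫⁻ ω, ENNReal.ofReal (∑ i, inner ℝ w (bagResidual (fun i => Y i ω) i) ^ 2) ∂P
      ≤ ENNReal.ofReal (N * quadForm S w) := by
  calc _ ≤ ∫⁻ ω, ∑ i, ENNReal.ofReal (inner ℝ w (Y i ω) ^ 2) ∂P := by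
        refine lintegral_mono fun ω => ?_
        rw [← ENNReal.ofReal_sum_of_nonneg fun i _ => sq_nonneg _]
        refine ENNReal.ofReal_le_ofReal ?_
        rw [sum_inner_residual_sq hN]
        have : (0 : ℝ) ≤ N * inner ℝ w (bagMean fun i => Y i ω) ^ 2 := by positivity
        linarith
    _ = ∑ i, ∫⁻ ω, ENNReal.ofReal (inner ℝ w (Y i ω) ^ 2) ∂P := by
        refine lintegral_finsetSum' _ fun i _ => ?_
        have := (hY i).aemeasurable
        fun_prop
    _ = ∑ i : Fin N, ENNReal.ofReal (quadForm S w) := by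
        refine Finset.sum_congr rfl fun i _ => ?_
        rw [← lintegral_inner_sq hS, ← (hY i).lintegral_comp (by fun_prop)]
    _ = _ := by
        rw [Finset.sum_const, Finset.card_univ, Fintype.card_fin, nsmul_eq_mul,
          ENNReal.ofReal_mul (by positivity)]
        simp

/-- The squared norm of the error of the empirical mean is close to its usual estimate. -/
lemma lintegral_abs_norm_bagMean_sq_sub_le (hN : 2 ≤ N) (hS : S.PosSemidef)
    (hY : ∀ i, HasLaw (Y i) (multivariateGaussian 0 S) P) (hind : iIndepFun Y P) :
    ∫⁻ ω, ENNReal.ofReal |‖bagMean fun i => Y i ω‖ ^ 2 - 1 / ((N : ℝ) * ((N : ℝ) - 1))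
        * ∑ i, ‖bagResidual (fun i => Y i ω) i‖ ^ 2| ∂P
      ≤ ENNReal.ofReal (28 * √(S * S).trace / N) := by
  have hN0 : 0 < N := by lia
  have hN2 : (2 : ℝ) ≤ N := by exact_mod_cast hN
  have hN1 : 0 < (N : ℝ) - 1 := by linarith
  have hNp : 0 < (N : ℝ) := by linarith
  set g : ℝ := √(S * S).trace with hg
  have hg0 : 0 ≤ g := Real.sqrt_nonneg _
  set U : Ω → ℝ := fun ω => |‖bagMean fun i => Y i ω‖ ^ 2 - S.trace / N| with hU
  set W : Fin N → Ω → ℝ := fun i ω => |‖Y i ω‖ ^ 2 - S.trace| with hW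
  have haeY : AEMeasurable (fun ω i => Y i ω) P :=
    aemeasurable_pi_lambda _ fun i => (hY i).aemeasurable
  have hlW : ∀ i, ∫⁻ ω, ENNReal.ofReal (W i ω) ∂P ≤ ENNReal.ofReal (7 * g) := by
    intro i
    rw [(hY i).lintegral_comp (f := fun x => ENNReal.ofReal |‖x‖ ^ 2 - S.trace|) (by fun_prop)]
    exact lintegral_abs_norm_sq_sub_trace_le hS
  have hlU : ∫⁻ ω, ENNReal.ofReal (U ω) ∂P ≤ ENNReal.ofReal (7 * g / N) := by
    have h := lintegral_abs_norm_sq_sub_trace_le (hS.smul (inv_nonneg.2 hNp.le))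
    rw [← (hasLaw_bagMean hN0 hS hY hind).lintegral_comp (by fun_prop)] at h
    have e1 : ((N : ℝ)⁻¹ • S).trace = S.trace / N := by rw [trace_smul, smul_eq_mul]; ring
    have e2 : √(((N : ℝ)⁻¹ • S) * ((N : ℝ)⁻¹ • S)).trace = g / N := by
      rw [smul_mul_smul_comm, trace_smul, smul_eq_mul, Real.sqrt_mul (by positivity),
        Real.sqrt_mul_self (by positivity), hg]
      ring
    rw [e1, e2] at h
    refine h.trans (le_of_eq ?_)
    congr 1; ring
  have hpt : ∀ ω, |‖bagMean fun i => Y i ω‖ ^ 2 - 1 / ((N : ℝ) * ((N : ℝ) - 1))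
        * ∑ i, ‖bagResidual (fun i => Y i ω) i‖ ^ 2|
      ≤ 2 * U ω + ∑ i, 2 / (N : ℝ) ^ 2 * W i ω := by
    intro ω
    rw [sum_norm_residual_sq hN0]
    have e : ‖bagMean fun i => Y i ω‖ ^ 2 - 1 / ((N : ℝ) * ((N : ℝ) - 1))
        * (∑ i, ‖Y i ω‖ ^ 2 - N * ‖bagMean fun i => Y i ω‖ ^ 2)
        = (N : ℝ) / (N - 1) * (‖bagMean fun i => Y i ω‖ ^ 2 - S.trace / N)
          - 1 / ((N : ℝ) * ((N : ℝ) - 1)) * ∑ i, (‖Y i ω‖ ^ 2 - S.trace) := by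
      rw [Finset.sum_sub_distrib, Finset.sum_const, Finset.card_univ, Fintype.card_fin,
        nsmul_eq_mul]
      field_simp
      ring
    rw [e]
    refine (abs_sub _ _).trans (add_le_add ?_ ?_)
    · rw [abs_mul, abs_of_nonneg (by positivity)]
      refine mul_le_mul_of_nonneg_right ?_ (abs_nonneg _)
      rw [div_le_iff₀ hN1]; linarith
    · rw [abs_mul, abs_of_nonneg (by positivity), ← Finset.mul_sum]
      refine mul_le_mul ?_ (Finset.abs_sum_le_sum_abs _ _) (abs_nonneg _) (by positivity)
      rw [div_le_div_iff₀ (by positivity) (by positivity)]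
      nlinarith
  have hUm : AEMeasurable U P := by
    simp only [hU]; fun_prop
  have hWm : ∀ i, AEMeasurable (W i) P := by
    intro i
    have := (hY i).aemeasurable
    simp only [hW]; fun_prop
  have hU0 : ∀ ω, 0 ≤ U ω := fun ω => abs_nonneg _
  have hW0 : ∀ i ω, 0 ≤ W i ω := fun i ω => abs_nonneg _
  calc _ ≤ ∫⁻ ω, ENNReal.ofReal 2 * ENNReal.ofReal (U ω)
          + ∑ i, ENNReal.ofReal (2 / (N : ℝ) ^ 2) * ENNReal.ofReal (W i ω) ∂P := by
        refine lintegral_mono fun ω => (ENNReal.ofReal_le_ofReal (hpt ω)).trans (le_of_eq ?_)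
        rw [ENNReal.ofReal_add (by have := hU0 ω; positivity)
          (Finset.sum_nonneg fun i _ => mul_nonneg (by positivity) (hW0 i ω)),
          ENNReal.ofReal_sum_of_nonneg fun i _ => mul_nonneg (by positivity) (hW0 i ω)]
        simp only [ENNReal.ofReal_mul (show (0 : ℝ) ≤ 2 by norm_num),
          ENNReal.ofReal_mul (show (0 : ℝ) ≤ 2 / (N : ℝ) ^ 2 by positivity)]
    _ = ENNReal.ofReal 2 * ∫⁻ ω, ENNReal.ofReal (U ω) ∂P
          + ∑ i, ENNReal.ofReal (2 / (N : ℝ) ^ 2) * ∫⁻ ω, ENNReal.ofReal (W i ω) ∂P := by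
        rw [lintegral_add_left' (by fun_prop), lintegral_const_mul'' _ (by fun_prop),
          lintegral_finsetSum' _ fun i _ => by fun_prop]
        simp only [lintegral_const_mul'' _ (hWm _).ennreal_ofReal]
    _ ≤ ENNReal.ofReal 2 * ENNReal.ofReal (7 * g / N)
          + ∑ i : Fin N, ENNReal.ofReal (2 / (N : ℝ) ^ 2) * ENNReal.ofReal (7 * g) := by
        gcongr with i
        exact hlW i
    _ = ENNReal.ofReal (28 * g / N) := by
        rw [Finset.sum_const, Finset.card_univ, Fintype.card_fin, nsmul_eq_mul,
          ← ENNReal.ofReal_mul (by positivity), ← ENNReal.ofReal_mul (by positivity),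
          ← ENNReal.ofReal_natCast, ← ENNReal.ofReal_mul (by positivity),
          ← ENNReal.ofReal_add (by positivity) (by positivity)]
        congr 1
        field_simp
        ring

end Sample

/-! ### Weights realising the oracle risk -/

namespace GaussianTasks

variable (T : GaussianTasks)

lemma naiveRisk_nonneg (k : Fin T.B) : 0 ≤ T.naiveRisk k :=
  div_nonneg (T.cov_posSemidef k).trace_nonneg (Nat.cast_nonneg _)

lemma trace_pos (h : T.cov 0 ≠ 0) : 0 < (T.cov 0).trace :=
  lt_of_le_of_ne (T.cov_posSemidef 0).trace_nonneg
    fun e => h ((T.cov_posSemidef 0).trace_eq_zero_iff.1 e.symm)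

lemma naiveRisk_pos (h : T.cov 0 ≠ 0) : 0 < T.naiveRisk 0 :=
  div_pos (T.trace_pos h) (Nat.cast_pos.2 (T.N_pos 0))

lemma zero_mem_trimmedNeighbours (τ ς : ℝ) (hτ : 0 ≤ τ) (hς : 1 ≤ ς) :
    0 ∈ T.trimmedNeighbours τ ς := by
  classical
  rw [trimmedNeighbours, Finset.mem_inter]
  constructor
  · rw [neighbours]
    split_ifs
    · simp
    · simpa using mul_nonneg hτ (T.naiveRisk_nonneg 0)
  · rw [lowVariance, Finset.mem_filter]
    refine ⟨Finset.mem_univ _, le_mul_of_one_le_left ?_ hς⟩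
    exact div_nonneg (Real.sqrt_nonneg _) (Nat.cast_nonneg _)

lemma norm_mean_sub_sq_le_of_mem {τ ς : ℝ} {k : Fin T.B} (hk : k ∈ T.trimmedNeighbours τ ς)
    (hk0 : k ≠ 0) : ‖T.mean k - T.mean 0‖ ^ 2 ≤ τ * T.naiveRisk 0 := by
  classical
  have h := (Finset.mem_inter.1 hk).1
  rw [neighbours] at h
  split_ifs at h
  · exact absurd (Finset.mem_singleton.1 h) hk0
  · exact (Finset.mem_filter.1 h).2

lemma schattenTwo_div_le_of_mem {τ ς : ℝ} {k : Fin T.B} (hk : k ∈ T.trimmedNeighbours τ ς) :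
    T.schattenTwo k / (T.N k : ℝ) ≤ ς * (T.schattenTwo 0 / (T.N 0 : ℝ)) := by
  classical
  exact (Finset.mem_filter.1 (Finset.mem_inter.1 hk).2).2

/-- In terms of the relative aggregated variance `v` of the neighbours other than the target,
`ν = v / (1 + v)` and the oracle risk is the minimum over `α` of `α² (τ + v) + (1 - α)²`. -/
lemma oracleRisk_div_one_add {τ v : ℝ} (hτ : 0 ≤ τ) (hv : 0 ≤ v) :
    oracleRisk τ (v / (1 + v)) = (τ + v) / (1 + τ + v) := by
  have h1 : 1 + v ≠ 0 := by positivity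
  have h2 : 1 + τ ≠ 0 := by positivity
  have h3 : 1 + τ + v ≠ 0 := by positivity
  have h4 : 1 + τ * (1 - v / (1 + v)) = (1 + τ + v) / (1 + v) := by field_simp; ring
  rw [oracleRisk, h4]
  field_simp
  ring

/-- A deterministic weight vector `z`, carried by the target and by `V_{τ,ς}`, that realises the oracle
risk.  The bound on the total weight of the other tasks controls the effect of their bias on the
fluctuations of the criterion. -/
structure OracleWeights (τ ς : ℝ) (z : Fin T.B → ℝ) : Prop where
  mem_simplex : z ∈ stdSimplex ℝ (Fin T.B)
  mem_of_ne_zero : ∀ k, k ≠ 0 → z k ≠ 0 → k ∈ T.trimmedNeighbours τ ς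
  sq_mul_le : (∑ k ∈ Finset.univ.erase 0, z k) ^ 2 * τ ≤ 1
  risk_le : ‖∑ k, z k • (T.mean k - T.mean 0)‖ ^ 2 + ∑ k, z k ^ 2 * T.naiveRisk k
    ≤ T.naiveRisk 0 * oracleRisk τ (T.relAggVariance (T.trimmedNeighbours τ ς))
  le_oracleRisk : τ / (1 + τ) ≤ oracleRisk τ (T.relAggVariance (T.trimmedNeighbours τ ς))

variable {T}

/-- Weights `p` on the neighbours other than the target, of relative variance at most `v`, are
shared with the target in the proportion `1 / (1 + τ + v)`. -/
lemma exists_oracleWeights_of_weights (h : T.cov 0 ≠ 0) {τ ς v : ℝ} (hτ : 0 ≤ τ)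
    (hv : 0 ≤ v) {p : Fin T.B → ℝ} (hp : p ∈ stdSimplex ℝ (Fin T.B)) (hp0 : p 0 = 0)
    (hpU : ∀ k, p k ≠ 0 → k ∈ T.trimmedNeighbours τ ς)
    (hpv : ∑ k, p k ^ 2 * T.naiveRisk k ≤ v * T.naiveRisk 0)
    (hν : T.relAggVariance (T.trimmedNeighbours τ ς) = v / (1 + v)) :
    ∃ z, T.OracleWeights τ ς z := by
  have hs := T.naiveRisk_pos h
  set s := T.naiveRisk 0 with hs_def
  have hτv : 0 < 1 + τ + v := by positivity
  set α : ℝ := 1 / (1 + τ + v) with hα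
  have hα0 : 0 ≤ α := by positivity
  have hα1 : α ≤ 1 := by rw [hα, div_le_one hτv]; linarith
  have hsum : ∑ k ∈ Finset.univ.erase 0, p k = 1 := by
    have := Finset.add_sum_erase Finset.univ p (Finset.mem_univ 0)
    rw [hp0, zero_add] at this
    rw [this, hp.2]
  set z : Fin T.B → ℝ := (1 - α) • Pi.single 0 1 + α • p with hz
  have hz0 : z 0 = 1 - α := by simp [hz, hp0]
  have hzk : ∀ k, k ≠ 0 → z k = α * p k := fun k hk => by simp [hz, hk]
  have hzs : ∑ k ∈ Finset.univ.erase 0, z k = α := by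
    rw [Finset.sum_congr rfl fun k hk => hzk k (Finset.ne_of_mem_erase hk), ← Finset.mul_sum, hsum,
      mul_one]
  have hαid : α ^ 2 * τ + (1 - α) ^ 2 + α ^ 2 * v = (τ + v) / (1 + τ + v) := by
    rw [hα]; field_simp; ring
  refine ⟨z, ?_, ?_, ?_, ?_, ?_⟩
  · exact convex_stdSimplex ℝ _ (single_mem_stdSimplex ℝ 0) hp (by linarith) hα0 (by ring)
  · intro k hk hzk'
    rw [hzk k hk] at hzk'
    exact hpU k (right_ne_zero_of_mul hzk')
  · rw [hzs]
    have : α * (1 + τ + v) = 1 := by rw [hα]; field_simp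
    nlinarith [mul_nonneg hα0 hτ, mul_nonneg hα0 hv]
  · rw [hν, oracleRisk_div_one_add hτ hv, ← hαid]
    have hbias : ‖∑ k, z k • (T.mean k - T.mean 0)‖ ≤ α * √(τ * s) := by
      rw [← Finset.add_sum_erase _ _ (Finset.mem_univ (0 : Fin T.B)), sub_self, smul_zero, zero_add]
      calc ‖∑ k ∈ Finset.univ.erase 0, z k • (T.mean k - T.mean 0)‖
          ≤ ∑ k ∈ Finset.univ.erase 0, α * p k * √(τ * s) := by
            refine norm_sum_le_of_le _ fun k hk => ?_
            rw [hzk k (Finset.ne_of_mem_erase hk), norm_smul,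
              Real.norm_of_nonneg (mul_nonneg hα0 (hp.1 k))]
            by_cases hpk : p k = 0
            · simp [hpk]
            · refine mul_le_mul_of_nonneg_left ?_ (mul_nonneg hα0 (hp.1 k))
              exact Real.le_sqrt_of_sq_le
                (T.norm_mean_sub_sq_le_of_mem (hpU k hpk) (Finset.ne_of_mem_erase hk))
        _ = α * √(τ * s) := by
            rw [← Finset.sum_mul, ← Finset.mul_sum, hsum, mul_one]
    have hb2 : ‖∑ k, z k • (T.mean k - T.mean 0)‖ ^ 2 ≤ α ^ 2 * (τ * s) := by
      calc _ ≤ (α * √(τ * s)) ^ 2 := by gcongr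
        _ = _ := by rw [mul_pow, Real.sq_sqrt (by positivity)]
    have hvar : ∑ k, z k ^ 2 * T.naiveRisk k ≤ (1 - α) ^ 2 * s + α ^ 2 * (v * s) := by
      rw [← Finset.add_sum_erase _ _ (Finset.mem_univ (0 : Fin T.B)), hz0]
      have e : ∑ k ∈ Finset.univ.erase 0, z k ^ 2 * T.naiveRisk k
          = α ^ 2 * ∑ k ∈ Finset.univ.erase 0, p k ^ 2 * T.naiveRisk k := by
        rw [Finset.mul_sum]
        refine Finset.sum_congr rfl fun k hk => ?_
        rw [hzk k (Finset.ne_of_mem_erase hk)]; ring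
      have e2 : ∑ k ∈ Finset.univ.erase 0, p k ^ 2 * T.naiveRisk k = ∑ k, p k ^ 2 * T.naiveRisk k := by
        rw [← Finset.add_sum_erase _ _ (Finset.mem_univ (0 : Fin T.B)), hp0]; simp
      rw [e, e2]
      gcongr
    nlinarith
  · rw [hν, oracleRisk_div_one_add hτ hv, div_le_div_iff₀ (by positivity) hτv]
    nlinarith

variable (T)

open Classical in
lemma exists_oracleWeights (h : T.cov 0 ≠ 0) {τ ς : ℝ} (hτ : 0 ≤ τ) (hς : 1 ≤ ς) :
    ∃ z, T.OracleWeights τ ς z := by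
  have hs := T.naiveRisk_pos h
  have h0U := T.zero_mem_trimmedNeighbours τ ς hτ hς
  set U := T.trimmedNeighbours τ ς with hU
  have hsplit : ∑ k ∈ U, (ENNReal.ofReal (T.naiveRisk k))⁻¹
      = (ENNReal.ofReal (T.naiveRisk 0))⁻¹ + ∑ k ∈ U.erase 0, (ENNReal.ofReal (T.naiveRisk k))⁻¹ :=
    (Finset.add_sum_erase _ _ h0U).symm
  rcases (U.erase 0).eq_empty_or_nonempty with hem | hne
  · have hν : T.relAggVariance U = 1 := by
      rw [relAggVariance, aggVariance, hsplit, hem, Finset.sum_empty, add_zero, inv_inv,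
        ENNReal.toReal_ofReal hs.le, div_self hs.ne']
    have hor : oracleRisk τ 1 = 1 := by
      have : 1 + τ ≠ 0 := by positivity
      rw [oracleRisk]; field_simp; ring
    refine ⟨Pi.single 0 1, single_mem_stdSimplex ℝ 0, fun k hk hz => absurd hz (by simp [hk]),
      ?_, ?_, ?_⟩
    · rw [Finset.sum_eq_zero fun k hk => by simp [Finset.ne_of_mem_erase hk]]
      norm_num
    · rw [← hU, hν, hor, ← Finset.add_sum_erase _ _ (Finset.mem_univ (0 : Fin T.B)),
        ← Finset.add_sum_erase _ (fun k => (Pi.single 0 1 : Fin T.B → ℝ) k ^ 2 * T.naiveRisk k)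
          (Finset.mem_univ (0 : Fin T.B)),
        Finset.sum_eq_zero fun k hk => by simp [Finset.ne_of_mem_erase hk],
        Finset.sum_eq_zero fun k hk => by simp [Finset.ne_of_mem_erase hk]]
      simp
    · rw [← hU, hν, hor, div_le_one (by positivity)]
      linarith
  · by_cases hz : ∃ k ∈ U.erase 0, T.naiveRisk k = 0
    · obtain ⟨k, hk, hk0⟩ := hz
      have hkU := Finset.mem_of_mem_erase hk
      have hkne := Finset.ne_of_mem_erase hk
      refine exists_oracleWeights_of_weights h hτ (v := 0) le_rfl (p := Pi.single k 1)
        (single_mem_stdSimplex ℝ k) (by simp [hkne.symm]) ?_ ?_ ?_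
      · intro j hj
        rcases eq_or_ne j k with rfl | hjk
        · exact hkU
        · exact absurd (by simp [hjk]) hj
      · rw [zero_mul, Finset.sum_eq_zero]
        intro j _
        rcases eq_or_ne j k with rfl | hjk
        · rw [hk0, mul_zero]
        · simp [hjk]
      · have : ∑ k ∈ U, (ENNReal.ofReal (T.naiveRisk k))⁻¹ = ⊤ :=
          ENNReal.sum_eq_top.2 ⟨k, hkU, by simp [hk0]⟩
        rw [← hU, relAggVariance, aggVariance, this]
        simp
    · push Not at hz
      have hpos : ∀ k ∈ U.erase 0, 0 < T.naiveRisk k := fun k hk =>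
        lt_of_le_of_ne (T.naiveRisk_nonneg k) (hz k hk).symm
      set H : ℝ := ∑ k ∈ U.erase 0, (T.naiveRisk k)⁻¹ with hH
      have hHpos : 0 < H := Finset.sum_pos (fun k hk => inv_pos.2 (hpos k hk)) hne
      set s := T.naiveRisk 0 with hs_def
      set p : Fin T.B → ℝ := fun k => if k ∈ U.erase 0 then (T.naiveRisk k)⁻¹ / H else 0 with hp
      refine exists_oracleWeights_of_weights h hτ (v := 1 / (H * s)) (by positivity) (p := p)
        ⟨fun k => ?_, ?_⟩ (by simp [hp]) ?_ ?_ ?_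
      · simp only [hp]
        split_ifs with hk
        · exact div_nonneg (inv_nonneg.2 (hpos k hk).le) hHpos.le
        · exact le_rfl
      · simp only [hp, Finset.sum_ite_mem, Finset.univ_inter, ← Finset.sum_div]
        exact div_self hHpos.ne'
      · intro k hk
        by_contra hkU
        exact hk (if_neg fun hm => hkU (Finset.mem_of_mem_erase hm))
      · have e : ∀ k, p k ^ 2 * T.naiveRisk k
            = if k ∈ U.erase 0 then (T.naiveRisk k)⁻¹ / H ^ 2 else 0 := by
          intro k
          simp only [hp]
          split_ifs with hk
          · have := (hpos k hk).ne'
            field_simp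
          · simp
        simp only [e, Finset.sum_ite_mem, Finset.univ_inter, ← Finset.sum_div]
        rw [← hH]
        refine le_of_eq ?_
        rw [← hs_def]
        field_simp
      · have e1 : ∀ k ∈ U.erase 0, (ENNReal.ofReal (T.naiveRisk k))⁻¹
            = ENNReal.ofReal (T.naiveRisk k)⁻¹ := fun k hk =>
          (ENNReal.ofReal_inv_of_pos (hpos k hk)).symm
        rw [← hU, relAggVariance, aggVariance, hsplit, Finset.sum_congr rfl e1,
          ← ENNReal.ofReal_inv_of_pos hs,
          ← ENNReal.ofReal_sum_of_nonneg fun k hk => inv_nonneg.2 (hpos k hk).le,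
          ← ENNReal.ofReal_add (inv_nonneg.2 hs.le) hHpos.le,
          ← ENNReal.ofReal_inv_of_pos (by positivity), ENNReal.toReal_ofReal (by positivity)]
        rw [← hs_def]
        field_simp
        ring

end GaussianTasks

/-! ### The joint law of the estimation errors -/

namespace GaussianTasks

variable (T : GaussianTasks)

/-- The order of magnitude `s_1² / √d^e_1` of the fluctuations of the squared error of the naive
estimator of the target. -/
noncomputable def fluctuation : ℝ := T.naiveRisk 0 / √(T.effDim 0)

/-- The covariance `Σ_1 / N_1` of the naive estimator of the target. -/
noncomputable def targetCov : Matrix (Fin T.d) (Fin T.d) ℝ := (T.N 0 : ℝ)⁻¹ • T.cov 0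

lemma targetCov_posSemidef : T.targetCov.PosSemidef :=
  (T.cov_posSemidef 0).smul (inv_nonneg.2 (Nat.cast_nonneg _))

variable {T}

lemma one_le_effDim (h : T.cov 0 ≠ 0) : 1 ≤ T.effDim 0 := by
  have h1 : toEuclideanCLM (n := Fin T.d) (𝕜 := ℝ) (T.cov 0) ≠ 0 := by
    simpa using h
  rw [effDim, one_le_div (norm_pos_iff.2 h1)]
  exact opNorm_le_trace (T.cov_posSemidef 0)

lemma fluctuation_pos (h : T.cov 0 ≠ 0) : 0 < T.fluctuation :=
  div_pos (T.naiveRisk_pos h) (Real.sqrt_pos.2 (by linarith [one_le_effDim h]))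

lemma fluctuation_sq (h : T.cov 0 ≠ 0) :
    T.fluctuation ^ 2 = T.naiveRisk 0 ^ 2 / T.effDim 0 := by
  rw [fluctuation, div_pow, Real.sq_sqrt (by linarith [one_le_effDim h])]

lemma naiveRisk_div_effDim_le (h : T.cov 0 ≠ 0) :
    T.naiveRisk 0 / T.effDim 0 ≤ T.fluctuation := by
  have hd := one_le_effDim h
  have hs := T.naiveRisk_pos h
  rw [fluctuation]
  have : √(T.effDim 0) ≤ T.effDim 0 := Real.sqrt_le_self_iff.2 (Or.inr hd)
  have h2 : 0 < √(T.effDim 0) := Real.sqrt_pos.2 (by linarith)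
  gcongr

lemma opNorm_cov_div (h : T.cov 0 ≠ 0) :
    ‖toEuclideanCLM (n := Fin T.d) (𝕜 := ℝ) (T.cov 0)‖ / T.N 0 = T.naiveRisk 0 / T.effDim 0 := by
  have h1 : 0 < ‖toEuclideanCLM (n := Fin T.d) (𝕜 := ℝ) (T.cov 0)‖ :=
    norm_pos_iff.2 (by simpa using h)
  have h2 : (T.N 0 : ℝ) ≠ 0 := by have := T.N_pos 0; positivity
  have h3 := (T.trace_pos h).ne'
  rw [effDim, naiveRisk]
  field_simp

lemma quadForm_targetCov_le (h : T.cov 0 ≠ 0) (w : EuclideanSpace ℝ (Fin T.d)) :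
    quadForm T.targetCov w ≤ T.naiveRisk 0 / T.effDim 0 * ‖w‖ ^ 2 := by
  have h2 : 0 ≤ (T.N 0 : ℝ)⁻¹ := by positivity
  rw [targetCov, quadForm_smul, ← opNorm_cov_div h]
  have := mul_le_mul_of_nonneg_left (quadForm_le (T.cov 0) w) h2
  refine this.trans (le_of_eq ?_)
  ring

lemma schattenTwo_div_le (h : T.cov 0 ≠ 0) : T.schattenTwo 0 / T.N 0 ≤ T.fluctuation := by
  have hN : (0 : ℝ) < T.N 0 := by exact_mod_cast T.N_pos 0
  refine abs_le_of_sq_le_sq' ?_ (fluctuation_pos h).le |>.2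
  rw [fluctuation_sq h, div_pow, schattenTwo, Real.sq_sqrt (trace_mul_self_nonneg (T.cov_posSemidef 0))]
  have h1 := trace_mul_self_le (T.cov_posSemidef 0)
  have h2 := opNorm_cov_div h
  calc (T.cov 0 * T.cov 0).trace / (T.N 0 : ℝ) ^ 2
      ≤ ‖toEuclideanCLM (n := Fin T.d) (𝕜 := ℝ) (T.cov 0)‖ * (T.cov 0).trace / (T.N 0 : ℝ) ^ 2 := by
        gcongr
    _ = ‖toEuclideanCLM (n := Fin T.d) (𝕜 := ℝ) (T.cov 0)‖ / T.N 0 * T.naiveRisk 0 := by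
        rw [naiveRisk]; field_simp
    _ = _ := by rw [h2]; ring

lemma trace_targetCov_mul_self_le (h : T.cov 0 ≠ 0) :
    (T.targetCov * T.targetCov).trace ≤ T.fluctuation ^ 2 := by
  have h1 := schattenTwo_div_le h
  have h0 : 0 ≤ T.schattenTwo 0 / T.N 0 := div_nonneg (Real.sqrt_nonneg _) (Nat.cast_nonneg _)
  have h2 : (T.targetCov * T.targetCov).trace = (T.schattenTwo 0 / T.N 0) ^ 2 := by
    rw [targetCov, smul_mul_smul_comm, trace_smul, smul_eq_mul, div_pow, schattenTwo,
      Real.sq_sqrt (trace_mul_self_nonneg (T.cov_posSemidef 0))]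
    ring
  rw [h2]
  gcongr

/-- The second moment of `⟨μ̂_k - μ_1, μ̂_1 - μ_1⟩` for a neighbour `k` of the target. -/
lemma quadForm_add_trace_le (h : T.cov 0 ≠ 0) {τ ς : ℝ} (hς : 1 ≤ ς)
    {k : Fin T.B} (hk : k ∈ T.trimmedNeighbours τ ς) (hk0 : k ≠ 0) :
    quadForm T.targetCov (T.mean k - T.mean 0)
        + (T.targetCov * ((T.N k : ℝ)⁻¹ • T.cov k)).trace ≤ T.fluctuation ^ 2 * (τ + ς) := by
  have hd := one_le_effDim h
  have hs := T.naiveRisk_pos h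
  have hb := T.norm_mean_sub_sq_le_of_mem hk hk0
  have hv := T.schattenTwo_div_le_of_mem hk
  have h1 : quadForm T.targetCov (T.mean k - T.mean 0) ≤ T.fluctuation ^ 2 * τ := by
    refine (quadForm_targetCov_le h _).trans ?_
    calc T.naiveRisk 0 / T.effDim 0 * ‖T.mean k - T.mean 0‖ ^ 2
        ≤ T.naiveRisk 0 / T.effDim 0 * (τ * T.naiveRisk 0) := by gcongr
      _ = _ := by rw [fluctuation_sq h]; ring
  have h2 : (T.targetCov * ((T.N k : ℝ)⁻¹ • T.cov k)).trace ≤ T.fluctuation ^ 2 * ς := by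
    rw [targetCov, smul_mul_smul_comm, trace_smul, smul_eq_mul]
    have hcs := trace_mul_le_sqrt_mul_sqrt (T.cov_posSemidef 0) (T.cov_posSemidef k)
    have hs0 : 0 ≤ T.schattenTwo 0 / T.N 0 := div_nonneg (Real.sqrt_nonneg _) (Nat.cast_nonneg _)
    have hsk : 0 ≤ T.schattenTwo k / T.N k := div_nonneg (Real.sqrt_nonneg _) (Nat.cast_nonneg _)
    have h3 := schattenTwo_div_le h
    calc (T.N 0 : ℝ)⁻¹ * (T.N k : ℝ)⁻¹ * (T.cov 0 * T.cov k).trace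
        ≤ (T.N 0 : ℝ)⁻¹ * (T.N k : ℝ)⁻¹ * (T.schattenTwo 0 * T.schattenTwo k) := by
          gcongr; exact hcs
      _ = (T.schattenTwo 0 / T.N 0) * (T.schattenTwo k / T.N k) := by ring
      _ ≤ (T.schattenTwo 0 / T.N 0) * (ς * (T.schattenTwo 0 / T.N 0)) := by gcongr
      _ = (T.schattenTwo 0 / T.N 0) * (T.schattenTwo 0 / T.N 0) * ς := by ring
      _ ≤ _ := by
          have := (fluctuation_pos h).le
          rw [sq]
          gcongr
  linarith

section Laws

variable {Ω : Type*} [MeasurableSpace Ω] {P : Measure Ω}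
  {X : (k : Fin T.B) → Fin (T.N k) → Ω → EuclideanSpace ℝ (Fin T.d)}

lemma hasLaw_aggregate (hX : T.IsSample P X) (z : Fin T.B → ℝ) :
    HasLaw (fun ω => T.aggregate (fun k i => X k i ω) z)
      (multivariateGaussian (∑ k, z k • T.mean k) (∑ k, z k ^ 2 • ((T.N k : ℝ)⁻¹ • T.cov k))) P := by
  have h := hasLaw_sum_smul_multivariateGaussian
    (X := fun p : (k : Fin T.B) × Fin (T.N k) => X p.1 p.2)
    (m := fun p => T.mean p.1) (M := fun p => T.cov p.1) (fun p => T.cov_posSemidef p.1)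
    (fun p => hX.1 p.1 p.2) hX.2 (fun p => z p.1 * (T.N p.1 : ℝ)⁻¹)
  have hN : ∀ k, (T.N k : ℝ) ≠ 0 := fun k => by have := T.N_pos k; positivity
  simp only [Fintype.sum_sigma, Finset.sum_const, Finset.card_univ, Fintype.card_fin] at h
  have e1 : ∀ k, T.N k • (z k * (T.N k : ℝ)⁻¹) • T.mean k = z k • T.mean k := fun k => by
    rw [← Nat.cast_smul_eq_nsmul ℝ, smul_smul]
    congr 1
    have := hN k
    field_simp
  have e2 : ∀ k, T.N k • (z k * (T.N k : ℝ)⁻¹) ^ 2 • T.cov k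
      = z k ^ 2 • ((T.N k : ℝ)⁻¹ • T.cov k) := fun k => by
    rw [← Nat.cast_smul_eq_nsmul ℝ, smul_smul, smul_smul]
    congr 1
    have := hN k
    field_simp
  simp only [e1, e2] at h
  convert h using 2 with ω
  simp only [aggregate, naive, Finset.smul_sum, smul_smul]

lemma hasLaw_naive (hX : T.IsSample P X) (k : Fin T.B) :
    HasLaw (fun ω => T.naive (fun k i => X k i ω) k)
      (multivariateGaussian (T.mean k) ((T.N k : ℝ)⁻¹ • T.cov k)) P := by
  have h := hasLaw_aggregate hX (Pi.single k 1)
  have e : ∀ j, (Pi.single k 1 : Fin T.B → ℝ) j ^ 2 = (Pi.single k 1 : Fin T.B → ℝ) j := by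
    intro j
    rcases eq_or_ne j k with rfl | hj
    · simp
    · simp [hj]
  simp only [aggregate, e] at h
  simpa only [Pi.single_apply, ite_smul, one_smul, zero_smul, Finset.sum_ite_eq', Finset.mem_univ,
    if_true] using h

/-- The expected loss of deterministic weights: bias plus variance. -/
lemma lintegral_loss_const (hX : T.IsSample P X) {z : Fin T.B → ℝ}
    (hz : z ∈ stdSimplex ℝ (Fin T.B)) :
    ∫⁻ ω, ENNReal.ofReal (T.loss (fun k i => X k i ω) z) ∂P
      = ENNReal.ofReal (‖∑ k, z k • (T.mean k - T.mean 0)‖ ^ 2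
          + ∑ k, z k ^ 2 * T.naiveRisk k) := by
  have h := (hasLaw_aggregate hX z).lintegral_comp
    (f := fun x => ENNReal.ofReal (‖x - T.mean 0‖ ^ 2)) (by fun_prop)
  simp only [loss]
  rw [h, lintegral_norm_sub_sq]
  · congr 3
    · simp only [smul_sub, Finset.sum_sub_distrib, ← Finset.sum_smul, hz.2, one_smul]
    · rw [trace_sum]
      refine Finset.sum_congr rfl fun k _ => ?_
      rw [trace_smul, trace_smul, naiveRisk, smul_eq_mul, smul_eq_mul]
      ring
  · exact posSemidef_sum _ fun k _ =>
      ((T.cov_posSemidef k).smul (inv_nonneg.2 (Nat.cast_nonneg _))).smul (sq_nonneg _)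

/-- The centred points of the target bag. -/
lemma hasLaw_sub_mean (hX : T.IsSample P X) (i : Fin (T.N 0)) :
    HasLaw (fun ω => X 0 i ω - T.mean 0) (multivariateGaussian 0 (T.cov 0)) P := by
  have h : HasLaw (fun x => x - T.mean 0) (multivariateGaussian 0 (T.cov 0))
      (multivariateGaussian (T.mean 0) (T.cov 0)) :=
    ⟨by fun_prop, by rw [multivariateGaussian_map_sub, sub_self]⟩
  exact h.fun_comp (hX.1 0 i)

lemma iIndepFun_sub_mean (hX : T.IsSample P X) :
    iIndepFun (fun i ω => X 0 i ω - T.mean 0) P := by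
  have h := hX.2.precomp (g := fun i : Fin (T.N 0) => (⟨0, i⟩ : (k : Fin T.B) × Fin (T.N k)))
    (fun i j hij => by simpa using hij)
  exact h.comp (fun _ x => x - T.mean 0) fun _ => by fun_prop

/-- The errors `μ̂_k - μ_1` of the naive estimators of the other tasks, as estimators of the
target; the component of the target itself is set to `0`. -/
noncomputable def otherErrors (T : GaussianTasks) (x : T.Data) :
    Fin T.B → EuclideanSpace ℝ (Fin T.d) :=
  fun k => if k = 0 then 0 else T.naive x k - T.mean 0

/-- The centred target bag. -/
noncomputable def centredBag (T : GaussianTasks) (x : T.Data) :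
    Fin (T.N 0) → EuclideanSpace ℝ (Fin T.d) :=
  fun i => x 0 i - T.mean 0

lemma bagMean_centredBag (x : T.Data) : bagMean (T.centredBag x) = T.naive x 0 - T.mean 0 := by
  have hN : (T.N 0 : ℝ) ≠ 0 := by have := T.N_pos 0; positivity
  simp only [bagMean, centredBag, naive, Finset.sum_sub_distrib, Finset.sum_const,
    Finset.card_univ, Fintype.card_fin, smul_sub]
  rw [← Nat.cast_smul_eq_nsmul ℝ, smul_smul, inv_mul_cancel₀ hN, one_smul]

lemma bagResidual_centredBag (x : T.Data) (i : Fin (T.N 0)) :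
    bagResidual (T.centredBag x) i = x 0 i - T.naive x 0 := by
  rw [bagResidual, bagMean_centredBag, centredBag]; abel

lemma indepFun_otherErrors_centredBag (hX : T.IsSample P X) :
    IndepFun (fun ω => T.otherErrors fun k i => X k i ω) (fun ω => T.centredBag fun k i => X k i ω)
      P := by
  classical
  let S₁ : Finset ((k : Fin T.B) × Fin (T.N k)) := Finset.univ.filter fun p => p.1 ≠ 0
  let S₂ : Finset ((k : Fin T.B) × Fin (T.N k)) := Finset.univ.filter fun p => p.1 = 0
  have hdisj : Disjoint S₁ S₂ := by
    rw [Finset.disjoint_left]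
    intro p h1 h2
    exact (Finset.mem_filter.1 h1).2 (Finset.mem_filter.1 h2).2
  have h := hX.2.indepFun_finset₀ S₁ S₂ hdisj fun p => (hX.1 p.1 p.2).aemeasurable
  let φ : (S₁ → EuclideanSpace ℝ (Fin T.d)) → Fin T.B → EuclideanSpace ℝ (Fin T.d) := fun y k =>
    if hk : k = 0 then 0 else (T.N k : ℝ)⁻¹ • ∑ i, y ⟨⟨k, i⟩, by simp [S₁, hk]⟩ - T.mean 0
  let ψ : (S₂ → EuclideanSpace ℝ (Fin T.d)) → Fin (T.N 0) → EuclideanSpace ℝ (Fin T.d) :=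
    fun y i => y ⟨⟨0, i⟩, by simp [S₂]⟩ - T.mean 0
  have hφ : Measurable φ := by
    refine measurable_pi_lambda _ fun k => ?_
    by_cases hk : k = 0
    · simp only [φ, hk, dif_pos]; fun_prop
    · simp only [φ, hk, dif_neg, not_false_eq_true]; fun_prop
  have hψ : Measurable ψ := by
    refine measurable_pi_lambda _ fun i => ?_
    simp only [ψ]; fun_prop
  have h2 := h.comp hφ hψ
  have e : (fun ω => T.otherErrors fun k i => X k i ω)
      = φ ∘ fun ω (p : S₁) => X p.1.1 p.1.2 ω := by
    ext ω k : 2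
    simp only [φ, otherErrors, Function.comp_apply, naive]
    split_ifs <;> rfl
  rw [e]
  exact h2

/-- The errors of the other tasks, the error of the target and the residuals of the target bag are
mutually independent. -/
lemma map_errors_eq_prod (hX : T.IsSample P X) :
    P.map (fun ω => (T.otherErrors fun k i => X k i ω,
        (bagMean (T.centredBag fun k i => X k i ω), bagResidual (T.centredBag fun k i => X k i ω))))
      = (P.map fun ω => T.otherErrors fun k i => X k i ω).prod
          ((multivariateGaussian 0 T.targetCov).prod
            (P.map fun ω => bagResidual (T.centredBag fun k i => X k i ω))) := by
  have : IsProbabilityMeasure P := hX.2.isProbabilityMeasure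
  have hc := indepFun_otherErrors_centredBag hX
  have hcm : AEMeasurable (fun ω => T.centredBag fun k i => X k i ω) P :=
    aemeasurable_pi_lambda _ fun i => (hasLaw_sub_mean hX i).aemeasurable
  have hom : AEMeasurable (fun ω => T.otherErrors fun k i => X k i ω) P := by
    refine aemeasurable_pi_lambda _ fun k => ?_
    simp only [otherErrors]
    split_ifs
    · fun_prop
    · exact (hasLaw_naive hX k).aemeasurable.sub_const _
  have h1 : IndepFun (fun ω => T.otherErrors fun k i => X k i ω)
      (fun ω => (bagMean (T.centredBag fun k i => X k i ω),
        bagResidual (T.centredBag fun k i => X k i ω))) P := hc.comp (φ := id)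
    (ψ := fun y : Fin (T.N 0) → EuclideanSpace ℝ (Fin T.d) => (bagMean y, bagResidual y))
    measurable_id (by fun_prop)
  have h2 := indepFun_bagMean_residual (T.N_pos 0) (fun i => hasLaw_sub_mean hX i)
    (iIndepFun_sub_mean hX)
  have h3 := hasLaw_bagMean (T.N_pos 0) (T.cov_posSemidef 0) (fun i => hasLaw_sub_mean hX i)
    (iIndepFun_sub_mean hX)
  have hpm : AEMeasurable (fun ω => (bagMean (T.centredBag fun k i => X k i ω),
      bagResidual (T.centredBag fun k i => X k i ω))) P :=
    (measurable_bagMean.prodMk measurable_bagResidual).comp_aemeasurable hcm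
  replace h1 := (indepFun_iff_map_prod_eq_prod_map_map hom hpm).1 h1
  have h4 := (indepFun_iff_map_prod_eq_prod_map_map h3.aemeasurable
    (measurable_bagResidual.comp_aemeasurable hcm)).1 h2
  rw [h3.map_eq] at h4
  refine h1.trans ?_
  congr 1

end Laws

end GaussianTasks

/-! ### The projection of the noise on a random span -/

section Projection

open InnerProductSpace

variable {d n : ℕ}

/-- The squared norm of the orthogonal projection of `x` on the span of the vectors `v k`, in terms
of the Gram–Schmidt basis, which makes it a measurable function of `(v, x)`. -/
noncomputable def projectionSq (v : Fin n → EuclideanSpace ℝ (Fin d))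
    (x : EuclideanSpace ℝ (Fin d)) : ℝ :=
  ∑ k, inner ℝ (gramSchmidtNormed ℝ v k) x ^ 2

lemma projectionSq_nonneg (v : Fin n → EuclideanSpace ℝ (Fin d)) (x : EuclideanSpace ℝ (Fin d)) :
    0 ≤ projectionSq v x := Finset.sum_nonneg fun _ _ => sq_nonneg _

lemma measurable_gramSchmidt (k : Fin n) :
    Measurable fun v : Fin n → EuclideanSpace ℝ (Fin d) => gramSchmidt ℝ v k := by
  induction k using WellFoundedLT.induction with
  | ind k ih =>
    simp only [gramSchmidt_def ℝ _ k, Submodule.starProjection_singleton]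
    refine (measurable_pi_apply k).sub (Finset.measurable_fun_sum _ fun i hi => ?_)
    have h1 := ih i (Finset.mem_Iio.1 hi)
    have h2 := measurable_pi_apply (X := fun _ : Fin n => EuclideanSpace ℝ (Fin d)) k
    simp only [RCLike.ofReal_real_eq_id, id_eq]
    exact ((h1.inner h2).div (h1.norm.pow_const 2)).smul h1

lemma measurable_gramSchmidtNormed (k : Fin n) :
    Measurable fun v : Fin n → EuclideanSpace ℝ (Fin d) => gramSchmidtNormed ℝ v k := by
  have := measurable_gramSchmidt (d := d) k
  unfold gramSchmidtNormed
  simp only [RCLike.ofReal_real_eq_id, id_eq]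
  fun_prop

lemma measurable_projectionSq :
    Measurable fun p : (Fin n → EuclideanSpace ℝ (Fin d)) × EuclideanSpace ℝ (Fin d) =>
      projectionSq p.1 p.2 := by
  unfold projectionSq
  refine Finset.measurable_fun_sum _ fun k _ => ?_
  have h : Measurable fun p : (Fin n → EuclideanSpace ℝ (Fin d)) × EuclideanSpace ℝ (Fin d) =>
    gramSchmidtNormed ℝ p.1 k := (measurable_gramSchmidtNormed k).comp measurable_fst
  exact (h.inner measurable_snd).pow_const 2

lemma measurable_projectionSq_right (v : Fin n → EuclideanSpace ℝ (Fin d)) :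
    Measurable (projectionSq v) := by
  unfold projectionSq
  fun_prop

lemma norm_gramSchmidtNormed_le (v : Fin n → EuclideanSpace ℝ (Fin d)) (k : Fin n) :
    ‖gramSchmidtNormed ℝ v k‖ ≤ 1 := by
  by_cases h : gramSchmidtNormed ℝ v k = 0
  · rw [h]; simp
  · exact (gramSchmidtNormed_unit_length' h).le

lemma inner_sum_smul_sq_le_projectionSq (v : Fin n → EuclideanSpace ℝ (Fin d))
    (x : EuclideanSpace ℝ (Fin d)) (c : Fin n → ℝ) :
    inner ℝ (∑ k, c k • v k) x ^ 2 ≤ projectionSq v x * ‖∑ k, c k • v k‖ ^ 2 := by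
  have hmem : ∑ k, c k • v k ∈ Submodule.span ℝ (Set.range (gramSchmidtNormed ℝ v)) := by
    rw [span_gramSchmidtNormed_range, span_gramSchmidt]
    exact (Submodule.mem_span_range_iff_exists_fun ℝ).2 ⟨c, rfl⟩
  obtain ⟨a, ha⟩ := (Submodule.mem_span_range_iff_exists_fun ℝ).1 hmem
  rw [← ha]
  set e := gramSchmidtNormed ℝ v with he
  have horth : ∀ i j, i ≠ j → inner ℝ (e i) (e j) = 0 := by
    intro i j hij
    simp only [he, gramSchmidtNormed, inner_smul_left, inner_smul_right,
      gramSchmidt_orthogonal ℝ v hij, mul_zero]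
  have hnorm : ‖∑ k, a k • e k‖ ^ 2 = ∑ k, (a k * ‖e k‖) ^ 2 := by
    rw [← real_inner_self_eq_norm_sq, sum_inner]
    refine Finset.sum_congr rfl fun i _ => ?_
    rw [inner_sum, Finset.sum_eq_single i]
    · rw [real_inner_smul_left, real_inner_smul_right, real_inner_self_eq_norm_sq]; ring
    · intro j _ hj
      rw [real_inner_smul_left, real_inner_smul_right, horth i j hj.symm, mul_zero, mul_zero]
    · simp
  have hinner : inner ℝ (∑ k, a k • e k) x = ∑ k, (a k * ‖e k‖) * inner ℝ (e k) x := by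
    rw [sum_inner]
    refine Finset.sum_congr rfl fun i _ => ?_
    rw [real_inner_smul_left]
    by_cases h : e i = 0
    · simp [h]
    · rw [gramSchmidtNormed_unit_length' h, mul_one]
  rw [hnorm, hinner, projectionSq, mul_comm]
  exact Finset.sum_mul_sq_le_sq_mul_sq _ _ _

end Projection

section Tools

/-- Jensen's inequality for the square root, through `√f ≤ f / (2 K) + K / 2`, which requires no
measurability of `f`. -/
lemma lintegral_ofReal_sqrt_le {Ω : Type*} [MeasurableSpace Ω] {P : Measure Ω}
    [IsProbabilityMeasure P] {f : Ω → ℝ} (hf : ∀ ω, 0 ≤ f ω) {K : ℝ} (hK : 0 < K)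
    (h : ∫⁻ ω, ENNReal.ofReal (f ω) ∂P ≤ ENNReal.ofReal (K ^ 2)) :
    ∫⁻ ω, ENNReal.ofReal √(f ω) ∂P ≤ ENNReal.ofReal K := by
  have hpt : ∀ ω, ENNReal.ofReal √(f ω)
      ≤ ENNReal.ofReal (1 / (2 * K)) * ENNReal.ofReal (f ω) + ENNReal.ofReal (K / 2) := by
    intro ω
    rw [← ENNReal.ofReal_mul (by positivity),
      ← ENNReal.ofReal_add (mul_nonneg (by positivity) (hf ω)) (by positivity)]
    refine ENNReal.ofReal_le_ofReal ?_
    have h1 := Real.sq_sqrt (hf ω)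
    have h2 : 1 / (2 * K) * f ω + K / 2 - √(f ω) = (√(f ω) - K) ^ 2 / (2 * K) := by
      rw [sub_sq, h1]; field_simp; ring
    have h3 : 0 ≤ (√(f ω) - K) ^ 2 / (2 * K) := by positivity
    linarith
  calc ∫⁻ ω, ENNReal.ofReal √(f ω) ∂P
      ≤ ∫⁻ ω, ENNReal.ofReal (1 / (2 * K)) * ENNReal.ofReal (f ω) + ENNReal.ofReal (K / 2) ∂P :=
        lintegral_mono hpt
    _ = ENNReal.ofReal (1 / (2 * K)) * ∫⁻ ω, ENNReal.ofReal (f ω) ∂P + ENNReal.ofReal (K / 2) := by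
        rw [lintegral_add_right _ measurable_const, lintegral_const_mul' _ _ ENNReal.ofReal_ne_top,
          lintegral_const]
        simp
    _ ≤ ENNReal.ofReal (1 / (2 * K)) * ENNReal.ofReal (K ^ 2) + ENNReal.ofReal (K / 2) := by gcongr
    _ = ENNReal.ofReal K := by
        rw [← ENNReal.ofReal_mul (by positivity), ← ENNReal.ofReal_add (by positivity) (by positivity)]
        congr 1
        field_simp
        ring

variable {d : ℕ} {M : Matrix (Fin d) (Fin d) ℝ}

/-- The Cauchy–Schwarz inequality on a rare event, with the fourth moment of a Gaussian variable; the
constant `7` bounds `√40`. -/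
lemma lintegral_indicator_inner_sq_le (hM : M.PosSemidef) (e : EuclideanSpace ℝ (Fin d))
    {A : Set (EuclideanSpace ℝ (Fin d))} (hA : MeasurableSet A) {t p : ℝ} (ht : 0 < t) (hp : 0 < p)
    (he : quadForm M e ≤ t)
    (hAp : multivariateGaussian 0 M A ≤ ENNReal.ofReal (p ^ 2)) :
    ∫⁻ x, A.indicator (fun x => ENNReal.ofReal (inner ℝ e x ^ 2)) x ∂multivariateGaussian 0 M
      ≤ ENNReal.ofReal (7 * t * p) := by
  have hpt : ∀ x, A.indicator (fun x => ENNReal.ofReal (inner ℝ e x ^ 2)) x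
      ≤ ENNReal.ofReal (7 * t / (2 * p)) * A.indicator 1 x
        + ENNReal.ofReal (p / (14 * t)) * ENNReal.ofReal (inner ℝ e x ^ 4) := by
    intro x
    by_cases hx : x ∈ A
    · simp only [Set.indicator_of_mem hx, Pi.one_apply, mul_one]
      rw [← ENNReal.ofReal_mul (by positivity),
        ← ENNReal.ofReal_add (by positivity) (by positivity)]
      refine ENNReal.ofReal_le_ofReal ?_
      have h2 : 7 * t / (2 * p) + p / (14 * t) * inner ℝ e x ^ 4 - inner ℝ e x ^ 2
          = (p * inner ℝ e x ^ 2 - 7 * t) ^ 2 / (14 * t * p) := by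
        field_simp; ring
      have h3 : 0 ≤ (p * inner ℝ e x ^ 2 - 7 * t) ^ 2 / (14 * t * p) := by positivity
      linarith
    · simp [Set.indicator_of_notMem hx]
  have h4 : ∫⁻ x, ENNReal.ofReal (inner ℝ e x ^ 4) ∂multivariateGaussian 0 M
      ≤ ENNReal.ofReal (40 * t ^ 2) := by
    rw [← ofReal_integral_eq_lintegral_ofReal (integrable_inner_pow hM e 4)
      (ae_of_all _ fun x => by positivity)]
    refine ENNReal.ofReal_le_ofReal ((integral_inner_pow_four_le hM e).trans ?_)
    have := quadForm_nonneg hM e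
    gcongr
  calc _ ≤ ∫⁻ x, (ENNReal.ofReal (7 * t / (2 * p)) * A.indicator 1 x
        + ENNReal.ofReal (p / (14 * t)) * ENNReal.ofReal (inner ℝ e x ^ 4))
          ∂multivariateGaussian 0 M := lintegral_mono hpt
    _ = ENNReal.ofReal (7 * t / (2 * p)) * multivariateGaussian 0 M A
        + ENNReal.ofReal (p / (14 * t))
          * ∫⁻ x, ENNReal.ofReal (inner ℝ e x ^ 4) ∂multivariateGaussian 0 M := by
        rw [lintegral_add_right _ (by fun_prop), lintegral_const_mul' _ _ ENNReal.ofReal_ne_top,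
          lintegral_const_mul' _ _ ENNReal.ofReal_ne_top, lintegral_indicator_one hA]
    _ ≤ ENNReal.ofReal (7 * t / (2 * p)) * ENNReal.ofReal (p ^ 2)
        + ENNReal.ofReal (p / (14 * t)) * ENNReal.ofReal (40 * t ^ 2) := by gcongr
    _ = ENNReal.ofReal (7 * t / (2 * p) * p ^ 2 + p / (14 * t) * (40 * t ^ 2)) := by
        rw [← ENNReal.ofReal_mul (by positivity), ← ENNReal.ofReal_mul (by positivity),
          ← ENNReal.ofReal_add (by positivity) (by positivity)]
    _ ≤ _ := by
        refine ENNReal.ofReal_le_ofReal ?_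
        have : 7 * t / (2 * p) * p ^ 2 + p / (14 * t) * (40 * t ^ 2) = (7 / 2 + 40 / 14) * (t * p) := by
          field_simp
        rw [this]
        nlinarith [mul_pos ht hp]

lemma lintegral_projectionSq_le (hM : M.PosSemidef) {n : ℕ}
    (v : Fin n → EuclideanSpace ℝ (Fin d)) {t : ℝ} (ht : 0 < t)
    (hMt : ∀ w, quadForm M w ≤ t * ‖w‖ ^ 2) :
    ∫⁻ x, ENNReal.ofReal (projectionSq v x) ∂multivariateGaussian 0 M
      ≤ ENNReal.ofReal (n * t) := by
  have hq : ∀ k, quadForm M (InnerProductSpace.gramSchmidtNormed ℝ v k) ≤ t := fun k => by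
    refine (hMt _).trans (mul_le_of_le_one_right ht.le ?_)
    exact pow_le_one₀ (norm_nonneg _) (norm_gramSchmidtNormed_le v k)
  simp only [projectionSq, ENNReal.ofReal_sum_of_nonneg fun _ _ => sq_nonneg _]
  rw [lintegral_finsetSum _ fun k _ => by fun_prop]
  simp only [lintegral_inner_sq hM]
  refine (Finset.sum_le_sum fun k _ => ENNReal.ofReal_le_ofReal (hq k)).trans (le_of_eq ?_)
  rw [Finset.sum_const, Finset.card_univ, Fintype.card_fin, nsmul_eq_mul,
    ENNReal.ofReal_mul (by positivity), ENNReal.ofReal_natCast]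

lemma lintegral_indicator_projectionSq_le (hM : M.PosSemidef) {n : ℕ}
    (v : Fin n → EuclideanSpace ℝ (Fin d)) {A : Set (EuclideanSpace ℝ (Fin d))}
    (hA : MeasurableSet A) {t p : ℝ} (ht : 0 < t) (hp : 0 < p)
    (hMt : ∀ w, quadForm M w ≤ t * ‖w‖ ^ 2)
    (hAp : multivariateGaussian 0 M A ≤ ENNReal.ofReal (p ^ 2)) :
    ∫⁻ x, A.indicator (fun x => ENNReal.ofReal (projectionSq v x)) x ∂multivariateGaussian 0 M
      ≤ ENNReal.ofReal (n * (7 * t * p)) := by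
  have hq : ∀ k, quadForm M (InnerProductSpace.gramSchmidtNormed ℝ v k) ≤ t := fun k => by
    refine (hMt _).trans (mul_le_of_le_one_right ht.le ?_)
    exact pow_le_one₀ (norm_nonneg _) (norm_gramSchmidtNormed_le v k)
  have e : ∀ x, A.indicator (fun x => ENNReal.ofReal (projectionSq v x)) x
      = ∑ k, A.indicator (fun x => ENNReal.ofReal
        (inner ℝ (InnerProductSpace.gramSchmidtNormed ℝ v k) x ^ 2)) x := by
    intro x
    by_cases hx : x ∈ A
    · simp only [Set.indicator_of_mem hx, projectionSq,
        ENNReal.ofReal_sum_of_nonneg fun _ _ => sq_nonneg _]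
    · simp [Set.indicator_of_notMem hx]
  simp only [e]
  rw [lintegral_finsetSum _ fun k _ => Measurable.indicator (by fun_prop) hA]
  refine (Finset.sum_le_sum fun k _ =>
    lintegral_indicator_inner_sq_le hM _ hA ht hp (hq k) hAp).trans (le_of_eq ?_)
  rw [Finset.sum_const, Finset.card_univ, Fintype.card_fin, nsmul_eq_mul,
    ENNReal.ofReal_mul (Nat.cast_nonneg n), ENNReal.ofReal_natCast]

end Tools

/-! ### The oracle inequality, conditionally on the data -/

section UpperMean

variable {Ω : Type*} [MeasurableSpace Ω] {P : Measure Ω}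

lemma lintegral_ofReal_add_le {f g : Ω → ℝ} {a b : ℝ} (hf : AEMeasurable f P) (ha : 0 ≤ a)
    (hb : 0 ≤ b) (h1 : ∫⁻ ω, ENNReal.ofReal (f ω) ∂P ≤ ENNReal.ofReal a)
    (h2 : ∫⁻ ω, ENNReal.ofReal (g ω) ∂P ≤ ENNReal.ofReal b) :
    ∫⁻ ω, ENNReal.ofReal (f ω + g ω) ∂P ≤ ENNReal.ofReal (a + b) := by
  calc _ ≤ ∫⁻ ω, ENNReal.ofReal (f ω) + ENNReal.ofReal (g ω) ∂P :=
        lintegral_mono fun ω => ENNReal.ofReal_add_le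
    _ = ∫⁻ ω, ENNReal.ofReal (f ω) ∂P + ∫⁻ ω, ENNReal.ofReal (g ω) ∂P :=
        lintegral_add_left' hf.ennreal_ofReal _
    _ ≤ ENNReal.ofReal a + ENNReal.ofReal b := add_le_add h1 h2
    _ = _ := (ENNReal.ofReal_add ha hb).symm

lemma lintegral_ofReal_const_mul_le {f : Ω → ℝ} {a c : ℝ} (hc : 0 ≤ c)
    (h : ∫⁻ ω, ENNReal.ofReal (f ω) ∂P ≤ ENNReal.ofReal a) :
    ∫⁻ ω, ENNReal.ofReal (c * f ω) ∂P ≤ ENNReal.ofReal (c * a) := by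
  simp only [ENNReal.ofReal_mul hc]
  rw [lintegral_const_mul' _ _ ENNReal.ofReal_ne_top]
  gcongr

lemma lintegral_ofReal_weighted_sum_le {ι : Type*} {s : Finset ι} {z : ι → ℝ} {f : ι → Ω → ℝ}
    {a : ℝ} (hz : ∀ k ∈ s, 0 ≤ z k) (hfm : ∀ k ∈ s, AEMeasurable (f k) P)
    (hf : ∀ k ∈ s, ∀ ω, 0 ≤ f k ω)
    (h : ∀ k ∈ s, z k ≠ 0 → ∫⁻ ω, ENNReal.ofReal (f k ω) ∂P ≤ ENNReal.ofReal a) :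
    ∫⁻ ω, ENNReal.ofReal (∑ k ∈ s, z k * f k ω) ∂P
      ≤ ENNReal.ofReal ((∑ k ∈ s, z k) * a) := by
  have e : ∀ ω, ENNReal.ofReal (∑ k ∈ s, z k * f k ω)
      = ∑ k ∈ s, ENNReal.ofReal (z k * f k ω) := fun ω =>
    ENNReal.ofReal_sum_of_nonneg fun k hk => mul_nonneg (hz k hk) (hf k hk ω)
  simp only [e]
  rw [lintegral_finsetSum' _ fun k hk => ((hfm k hk).const_mul _).ennreal_ofReal,
    ENNReal.ofReal_mul (Finset.sum_nonneg hz), ENNReal.ofReal_sum_of_nonneg hz, Finset.sum_mul]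
  refine Finset.sum_le_sum fun k hk => ?_
  by_cases hk0 : z k = 0
  · simp [hk0]
  · rw [← ENNReal.ofReal_mul (hz k hk)]
    exact lintegral_ofReal_const_mul_le (hz k hk) (h k hk hk0)

end UpperMean

namespace GaussianTasks

variable {T : GaussianTasks}

/-- The penalty `√(q̂_k / N_1)`, in terms of the error `v` of `μ̂_k`, the error `x` of `μ̂_1` and the
residuals `r` of the target bag. -/
noncomputable def noiseScale (T : GaussianTasks) (v x : EuclideanSpace ℝ (Fin T.d))
    (r : Fin (T.N 0) → EuclideanSpace ℝ (Fin T.d)) : ℝ :=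
  √(1 / ((T.N 0 : ℝ) - 1) * (∑ i, inner ℝ (x - v) (r i) ^ 2) / T.N 0)

/-- The noises `x` for which one of the `⟨v k, x⟩` exceeds its standard deviation by a factor
`2 √u`.  An index `k` with `v k = 0`, such as that of the target, imposes nothing. -/
def noiseSet (T : GaussianTasks) (u : ℝ) (v : Fin T.B → EuclideanSpace ℝ (Fin T.d)) :
    Set (EuclideanSpace ℝ (Fin T.d)) :=
  {x | ∃ k, 2 * √u * √(quadForm T.targetCov (v k)) < |inner ℝ (v k) x|}

/-- The residuals `r` of the target bag for which one of the variances in the directions `x - v k`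
is underestimated by a factor `16`.  For the target, `v 0 = 0` and the direction is `x` itself. -/
def residualSet (T : GaussianTasks) (v : Fin T.B → EuclideanSpace ℝ (Fin T.d))
    (x : EuclideanSpace ℝ (Fin T.d)) : Set (Fin (T.N 0) → EuclideanSpace ℝ (Fin T.d)) :=
  {r | ∃ k, ∑ i, inner ℝ (x - v k) (r i) ^ 2
    < 1 / 16 * ((T.N 0 : ℝ) - 1) * quadForm (T.cov 0) (x - v k)}

lemma loss_eq (x : T.Data) {w : Fin T.B → ℝ} (hw : w ∈ stdSimplex ℝ (Fin T.B)) :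
    T.loss x w = ‖∑ k, w k • (T.naive x k - T.mean 0)‖ ^ 2 := by
  simp only [loss, aggregate, smul_sub, Finset.sum_sub_distrib, ← Finset.sum_smul, hw.2, one_smul]

lemma otherErrors_of_ne (x : T.Data) {k : Fin T.B} (hk : k ≠ 0) :
    T.otherErrors x k = T.naive x k - T.mean 0 := if_neg hk

lemma naiveRiskHat_eq (x : T.Data) : T.naiveRiskHat x
    = 1 / ((T.N 0 : ℝ) * ((T.N 0 : ℝ) - 1)) * ∑ i, ‖bagResidual (T.centredBag x) i‖ ^ 2 := by
  simp only [naiveRiskHat, bagResidual_centredBag]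

lemma sqrt_qHat_div_eq (x : T.Data) {k : Fin T.B} (hk : k ≠ 0) : √(T.qHat x k / T.N 0)
    = T.noiseScale (T.otherErrors x k) (bagMean (T.centredBag x)) (bagResidual (T.centredBag x)) := by
  have e : bagMean (T.centredBag x) - T.otherErrors x k = T.naive x 0 - T.naive x k := by
    rw [bagMean_centredBag, otherErrors_of_ne x hk]; abel
  simp only [noiseScale, qHat, e, bagResidual_centredBag]

lemma isMinOn_of_isQAggregation {u : ℝ} {x : T.Data} {w : Fin T.B → ℝ}
    (h : T.IsQAggregation u x w) :
    IsMinOn (fun v : Fin T.B → ℝ => ‖∑ k ∈ Finset.univ.erase 0,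
        v k • ((T.naive x k - T.mean 0) - (T.naive x 0 - T.mean 0))‖ ^ 2
      + (2 * v 0 - 1) * T.naiveRiskHat x + ∑ k ∈ Finset.univ.erase 0,
        v k * (16 * √u * √(T.qHat x k / T.N 0))) (stdSimplex ℝ (Fin T.B)) w := by
  refine h.2.congr (Filter.Eventually.of_forall fun v => ?_) ?_ <;>
  · simp only [lossHat, penaltyHat, sub_sub_sub_cancel_right, Finset.mul_sum]
    congr 1
    exact Finset.sum_congr rfl fun k _ => by ring

/-- Off the exceptional event the penalty dominates the noise.  The standard deviation in the
direction `v` is at most the sum of those in the directions `x - v`, which the penalty estimates, and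
`x`, which does not depend on the task. -/
lemma two_mul_inner_le {u : ℝ} (hN : 2 ≤ T.N 0) {v x : EuclideanSpace ℝ (Fin T.d)}
    {r : Fin (T.N 0) → EuclideanSpace ℝ (Fin T.d)}
    (h1 : |inner ℝ v x| ≤ 2 * √u * √(quadForm T.targetCov v))
    (h2 : 1 / 16 * ((T.N 0 : ℝ) - 1) * quadForm (T.cov 0) (x - v)
      ≤ ∑ i, inner ℝ (x - v) (r i) ^ 2) :
    2 * inner ℝ v x ≤ 16 * √u * T.noiseScale v x r + 4 * √u * √(quadForm T.targetCov x) := by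
  have hN2 : (2 : ℝ) ≤ T.N 0 := by exact_mod_cast hN
  have hN1 : 0 < (T.N 0 : ℝ) - 1 := by linarith
  have h3 := sqrt_quadForm_le T.targetCov_posSemidef v x
  have h4 : √(quadForm T.targetCov (x - v)) ≤ 4 * T.noiseScale v x r := by
    have e4 : (4 : ℝ) = √16 := by
      rw [show (16 : ℝ) = 4 ^ 2 by norm_num, Real.sqrt_sq (by norm_num)]
    rw [noiseScale, e4, ← Real.sqrt_mul (by norm_num)]
    refine Real.sqrt_le_sqrt ?_
    rw [targetCov, quadForm_smul]
    calc (T.N 0 : ℝ)⁻¹ * quadForm (T.cov 0) (x - v)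
        = 16 * (1 / ((T.N 0 : ℝ) - 1)
          * (1 / 16 * ((T.N 0 : ℝ) - 1) * quadForm (T.cov 0) (x - v)) / T.N 0) := by
          field_simp
      _ ≤ _ := by gcongr
  have h5 := le_abs_self (inner ℝ v x : ℝ)
  have hu := Real.sqrt_nonneg u
  nlinarith [mul_le_mul_of_nonneg_left h3 hu, mul_le_mul_of_nonneg_left h4 hu]

/-- The squared norm of the projection of `x` on the span of the `v k`, on the exceptional event, and
counted twice when both exceptional sets are hit. -/
noncomputable def exceptionalLoss (T : GaussianTasks) (u : ℝ)
    (v : Fin T.B → EuclideanSpace ℝ (Fin T.d)) (x : EuclideanSpace ℝ (Fin T.d))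
    (r : Fin (T.N 0) → EuclideanSpace ℝ (Fin T.d)) : ℝ :=
  (T.noiseSet u v).indicator (projectionSq v) x
    + (T.residualSet v x).indicator (fun _ => projectionSq v x) r

lemma exceptionalLoss_nonneg (u : ℝ)
    (v : Fin T.B → EuclideanSpace ℝ (Fin T.d)) (x : EuclideanSpace ℝ (Fin T.d))
    (r : Fin (T.N 0) → EuclideanSpace ℝ (Fin T.d)) : 0 ≤ T.exceptionalLoss u v x r :=
  add_nonneg (Set.indicator_nonneg (fun _ _ => projectionSq_nonneg _ _) _)
    (Set.indicator_nonneg (fun _ _ => projectionSq_nonneg _ _) _)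

/-- The oracle inequality before taking expectations. -/
lemma loss_le_of_isQAggregation {u : ℝ} (hN : 2 ≤ T.N 0) {x : T.Data} {w z : Fin T.B → ℝ}
    (h : T.IsQAggregation u x w) (hz : z ∈ stdSimplex ℝ (Fin T.B)) :
    T.loss x w ≤ T.loss x z
      + (2 * (∑ k ∈ Finset.univ.erase 0,
          z k * |inner ℝ (T.otherErrors x k) (bagMean (T.centredBag x))|)
      + (16 * √u * (∑ k ∈ Finset.univ.erase 0, z k *
          T.noiseScale (T.otherErrors x k) (bagMean (T.centredBag x)) (bagResidual (T.centredBag x)))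
      + (4 * √u * √(quadForm T.targetCov (bagMean (T.centredBag x)))
      + (2 * |‖bagMean (T.centredBag x)‖ ^ 2 - 1 / ((T.N 0 : ℝ) * ((T.N 0 : ℝ) - 1))
          * ∑ i, ‖bagResidual (T.centredBag x) i‖ ^ 2|
      + 4 * T.exceptionalLoss u (T.otherErrors x) (bagMean (T.centredBag x))
          (bagResidual (T.centredBag x)))))) := by
  set V := T.otherErrors x with hV
  set ξ := bagMean (T.centredBag x) with hξ
  set R := bagResidual (T.centredBag x) with hR
  have hmin := isMinOn_of_isQAggregation h
  have hu := Real.sqrt_nonneg u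
  have hpen : ∑ k ∈ Finset.univ.erase 0, z k * (16 * √u * √(T.qHat x k / T.N 0))
      = 16 * √u * ∑ k ∈ Finset.univ.erase 0, z k * T.noiseScale (V k) ξ R := by
    rw [Finset.mul_sum]
    refine Finset.sum_congr rfl fun k hk => ?_
    rw [sqrt_qHat_div_eq x (Finset.ne_of_mem_erase hk)]; ring
  have hrisk := naiveRiskHat_eq x
  rw [← hR] at hrisk
  have hcross : ∑ k ∈ Finset.univ.erase 0,
        z k * |inner ℝ (T.naive x k - T.mean 0) (T.naive x 0 - T.mean 0)|
      = ∑ k ∈ Finset.univ.erase 0, z k * |inner ℝ (V k) ξ| :=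
    Finset.sum_congr rfl fun k hk => by
      rw [hV, otherErrors_of_ne x (Finset.ne_of_mem_erase hk), hξ, bagMean_centredBag]
  have hξ0 : T.naive x 0 - T.mean 0 = ξ := (bagMean_centredBag x).symm
  have hq := Real.sqrt_nonneg (quadForm T.targetCov ξ)
  have hexc := T.exceptionalLoss_nonneg u V ξ R
  have hcr : 0 ≤ ∑ k ∈ Finset.univ.erase 0, z k * |inner ℝ (V k) ξ| :=
    Finset.sum_nonneg fun k _ => mul_nonneg (hz.1 k) (abs_nonneg _)
  rw [loss_eq x h.1, loss_eq x hz]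
  -- on the good event the penalty absorbs the noise; otherwise the quadratic part does
  by_cases hgood : ξ ∉ T.noiseSet u V ∧ R ∉ T.residualSet V ξ
  · simp only [noiseSet, residualSet, Set.mem_ofPred_eq, not_exists, not_lt] at hgood
    have := norm_sq_le_of_isMinOn_of_inner_le 0 (fun k => T.naive x k - T.mean 0) _ _ h.1 hz hmin
      (e := 4 * √u * √(quadForm T.targetCov ξ)) (by positivity) (fun k hk => by
        rw [hξ0, sqrt_qHat_div_eq x hk, ← otherErrors_of_ne x hk]
        exact two_mul_inner_le hN (hgood.1 k) (hgood.2 k))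
    simp only [hcross] at this
    rw [hpen, hξ0, hrisk] at this
    linarith
  · have := norm_sq_le_of_isMinOn_of_projection 0 (fun k => T.naive x k - T.mean 0) _ _ h.1 hz
      (fun k => by positivity) hmin (Y := projectionSq V ξ) (projectionSq_nonneg _ _) (fun c => by
        have hs : ∑ k ∈ Finset.univ.erase 0, c k • (T.naive x k - T.mean 0)
            = ∑ k, c k • V k := by
          rw [← Finset.add_sum_erase _ (fun k => c k • V k) (Finset.mem_univ (0 : Fin T.B))]
          rw [hV, show T.otherErrors x 0 = 0 from if_pos rfl, smul_zero, zero_add]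
          exact Finset.sum_congr rfl fun k hk => by
            rw [otherErrors_of_ne x (Finset.ne_of_mem_erase hk)]
        rw [hs, hξ0]
        exact inner_sum_smul_sq_le_projectionSq V ξ c)
    rw [hpen, hξ0, hrisk] at this
    have hY : projectionSq V ξ ≤ T.exceptionalLoss u V ξ R := by
      rw [exceptionalLoss]
      by_cases h1 : ξ ∈ T.noiseSet u V
      · rw [Set.indicator_of_mem h1]
        exact le_add_of_nonneg_right (Set.indicator_nonneg (fun _ _ => projectionSq_nonneg _ _) _)
      · have h2 : R ∈ T.residualSet V ξ := by
          by_contra h2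
          exact hgood ⟨h1, h2⟩
        rw [Set.indicator_of_mem h2]
        exact le_add_of_nonneg_left (Set.indicator_nonneg (fun _ _ => projectionSq_nonneg _ _) _)
    have : 0 ≤ 4 * √u * √(quadForm T.targetCov ξ) := by positivity
    linarith

end GaussianTasks

/-! ### Expectation of the terms of the oracle inequality -/

namespace GaussianTasks

variable {T : GaussianTasks} {Ω : Type*} [MeasurableSpace Ω] {P : Measure Ω}
  {X : (k : Fin T.B) → Fin (T.N k) → Ω → EuclideanSpace ℝ (Fin T.d)}

lemma aemeasurable_centredBag (hX : T.IsSample P X) :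
    AEMeasurable (fun ω => T.centredBag fun k i => X k i ω) P :=
  aemeasurable_pi_lambda _ fun i => (hasLaw_sub_mean hX i).aemeasurable

lemma aemeasurable_bagMean_centredBag (hX : T.IsSample P X) :
    AEMeasurable (fun ω => bagMean (T.centredBag fun k i => X k i ω)) P :=
  measurable_bagMean.comp_aemeasurable (aemeasurable_centredBag hX)

lemma aemeasurable_bagResidual_centredBag (hX : T.IsSample P X) :
    AEMeasurable (fun ω => bagResidual (T.centredBag fun k i => X k i ω)) P :=
  measurable_bagResidual.comp_aemeasurable (aemeasurable_centredBag hX)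

lemma aemeasurable_otherErrors (hX : T.IsSample P X) :
    AEMeasurable (fun ω => T.otherErrors fun k i => X k i ω) P := by
  refine aemeasurable_pi_lambda _ fun k => ?_
  simp only [otherErrors]
  split_ifs
  · fun_prop
  · exact (hasLaw_naive hX k).aemeasurable.sub_const _

/-- Expectations with respect to the errors, computed by conditioning on the errors of the other
tasks, and then on the error of the target. -/
lemma lintegral_errors (hX : T.IsSample P X)
    {F : (Fin T.B → EuclideanSpace ℝ (Fin T.d)) → EuclideanSpace ℝ (Fin T.d) →
      (Fin (T.N 0) → EuclideanSpace ℝ (Fin T.d)) → ENNReal}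
    (hF : Measurable fun p : (Fin T.B → EuclideanSpace ℝ (Fin T.d)) ×
      EuclideanSpace ℝ (Fin T.d) × (Fin (T.N 0) → EuclideanSpace ℝ (Fin T.d)) =>
        F p.1 p.2.1 p.2.2) :
    ∫⁻ ω, F (T.otherErrors fun k i => X k i ω) (bagMean (T.centredBag fun k i => X k i ω))
        (bagResidual (T.centredBag fun k i => X k i ω)) ∂P
      = ∫⁻ v, ∫⁻ x, ∫⁻ r, F v x r
          ∂(P.map fun ω => bagResidual (T.centredBag fun k i => X k i ω))
          ∂multivariateGaussian 0 T.targetCov ∂(P.map fun ω => T.otherErrors fun k i => X k i ω) := by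
  have : IsProbabilityMeasure P := hX.2.isProbabilityMeasure
  have h := lintegral_map' (μ := P) (f := fun p : (Fin T.B → EuclideanSpace ℝ (Fin T.d)) ×
      EuclideanSpace ℝ (Fin T.d) × (Fin (T.N 0) → EuclideanSpace ℝ (Fin T.d)) =>
        F p.1 p.2.1 p.2.2) hF.aemeasurable
    ((aemeasurable_otherErrors hX).prodMk
      ((aemeasurable_bagMean_centredBag hX).prodMk (aemeasurable_bagResidual_centredBag hX)))
  rw [map_errors_eq_prod hX, lintegral_prod _ hF.aemeasurable] at h
  rw [← h]
  refine lintegral_congr fun v => ?_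
  exact lintegral_prod _ (hF.comp (measurable_prodMk_left (x := v))).aemeasurable

section Residuals

lemma map_bagResidual_le (hX : T.IsSample P X) (w : EuclideanSpace ℝ (Fin T.d)) :
    (P.map fun ω => bagResidual (T.centredBag fun k i => X k i ω))
        {r | ∑ i, inner ℝ w (r i) ^ 2 < 1 / 16 * ((T.N 0 : ℝ) - 1) * quadForm (T.cov 0) w}
      ≤ ENNReal.ofReal (Real.exp (-(3 / 4 * ((T.N 0 : ℝ) - 1)))) := by
  rw [Measure.map_apply_of_aemeasurable (aemeasurable_bagResidual_centredBag hX)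
    (measurableSet_lt (by fun_prop) measurable_const)]
  exact measure_sum_inner_residual_sq_lt_le (T.N_pos 0) (T.cov_posSemidef 0)
    (fun i => hasLaw_sub_mean hX i) (iIndepFun_sub_mean hX) w

lemma lintegral_map_bagResidual_le (hX : T.IsSample P X) (w : EuclideanSpace ℝ (Fin T.d)) :
    ∫⁻ r, ENNReal.ofReal (∑ i, inner ℝ w (r i) ^ 2)
        ∂(P.map fun ω => bagResidual (T.centredBag fun k i => X k i ω))
      ≤ ENNReal.ofReal (T.N 0 * quadForm (T.cov 0) w) := by
  rw [lintegral_map' (Measurable.aemeasurable (by fun_prop)) (aemeasurable_bagResidual_centredBag hX)]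
  exact lintegral_sum_inner_residual_sq_le (T.N_pos 0) (T.cov_posSemidef 0)
    (fun i => hasLaw_sub_mean hX i) w

end Residuals

lemma lintegral_quadForm_otherErrors (hX : T.IsSample P X) {k : Fin T.B} (hk : k ≠ 0) :
    ∫⁻ v, ENNReal.ofReal (quadForm T.targetCov (v k))
        ∂(P.map fun ω => T.otherErrors fun k i => X k i ω)
      = ENNReal.ofReal (quadForm T.targetCov (T.mean k - T.mean 0)
          + (T.targetCov * ((T.N k : ℝ)⁻¹ • T.cov k)).trace) := by
  rw [lintegral_map' (Measurable.aemeasurable (by fun_prop)) (aemeasurable_otherErrors hX)]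
  simp only [otherErrors_of_ne _ hk]
  have h := (hasLaw_naive hX k).lintegral_comp
    (f := fun y => ENNReal.ofReal (quadForm T.targetCov (y - T.mean 0))) (by fun_prop)
  have h2 := lintegral_map' (μ := multivariateGaussian (T.mean k) ((T.N k : ℝ)⁻¹ • T.cov k))
    (f := fun y => ENNReal.ofReal (quadForm T.targetCov y)) (g := fun y => y - T.mean 0)
    (by fun_prop) (by fun_prop)
  rw [multivariateGaussian_map_sub, lintegral_quadForm T.targetCov_posSemidef
    ((T.cov_posSemidef k).smul (inv_nonneg.2 (Nat.cast_nonneg _)))] at h2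
  rw [h, h2]

lemma lintegral_abs_inner_le (h0 : T.cov 0 ≠ 0) (hX : T.IsSample P X) {τ ς : ℝ} (hτ : 0 ≤ τ)
    (hς : 1 ≤ ς) {k : Fin T.B} (hk : k ∈ T.trimmedNeighbours τ ς) (hk0 : k ≠ 0) :
    ∫⁻ ω, ENNReal.ofReal |inner ℝ (T.otherErrors (fun k i => X k i ω) k)
        (bagMean (T.centredBag fun k i => X k i ω))| ∂P
      ≤ ENNReal.ofReal (T.fluctuation * √(τ + ς)) := by
  have : IsProbabilityMeasure P := hX.2.isProbabilityMeasure
  have := Measure.isProbabilityMeasure_map (aemeasurable_bagResidual_centredBag hX)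
  simp only [← Real.sqrt_sq_eq_abs]
  refine lintegral_ofReal_sqrt_le (fun _ => sq_nonneg _)
    (mul_pos (fluctuation_pos h0) (Real.sqrt_pos.2 (by linarith))) ?_
  rw [lintegral_errors hX (F := fun v x _ => ENNReal.ofReal (inner ℝ (v k) x ^ 2)) (by fun_prop)]
  simp only [lintegral_const, measure_univ, mul_one, lintegral_inner_sq T.targetCov_posSemidef]
  rw [lintegral_quadForm_otherErrors hX hk0, mul_pow, Real.sq_sqrt (by linarith)]
  exact ENNReal.ofReal_le_ofReal (quadForm_add_trace_le h0 hς hk hk0)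

lemma aemeasurable_noiseScale (hX : T.IsSample P X) (k : Fin T.B) :
    AEMeasurable (fun ω => T.noiseScale (T.otherErrors (fun k i => X k i ω) k)
      (bagMean (T.centredBag fun k i => X k i ω))
      (bagResidual (T.centredBag fun k i => X k i ω))) P := by
  have hV := (measurable_pi_apply k).comp_aemeasurable (aemeasurable_otherErrors hX)
  have hξ := aemeasurable_bagMean_centredBag hX
  have hR := fun i => (measurable_pi_apply i).comp_aemeasurable
    (aemeasurable_bagResidual_centredBag hX)
  unfold noiseScale
  exact (((Finset.aemeasurable_fun_sum _ fun i _ =>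
    ((hξ.sub hV).inner (hR i)).pow_const 2).const_mul _).div_const _).sqrt

lemma lintegral_noiseScale_le (h0 : T.cov 0 ≠ 0) (hN : 2 ≤ T.N 0) (hX : T.IsSample P X) {τ ς : ℝ}
    (hτ : 0 ≤ τ) (hς : 1 ≤ ς) {k : Fin T.B} (hk : k ∈ T.trimmedNeighbours τ ς) (hk0 : k ≠ 0) :
    ∫⁻ ω, ENNReal.ofReal (T.noiseScale (T.otherErrors (fun k i => X k i ω) k)
        (bagMean (T.centredBag fun k i => X k i ω))
        (bagResidual (T.centredBag fun k i => X k i ω))) ∂P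
      ≤ ENNReal.ofReal (2 * T.fluctuation * √(τ + 2 * ς)) := by
  have : IsProbabilityMeasure P := hX.2.isProbabilityMeasure
  have := Measure.isProbabilityMeasure_map (aemeasurable_otherErrors hX)
  have hδ := fluctuation_pos h0
  have hN2 : (2 : ℝ) ≤ T.N 0 := by exact_mod_cast hN
  have hN1 : 0 < (T.N 0 : ℝ) - 1 := by linarith
  have hS := T.targetCov_posSemidef
  set c : ℝ := 1 / ((T.N 0 : ℝ) - 1) / T.N 0 with hc
  have hc0 : 0 ≤ c := by positivity
  refine lintegral_ofReal_sqrt_le (fun _ => by positivity)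
    (mul_pos (by positivity) (Real.sqrt_pos.2 (by linarith))) ?_
  rw [lintegral_errors hX (F := fun v x r => ENNReal.ofReal
    (1 / ((T.N 0 : ℝ) - 1) * (∑ i, inner ℝ (x - v k) (r i) ^ 2) / T.N 0)) (by fun_prop)]
  have hr : ∀ (v : Fin T.B → EuclideanSpace ℝ (Fin T.d)) (x : EuclideanSpace ℝ (Fin T.d)),
      ∫⁻ r, ENNReal.ofReal (1 / ((T.N 0 : ℝ) - 1) * (∑ i, inner ℝ (x - v k) (r i) ^ 2) / T.N 0)
        ∂(P.map fun ω => bagResidual (T.centredBag fun k i => X k i ω))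
      ≤ ENNReal.ofReal (4 * quadForm T.targetCov x)
        + ENNReal.ofReal (4 * quadForm T.targetCov (v k)) := by
    intro v x
    have e : ∀ r : Fin (T.N 0) → EuclideanSpace ℝ (Fin T.d),
        1 / ((T.N 0 : ℝ) - 1) * (∑ i, inner ℝ (x - v k) (r i) ^ 2) / T.N 0
          = c * ∑ i, inner ℝ (x - v k) (r i) ^ 2 := fun r => by rw [hc]; ring
    simp only [e]
    refine (lintegral_ofReal_const_mul_le hc0 (lintegral_map_bagResidual_le hX _)).trans ?_
    have hx := quadForm_nonneg hS x
    have hv := quadForm_nonneg hS (v k)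
    rw [← ENNReal.ofReal_add (by positivity) (by positivity)]
    refine ENNReal.ofReal_le_ofReal ?_
    have h1 := quadForm_sub_le hS x (v k)
    have h2 := quadForm_nonneg hS (x - v k)
    have h3 : c * (T.N 0 * quadForm (T.cov 0) (x - v k))
        = T.N 0 / ((T.N 0 : ℝ) - 1) * quadForm T.targetCov (x - v k) := by
      rw [hc, targetCov, quadForm_smul]; field_simp
    have h4 : T.N 0 / ((T.N 0 : ℝ) - 1) ≤ 2 := by rw [div_le_iff₀ hN1]; linarith
    rw [h3]
    nlinarith [mul_le_mul_of_nonneg_right h4 h2]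
  refine (lintegral_mono fun v => lintegral_mono fun x => hr v x).trans ?_
  simp only [lintegral_add_right _ measurable_const, lintegral_const, measure_univ, mul_one]
  rw [lintegral_add_left measurable_const, lintegral_const, measure_univ, mul_one]
  simp only [ENNReal.ofReal_mul (show (0 : ℝ) ≤ 4 by norm_num)]
  rw [lintegral_const_mul' _ _ ENNReal.ofReal_ne_top, lintegral_const_mul' _ _ ENNReal.ofReal_ne_top,
    lintegral_quadForm_otherErrors hX hk0, lintegral_quadForm hS hS]
  have h5 := quadForm_add_trace_le h0 hς hk hk0
  have h6 := trace_targetCov_mul_self_le h0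
  have h7 : quadForm T.targetCov 0 = 0 := by simp [quadForm]
  rw [h7, zero_add, mul_pow, Real.sq_sqrt (by linarith)]
  calc _ ≤ ENNReal.ofReal 4 * ENNReal.ofReal (T.fluctuation ^ 2)
        + ENNReal.ofReal 4 * ENNReal.ofReal (T.fluctuation ^ 2 * (τ + ς)) := by gcongr
    _ = ENNReal.ofReal (4 * T.fluctuation ^ 2 + 4 * (T.fluctuation ^ 2 * (τ + ς))) := by
        rw [ENNReal.ofReal_add (by positivity) (by positivity),
          ENNReal.ofReal_mul (p := 4) (q := T.fluctuation ^ 2) (by norm_num),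
          ENNReal.ofReal_mul (p := 4) (q := T.fluctuation ^ 2 * (τ + ς)) (by norm_num)]
    _ ≤ _ := ENNReal.ofReal_le_ofReal (by nlinarith [sq_nonneg T.fluctuation])

lemma lintegral_sqrt_quadForm_le (h0 : T.cov 0 ≠ 0) (hX : T.IsSample P X) :
    ∫⁻ ω, ENNReal.ofReal √(quadForm T.targetCov (bagMean (T.centredBag fun k i => X k i ω))) ∂P
      ≤ ENNReal.ofReal T.fluctuation := by
  have : IsProbabilityMeasure P := hX.2.isProbabilityMeasure
  have hS := T.targetCov_posSemidef
  refine lintegral_ofReal_sqrt_le (fun _ => quadForm_nonneg hS _) (fluctuation_pos h0) ?_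
  have h := hasLaw_bagMean (T.N_pos 0) (T.cov_posSemidef 0) (fun i => hasLaw_sub_mean hX i)
    (iIndepFun_sub_mean hX)
  have h2 := h.lintegral_comp (f := fun y => ENNReal.ofReal (quadForm T.targetCov y)) (by fun_prop)
  refine h2.trans_le ?_
  have h7 : quadForm T.targetCov 0 = 0 := by simp [quadForm]
  rw [← targetCov, lintegral_quadForm hS hS, h7, zero_add]
  exact ENNReal.ofReal_le_ofReal (trace_targetCov_mul_self_le h0)

lemma lintegral_abs_norm_sq_sub_naiveRiskHat_le (h0 : T.cov 0 ≠ 0) (hN : 2 ≤ T.N 0)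
    (hX : T.IsSample P X) :
    ∫⁻ ω, ENNReal.ofReal |‖bagMean (T.centredBag fun k i => X k i ω)‖ ^ 2
        - 1 / ((T.N 0 : ℝ) * ((T.N 0 : ℝ) - 1))
          * ∑ i, ‖bagResidual (T.centredBag fun k i => X k i ω) i‖ ^ 2| ∂P
      ≤ ENNReal.ofReal (28 * T.fluctuation) := by
  refine (lintegral_abs_norm_bagMean_sq_sub_le hN (T.cov_posSemidef 0)
    (fun i => hasLaw_sub_mean hX i) (iIndepFun_sub_mean hX)).trans ?_
  refine ENNReal.ofReal_le_ofReal ?_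
  have := schattenTwo_div_le h0
  rw [schattenTwo] at this
  rw [mul_div_assoc]
  linarith

section Exceptional

lemma measurableSet_noiseSet (u : ℝ) :
    MeasurableSet {p : (Fin T.B → EuclideanSpace ℝ (Fin T.d)) × EuclideanSpace ℝ (Fin T.d) |
      p.2 ∈ T.noiseSet u p.1} := by
  have e : {p : (Fin T.B → EuclideanSpace ℝ (Fin T.d)) × EuclideanSpace ℝ (Fin T.d) |
      p.2 ∈ T.noiseSet u p.1}
      = ⋃ k, {p | 2 * √u * √(quadForm T.targetCov (p.1 k)) < |inner ℝ (p.1 k) p.2|} := by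
    ext p; simp [noiseSet]
  rw [e]
  exact MeasurableSet.iUnion fun k => measurableSet_lt (by fun_prop) (by fun_prop)

lemma measurableSet_residualSet :
    MeasurableSet {p : (Fin T.B → EuclideanSpace ℝ (Fin T.d)) × EuclideanSpace ℝ (Fin T.d) ×
      (Fin (T.N 0) → EuclideanSpace ℝ (Fin T.d)) | p.2.2 ∈ T.residualSet p.1 p.2.1} := by
  have e : {p : (Fin T.B → EuclideanSpace ℝ (Fin T.d)) × EuclideanSpace ℝ (Fin T.d) ×
      (Fin (T.N 0) → EuclideanSpace ℝ (Fin T.d)) | p.2.2 ∈ T.residualSet p.1 p.2.1}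
      = ⋃ k, {p | ∑ i, inner ℝ (p.2.1 - p.1 k) (p.2.2 i) ^ 2
        < 1 / 16 * ((T.N 0 : ℝ) - 1) * quadForm (T.cov 0) (p.2.1 - p.1 k)} := by
    ext p; simp [residualSet]
  rw [e]
  exact MeasurableSet.iUnion fun k => measurableSet_lt (by fun_prop) (by fun_prop)

lemma measurable_exceptionalLoss (u : ℝ) :
    Measurable fun p : (Fin T.B → EuclideanSpace ℝ (Fin T.d)) × EuclideanSpace ℝ (Fin T.d) ×
      (Fin (T.N 0) → EuclideanSpace ℝ (Fin T.d)) => T.exceptionalLoss u p.1 p.2.1 p.2.2 := by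
  classical
  have hp : Measurable fun p : (Fin T.B → EuclideanSpace ℝ (Fin T.d)) ×
      EuclideanSpace ℝ (Fin T.d) × (Fin (T.N 0) → EuclideanSpace ℝ (Fin T.d)) => (p.1, p.2.1) := by
    fun_prop
  have hY := measurable_projectionSq.comp hp
  unfold exceptionalLoss
  simp only [Set.indicator_apply]
  exact (Measurable.ite ((measurableSet_noiseSet u).preimage hp) hY measurable_const).add
    (Measurable.ite measurableSet_residualSet hY measurable_const)

lemma measure_noiseSet_le (u : ℝ) (hu : 0 ≤ u) (v : Fin T.B → EuclideanSpace ℝ (Fin T.d)) :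
    multivariateGaussian 0 T.targetCov (T.noiseSet u v)
      ≤ ENNReal.ofReal (2 * T.B * Real.exp (-(2 * u))) := by
  have e : T.noiseSet u v
      = ⋃ k, {x | 2 * √u * √(quadForm T.targetCov (v k)) < |inner ℝ (v k) x|} := by
    simp only [noiseSet, Set.ofPred_exists]
  have he : -(2 * √u) ^ 2 / 2 = -(2 * u) := by rw [mul_pow, Real.sq_sqrt hu]; ring
  rw [e]
  refine (measure_iUnion_fintype_le _ _).trans ?_
  refine (Finset.sum_le_sum fun k _ => multivariateGaussian_tail_le T.targetCov_posSemidef (v k)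
    (t := 2 * √u) (by positivity)).trans (le_of_eq ?_)
  rw [he, Finset.sum_const, Finset.card_univ, Fintype.card_fin, nsmul_eq_mul,
    ← ENNReal.ofReal_natCast, ← ENNReal.ofReal_mul (Nat.cast_nonneg _)]
  congr 1; ring

lemma measure_residualSet_le (hX : T.IsSample P X) (v : Fin T.B → EuclideanSpace ℝ (Fin T.d))
    (x : EuclideanSpace ℝ (Fin T.d)) :
    (P.map fun ω => bagResidual (T.centredBag fun k i => X k i ω)) (T.residualSet v x)
      ≤ ENNReal.ofReal (T.B * Real.exp (-(3 / 4 * ((T.N 0 : ℝ) - 1)))) := by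
  simp only [residualSet, Set.ofPred_exists]
  refine (measure_iUnion_fintype_le _ _).trans ?_
  refine (Finset.sum_le_sum fun k _ => map_bagResidual_le hX (x - v k)).trans (le_of_eq ?_)
  rw [Finset.sum_const, Finset.card_univ, Fintype.card_fin, nsmul_eq_mul,
    ← ENNReal.ofReal_natCast, ← ENNReal.ofReal_mul (Nat.cast_nonneg _)]

/-- Given the errors `v` of the other tasks, the projection on their span involves at most `B`
directions.  The first exceptional set depends on `x` only and is handled by the Cauchy–Schwarz
inequality; the second one has a small probability conditionally on `x`. -/
lemma lintegral_exceptionalLoss_le (h0 : T.cov 0 ≠ 0) (hX : T.IsSample P X) {u : ℝ}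
    (hu : Real.log (17 * T.B) ≤ u) (huN : u ≤ ((T.N 0 : ℝ) - 1) / 2) :
    ∫⁻ ω, ENNReal.ofReal (T.exceptionalLoss u (T.otherErrors fun k i => X k i ω)
        (bagMean (T.centredBag fun k i => X k i ω))
        (bagResidual (T.centredBag fun k i => X k i ω))) ∂P
      ≤ ENNReal.ofReal (4 * T.B * Real.exp (-u / 2) * T.fluctuation) := by
  have : IsProbabilityMeasure P := hX.2.isProbabilityMeasure
  have := Measure.isProbabilityMeasure_map (aemeasurable_otherErrors hX)
  have hS := T.targetCov_posSemidef
  have hB : (1 : ℝ) ≤ T.B := by exact_mod_cast NeZero.one_le (n := T.B)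
  have hu0 : 0 ≤ u := (Real.log_nonneg (by linarith)).trans hu
  set ρ := P.map fun ω => bagResidual (T.centredBag fun k i => X k i ω) with hρ
  set t := T.naiveRisk 0 / T.effDim 0 with ht
  have ht0 : 0 < t := div_pos (T.naiveRisk_pos h0) (by linarith [one_le_effDim h0])
  set E := Real.exp (-u / 2) with hE
  have hE0 : 0 < E := Real.exp_pos _
  -- with `E = e^{-u/2}`, this absorbs the union bounds over the tasks
  have hBE : T.B * E ^ 2 ≤ 1 / 17 := by
    have h1 : 17 * (T.B : ℝ) ≤ Real.exp u := (Real.log_le_iff_le_exp (by linarith)).1 hu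
    have h2 : E ^ 2 * Real.exp u = 1 := by
      rw [hE, sq, ← Real.exp_add, ← Real.exp_add]
      simp
    nlinarith [sq_nonneg E]
  have hpa : ∀ v, multivariateGaussian 0 T.targetCov (T.noiseSet u v)
      ≤ ENNReal.ofReal ((E / 2) ^ 2) := fun v => by
    refine (measure_noiseSet_le u hu0 v).trans (ENNReal.ofReal_le_ofReal ?_)
    have : Real.exp (-(2 * u)) = E ^ 2 * E ^ 2 := by
      rw [hE]; simp only [sq, ← Real.exp_add]; congr 1; ring
    rw [this]
    nlinarith [sq_nonneg E]
  have hpb : ∀ v x, ρ (T.residualSet v x) ≤ ENNReal.ofReal (E / 17) := fun v x => by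
    refine (measure_residualSet_le hX v x).trans (ENNReal.ofReal_le_ofReal ?_)
    have h1 : Real.exp (-(3 / 4 * ((T.N 0 : ℝ) - 1))) ≤ E ^ 2 * E := by
      rw [hE]; simp only [sq, ← Real.exp_add]; gcongr; linarith
    nlinarith
  rw [lintegral_errors hX (F := fun v x r => ENNReal.ofReal (T.exceptionalLoss u v x r))
    (measurable_exceptionalLoss u).ennreal_ofReal]
  have hv : ∀ v, ∫⁻ x, ∫⁻ r, ENNReal.ofReal (T.exceptionalLoss u v x r) ∂ρ
        ∂multivariateGaussian 0 T.targetCov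
      ≤ ENNReal.ofReal (4 * T.B * E * T.fluctuation) := by
    intro v
    have := Measure.isProbabilityMeasure_map (aemeasurable_bagResidual_centredBag hX)
    have hA : MeasurableSet (T.noiseSet u v) := by
      simp only [noiseSet, Set.ofPred_exists]
      exact MeasurableSet.iUnion fun k => measurableSet_lt measurable_const (by fun_prop)
    have hY : Measurable (projectionSq v) := measurable_projectionSq_right v
    have hx : ∀ x, ∫⁻ r, ENNReal.ofReal (T.exceptionalLoss u v x r) ∂ρ
        ≤ (T.noiseSet u v).indicator (fun x => ENNReal.ofReal (projectionSq v x)) x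
          + ENNReal.ofReal (E / 17) * ENNReal.ofReal (projectionSq v x) := by
      intro x
      have hC : MeasurableSet (T.residualSet v x) := by
        simp only [residualSet, Set.ofPred_exists]
        exact MeasurableSet.iUnion fun k => measurableSet_lt (by fun_prop) measurable_const
      have e : ∀ r, ENNReal.ofReal (T.exceptionalLoss u v x r)
          = (T.noiseSet u v).indicator (fun x => ENNReal.ofReal (projectionSq v x)) x
            + (T.residualSet v x).indicator (fun _ => ENNReal.ofReal (projectionSq v x)) r := by
        intro r
        rw [exceptionalLoss, ENNReal.ofReal_add
          (Set.indicator_nonneg (fun _ _ => projectionSq_nonneg _ _) _)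
          (Set.indicator_nonneg (fun _ _ => projectionSq_nonneg _ _) _)]
        congr 1
        · by_cases h : x ∈ T.noiseSet u v <;> simp [h]
        · by_cases h : r ∈ T.residualSet v x <;> simp [h]
      simp only [e]
      rw [lintegral_add_left measurable_const, lintegral_const, measure_univ, mul_one,
        lintegral_indicator_const hC, mul_comm (ENNReal.ofReal (projectionSq v x))]
      gcongr
      exact hpb v x
    refine (lintegral_mono hx).trans ?_
    rw [lintegral_add_right _ (by fun_prop), lintegral_const_mul' _ _ ENNReal.ofReal_ne_top]
    calc _ ≤ ENNReal.ofReal (T.B * (7 * t * (E / 2)))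
          + ENNReal.ofReal (E / 17) * ENNReal.ofReal (T.B * t) := by
          gcongr
          · exact lintegral_indicator_projectionSq_le hS v hA ht0 (by positivity)
              (quadForm_targetCov_le h0) (hpa v)
          · exact lintegral_projectionSq_le hS v ht0 (quadForm_targetCov_le h0)
      _ = ENNReal.ofReal (T.B * (7 * t * (E / 2)) + E / 17 * (T.B * t)) := by
          rw [← ENNReal.ofReal_mul (by positivity),
            ← ENNReal.ofReal_add (by positivity) (by positivity)]
      _ ≤ _ := by
          refine ENNReal.ofReal_le_ofReal ?_
          have h1 : t ≤ T.fluctuation := naiveRisk_div_effDim_le h0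
          have h2 : 0 < T.B * E := by positivity
          nlinarith [mul_le_mul_of_nonneg_left h1 h2.le]
  refine (lintegral_mono hv).trans ?_
  rw [lintegral_const, measure_univ, mul_one]

end Exceptional

end GaussianTasks

/-! ### The risk bound and oracle consistency -/

namespace GaussianTasks

variable {T : GaussianTasks} {Ω : Type*} [MeasurableSpace Ω] {P : Measure Ω}
  {X : (k : Fin T.B) → Fin (T.N k) → Ω → EuclideanSpace ℝ (Fin T.d)}

lemma loss_nonneg (T : GaussianTasks) (x : T.Data) (w : Fin T.B → ℝ) : 0 ≤ T.loss x w :=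
  sq_nonneg _

lemma one_le_of_log_le {u : ℝ} (hu : Real.log (17 * T.B) ≤ u) : 1 ≤ u := by
  have hB : (1 : ℝ) ≤ T.B := by exact_mod_cast NeZero.one_le (n := T.B)
  refine le_trans ?_ hu
  rw [Real.le_log_iff_exp_le (by linarith)]
  linarith [Real.exp_one_lt_d9]

lemma two_le_card_of_le {u : ℝ} (hu : 1 ≤ u) (huN : u ≤ ((T.N 0 : ℝ) - 1) / 2) : 2 ≤ T.N 0 := by
  have : (2 : ℝ) ≤ T.N 0 := by linarith
  exact_mod_cast this

/-- A weight `A` with `A² τ ≤ 1` removes the dependence on `τ` of a fluctuation of order `√(τ + c)`. -/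
lemma mul_sqrt_add_le {A τ c : ℝ} (hA : 0 ≤ A) (hA1 : A ≤ 1) (hAτ : A ^ 2 * τ ≤ 1) (hτ : 0 ≤ τ)
    (hc : 0 ≤ c) : A * √(τ + c) ≤ √(1 + c) := by
  refine Real.le_sqrt_of_sq_le ?_
  rw [mul_pow, Real.sq_sqrt (by positivity)]
  nlinarith [mul_le_mul_of_nonneg_right (pow_le_one₀ hA hA1 : A ^ 2 ≤ 1) hc]

/-- The risk bound for the competitors of parameters `τ` and `ς`. -/
lemma lintegral_loss_le (h0 : T.cov 0 ≠ 0) {u : ℝ}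
    (hu : Real.log (17 * T.B) ≤ u) (huN : u ≤ ((T.N 0 : ℝ) - 1) / 2) (hX : T.IsSample P X)
    {what : Ω → Fin T.B → ℝ} (hw : T.IsQAggregationEstimator u P X what) {τ ς : ℝ} (hτ : 0 ≤ τ)
    (hς : 1 ≤ ς) :
    ∫⁻ ω, ENNReal.ofReal (T.loss (fun k i => X k i ω) (what ω)) ∂P
      ≤ ENNReal.ofReal (T.naiveRisk 0 * oracleRisk τ (T.relAggVariance (T.trimmedNeighbours τ ς))
        + (128 * √u * ς + 16 * T.B * Real.exp (-u / 2)) * T.fluctuation) := by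
  have hu1 := one_le_of_log_le hu
  have hN := two_le_card_of_le hu1 huN
  have hδ := fluctuation_pos h0
  have hsu : 1 ≤ √u := Real.one_le_sqrt.2 hu1
  obtain ⟨z, hz⟩ := T.exists_oracleWeights h0 hτ hς
  have hV := aemeasurable_otherErrors hX
  have hξ := aemeasurable_bagMean_centredBag hX
  have hR := aemeasurable_bagResidual_centredBag hX
  have hVk : ∀ k, AEMeasurable (fun ω => T.otherErrors (fun k i => X k i ω) k) P := fun k =>
    (measurable_pi_apply k).comp_aemeasurable hV
  have hz0 : ∀ k ∈ Finset.univ.erase 0, 0 ≤ z k := fun k _ => hz.mem_simplex.1 k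
  set A := ∑ k ∈ Finset.univ.erase 0, z k with hA
  have hA0 : 0 ≤ A := Finset.sum_nonneg hz0
  have hA1 : A ≤ 1 := hz.mem_simplex.2 ▸
    Finset.sum_le_sum_of_subset_of_nonneg (Finset.erase_subset _ _) fun k _ _ => hz.mem_simplex.1 k
  -- the competitor
  have hmeasure : AEMeasurable (fun ω => T.loss (fun k i => X k i ω) z) P := by
    simp only [loss]
    exact ((hasLaw_aggregate hX z).aemeasurable.sub_const _).norm.pow_const 2
  have b0 : ∫⁻ ω, ENNReal.ofReal (T.loss (fun k i => X k i ω) z) ∂P ≤ ENNReal.ofReal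
      (T.naiveRisk 0 * oracleRisk τ (T.relAggVariance (T.trimmedNeighbours τ ς))) := by
    rw [lintegral_loss_const hX hz.mem_simplex]
    exact ENNReal.ofReal_le_ofReal hz.risk_le
  have hor : 0 ≤ T.naiveRisk 0
      * oracleRisk τ (T.relAggVariance (T.trimmedNeighbours τ ς)) :=
    mul_nonneg (T.naiveRisk_nonneg 0) ((div_nonneg hτ (by linarith)).trans hz.le_oracleRisk)
  -- its cross terms
  have b1 := lintegral_ofReal_const_mul_le (zero_le_two) (lintegral_ofReal_weighted_sum_le (P := P)
    (f := fun k ω => |inner ℝ (T.otherErrors (fun k i => X k i ω) k)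
      (bagMean (T.centredBag fun k i => X k i ω))|) hz0
    (fun k _ => ((hVk k).inner hξ).abs)
    (fun k _ ω => abs_nonneg _) fun k hk hk0 => lintegral_abs_inner_le h0 hX hτ hς
      (hz.mem_of_ne_zero k (Finset.ne_of_mem_erase hk) hk0) (Finset.ne_of_mem_erase hk))
  -- its penalty
  have hnoise : ∀ k, AEMeasurable (fun ω => T.noiseScale (T.otherErrors (fun k i => X k i ω) k)
      (bagMean (T.centredBag fun k i => X k i ω))
      (bagResidual (T.centredBag fun k i => X k i ω))) P := aemeasurable_noiseScale hX
  have b2 := lintegral_ofReal_const_mul_le (c := 16 * √u) (by positivity)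
    (lintegral_ofReal_weighted_sum_le (P := P) hz0 (fun k _ => hnoise k)
    (fun k _ ω => Real.sqrt_nonneg _) fun k hk hk0 => lintegral_noiseScale_le h0 hN hX hτ hς
      (hz.mem_of_ne_zero k (Finset.ne_of_mem_erase hk) hk0) (Finset.ne_of_mem_erase hk))
  have b3 := lintegral_ofReal_const_mul_le (c := 4 * √u) (by positivity)
    (lintegral_sqrt_quadForm_le h0 hX)
  have b4 := lintegral_ofReal_const_mul_le (zero_le_two)
    (lintegral_abs_norm_sq_sub_naiveRiskHat_le h0 hN hX)
  have b5 := lintegral_ofReal_const_mul_le (zero_le_four) (lintegral_exceptionalLoss_le h0 hX hu huN)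
  have m1 : AEMeasurable (fun ω => 2 * ∑ k ∈ Finset.univ.erase 0,
      z k * |inner ℝ (T.otherErrors (fun k i => X k i ω) k)
        (bagMean (T.centredBag fun k i => X k i ω))|) P :=
    (Finset.aemeasurable_fun_sum _ fun k _ => ((hVk k).inner hξ).abs.const_mul _).const_mul _
  have m2 := (Finset.aemeasurable_fun_sum (Finset.univ.erase 0)
    fun k _ => (hnoise k).const_mul (z k)).const_mul (16 * √u)
  have m3 : AEMeasurable (fun ω => 4 * √u * √(quadForm T.targetCov
      (bagMean (T.centredBag fun k i => X k i ω)))) P :=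
    (measurable_quadForm.comp_aemeasurable hξ).sqrt.const_mul _
  have m4 : AEMeasurable (fun ω => 2 * |‖bagMean (T.centredBag fun k i => X k i ω)‖ ^ 2
      - 1 / ((T.N 0 : ℝ) * ((T.N 0 : ℝ) - 1))
        * ∑ i, ‖bagResidual (T.centredBag fun k i => X k i ω) i‖ ^ 2|) P := by
    have hRi := fun i => (measurable_pi_apply i).comp_aemeasurable hR
    exact ((hξ.norm.pow_const 2).sub ((Finset.aemeasurable_fun_sum _ fun i _ =>
      (hRi i).norm.pow_const 2).const_mul _)).abs.const_mul _
  have hE := Real.exp_pos (-u / 2)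
  have key := lintegral_ofReal_add_le hmeasure hor (by positivity) b0
    (lintegral_ofReal_add_le m1 (by positivity) (by positivity) b1
    (lintegral_ofReal_add_le m2 (by positivity) (by positivity) b2
    (lintegral_ofReal_add_le m3 (by positivity) (by positivity) b3
    (lintegral_ofReal_add_le m4 (by positivity) (by positivity) b4 b5))))
  refine (lintegral_mono_ae ?_).trans (key.trans (ENNReal.ofReal_le_ofReal ?_))
  · filter_upwards [hw.2] with ω hω
    exact ENNReal.ofReal_le_ofReal (loss_le_of_isQAggregation hN hω hz.mem_simplex)
  · have c1 : A * √(τ + ς) ≤ 2 * ς := by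
      refine (mul_sqrt_add_le hA0 hA1 hz.sq_mul_le hτ (by linarith)).trans ?_
      exact Real.sqrt_le_iff.2 ⟨by linarith, by nlinarith⟩
    have c2 : A * √(τ + 2 * ς) ≤ 2 * ς := by
      refine (mul_sqrt_add_le hA0 hA1 hz.sq_mul_le hτ (by linarith)).trans ?_
      exact Real.sqrt_le_iff.2 ⟨by linarith, by nlinarith⟩
    have e1 : 2 * (A * (T.fluctuation * √(τ + ς))) ≤ 4 * (√u * ς * T.fluctuation) := by
      have : ς ≤ √u * ς := le_mul_of_one_le_left (by linarith) hsu
      calc 2 * (A * (T.fluctuation * √(τ + ς))) = 2 * T.fluctuation * (A * √(τ + ς)) := by ring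
        _ ≤ 2 * T.fluctuation * (2 * (√u * ς)) :=
          mul_le_mul_of_nonneg_left (by linarith) (by positivity)
        _ = _ := by ring
    have e2 : 16 * √u * (A * (2 * T.fluctuation * √(τ + 2 * ς)))
        ≤ 64 * (√u * ς * T.fluctuation) := by
      calc _ = 32 * √u * T.fluctuation * (A * √(τ + 2 * ς)) := by ring
        _ ≤ 32 * √u * T.fluctuation * (2 * ς) := by gcongr
        _ = _ := by ring
    have e3 : √u * T.fluctuation ≤ √u * ς * T.fluctuation := by
      have : √u ≤ √u * ς := le_mul_of_one_le_right (by linarith) hς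
      gcongr
    have e4 : T.fluctuation ≤ √u * ς * T.fluctuation :=
      le_mul_of_one_le_left hδ.le (one_le_mul_of_one_le_of_one_le hsu hς)
    linarith

lemma integrable_loss (h0 : T.cov 0 ≠ 0) {u : ℝ}
    (hu : Real.log (17 * T.B) ≤ u) (huN : u ≤ ((T.N 0 : ℝ) - 1) / 2) (hX : T.IsSample P X)
    {what : Ω → Fin T.B → ℝ} (hw : T.IsQAggregationEstimator u P X what) :
    Integrable (fun ω => T.loss (fun k i => X k i ω) (what ω)) P := by
  refine ⟨AEMeasurable.aestronglyMeasurable ?_, ?_⟩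
  · simp only [loss, aggregate]
    have h : ∀ k, AEMeasurable (fun ω => what ω k • T.naive (fun k i => X k i ω) k) P := fun k =>
      ((measurable_pi_apply k).comp_aemeasurable hw.1).smul (hasLaw_naive hX k).aemeasurable
    exact ((Finset.aemeasurable_fun_sum _ fun k _ => h k).sub_const _).norm.pow_const 2
  · rw [hasFiniteIntegral_iff_ofReal (ae_of_all _ fun ω => T.loss_nonneg _ _)]
    exact (lintegral_loss_le h0 hu huN hX hw le_rfl le_rfl).trans_lt ENNReal.ofReal_lt_top

lemma oracleRisk_relAggVariance_ge (h0 : T.cov 0 ≠ 0) {τ ς : ℝ} (hτ : 0 ≤ τ) (hς : 1 ≤ ς) :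
    τ / (1 + τ) ≤ oracleRisk τ (T.relAggVariance (T.trimmedNeighbours τ ς)) :=
  (T.exists_oracleWeights h0 hτ hς).choose_spec.le_oracleRisk

/-- The remainder `B e^{-u/2} s_1² / √d^e_1` is a fraction `B e^{-u/2}` of the fluctuation term, and is
therefore absorbed by the factor in front. -/
lemma risk_div_naiveRisk_le (h0 : T.cov 0 ≠ 0) {u : ℝ}
    (hu : Real.log (17 * T.B) ≤ u) (huN : u ≤ ((T.N 0 : ℝ) - 1) / 2) (hX : T.IsSample P X)
    {what : Ω → Fin T.B → ℝ} (hw : T.IsQAggregationEstimator u P X what) {τ ς : ℝ} (hτ : 0 ≤ τ)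
    (hς : 1 ≤ ς) :
    T.risk P X what / T.naiveRisk 0 ≤ (1 + 128 * T.B * Real.exp (-u / 2))
      * (oracleRisk τ (T.relAggVariance (T.trimmedNeighbours τ ς))
        + 128 * ς * √(u / T.effDim 0)) := by
  have hs := T.naiveRisk_pos h0
  have hd := one_le_effDim h0
  have hu1 := one_le_of_log_le hu
  have hsu : 1 ≤ √u := Real.one_le_sqrt.2 hu1
  have hsd : 0 < √(T.effDim 0) := Real.sqrt_pos.2 (by linarith)
  have hor : 0 ≤ oracleRisk τ (T.relAggVariance (T.trimmedNeighbours τ ς)) :=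
    (div_nonneg hτ (by linarith)).trans (oracleRisk_relAggVariance_ge h0 hτ hς)
  have hE := Real.exp_pos (-u / 2)
  have hδ := fluctuation_pos h0
  have h : T.risk P X what ≤ T.naiveRisk 0
      * oracleRisk τ (T.relAggVariance (T.trimmedNeighbours τ ς))
        + (128 * √u * ς + 16 * T.B * Real.exp (-u / 2)) * T.fluctuation := by
    rw [risk, integral_eq_lintegral_of_nonneg_ae (ae_of_all _ fun ω => T.loss_nonneg _ _)
      (integrable_loss h0 hu huN hX hw).1]
    refine ENNReal.toReal_le_of_le_ofReal (by positivity) ?_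
    exact lintegral_loss_le h0 hu huN hX hw hτ hς
  rw [div_le_iff₀ hs]
  refine h.trans ?_
  rw [Real.sqrt_div (by linarith), fluctuation]
  set o := oracleRisk τ (T.relAggVariance (T.trimmedNeighbours τ ς))
  set s := T.naiveRisk 0
  have h1 : 16 * (T.B : ℝ) * Real.exp (-u / 2) * (s / √(T.effDim 0))
      ≤ 128 * T.B * Real.exp (-u / 2) * (128 * ς * (√u / √(T.effDim 0))) * s := by
    have : 1 ≤ 128 * ς * √u := by nlinarith
    calc _ ≤ 128 * T.B * Real.exp (-u / 2) * (s / √(T.effDim 0)) * 1 := by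
          rw [mul_one]; gcongr; norm_num
      _ ≤ 128 * T.B * Real.exp (-u / 2) * (s / √(T.effDim 0)) * (128 * ς * √u) := by gcongr
      _ = _ := by ring
  have h2 : 0 ≤ 128 * T.B * Real.exp (-u / 2) * (s * o) := by positivity
  calc s * o + (128 * √u * ς + 16 * T.B * Real.exp (-u / 2)) * (s / √(T.effDim 0))
      = s * o + 128 * ς * (√u / √(T.effDim 0)) * s
        + 16 * (T.B : ℝ) * Real.exp (-u / 2) * (s / √(T.effDim 0)) := by ring
    _ ≤ s * o + 128 * ς * (√u / √(T.effDim 0)) * s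
        + 128 * T.B * Real.exp (-u / 2) * (128 * ς * (√u / √(T.effDim 0))) * s
        + 128 * T.B * Real.exp (-u / 2) * (s * o) := by linarith
    _ = _ := by ring

end GaussianTasks

theorem mainTheorem2 :
    -- the risk bound, with an absolute constant `C`
    (∃ C : ℝ, 0 < C ∧
      ∀ (T : GaussianTasks) (_ : T.cov 0 ≠ 0)
        (u₀ : ℝ) (_ : Real.log (17 * T.B) ≤ u₀) (_ : u₀ ≤ ((T.N 0 : ℝ) - 1) / 2)
        (Ω : Type*) [MeasurableSpace Ω] (P : MeasureTheory.Measure Ω)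
        [MeasureTheory.IsProbabilityMeasure P]
        (X : (k : Fin T.B) → Fin (T.N k) → Ω → EuclideanSpace ℝ (Fin T.d))
        (_ : T.IsSample P X)
        (what : Ω → Fin T.B → ℝ) (_ : T.IsQAggregationEstimator u₀ P X what),
        MeasureTheory.Integrable (fun a => T.loss (fun k i => X k i a) (what a)) P ∧
        T.risk P X what / T.naiveRisk 0 ≤
          (1 + C * T.B * Real.exp (-u₀ / 2)) *
            sInf {r : ℝ | ∃ τ ς : ℝ, 0 ≤ τ ∧ 1 ≤ ς ∧
              r = GaussianTasks.oracleRisk τ (T.relAggVariance (T.trimmedNeighbours τ ς))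
                + C * ς * Real.sqrt (u₀ / T.effDim 0)}) ∧
    -- oracle-consistency along sequences of problems, for every choice of `τ` and `ς`
    (∀ (T : ℕ → GaussianTasks) (_ : ∀ n, (T n).cov 0 ≠ 0)
      (_ : Filter.Tendsto (fun n => (T n).effDim 0) Filter.atTop Filter.atTop)
      (_ : ∀ᶠ n in Filter.atTop,
        1 + 4 * Real.log ((T n).B * (T n).effDim 0) ≤ ((T n).N 0 : ℝ))
      (Ω : ℕ → Type*) [∀ n, MeasurableSpace (Ω n)] (P : ∀ n, MeasureTheory.Measure (Ω n))
      [∀ n, MeasureTheory.IsProbabilityMeasure (P n)]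
      (X : ∀ n, (k : Fin (T n).B) → Fin ((T n).N k) → Ω n → EuclideanSpace ℝ (Fin (T n).d))
      (_ : ∀ n, (T n).IsSample (P n) (X n))
      (what : ∀ n, Ω n → Fin (T n).B → ℝ)
      (_ : ∀ n, (T n).IsQAggregationEstimator
        (2 * Real.log ((T n).B * (T n).effDim 0)) (P n) (X n) (what n))
      (τ ς : ℕ → ℝ) (_ : ∀ n, 0 < τ n) (_ : ∀ n, 1 ≤ ς n)
      (_ : (fun n => ς n *
          Real.sqrt (Real.log ((T n).B * (T n).effDim 0) / (T n).effDim 0))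
        =o[Filter.atTop] (fun n => τ n / (1 + τ n))),
      ∃ c : ℕ → ℝ, Filter.Tendsto c Filter.atTop (nhds 1) ∧
        ∀ᶠ n in Filter.atTop,
          (T n).risk (P n) (X n) (what n) / (T n).naiveRisk 0 ≤
            c n * GaussianTasks.oracleRisk (τ n)
              ((T n).relAggVariance ((T n).trimmedNeighbours (τ n) (ς n)))) := by
  refine ⟨⟨128, by norm_num, ?_⟩, ?_⟩
  · intro T h0 u hu huN Ω _ P _ X hX what hw
    refine ⟨GaussianTasks.integrable_loss h0 hu huN hX hw, ?_⟩
    have hc : 0 < 1 + 128 * (T.B : ℝ) * Real.exp (-u / 2) := by positivity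
    rw [← div_le_iff₀' hc]
    refine le_csInf ⟨_, 0, 1, le_rfl, le_rfl, rfl⟩ ?_
    rintro r ⟨τ, ς, hτ, hς, rfl⟩
    rw [div_le_iff₀' hc]
    exact GaussianTasks.risk_div_naiveRisk_le h0 hu huN hX hw hτ hς
  · intro T h0 hd hN Ω _ P _ X hX what hw τ ς hτ hς ho
    -- `ratio` is the fluctuation term relative to the lower bound `τ / (1 + τ)` of the oracle risk;
    -- for `u = 2 log (B d)`, the factor `B e^{-u/2}` is `1 / d`
    set ratio : ℕ → ℝ := fun n => ς n *
      Real.sqrt (Real.log ((T n).B * (T n).effDim 0) / (T n).effDim 0) / (τ n / (1 + τ n))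
      with hratio
    have hlim : Filter.Tendsto ratio Filter.atTop (nhds 0) := ho.tendsto_div_nhds_zero
    refine ⟨fun n => (1 + 128 * ((T n).effDim 0)⁻¹) * (1 + 128 * √2 * ratio n), ?_, ?_⟩
    · have h1 := (tendsto_inv_atTop_zero.comp hd).const_mul 128 |>.const_add 1
      have h2 := hlim.const_mul (128 * √2) |>.const_add 1
      simpa using h1.mul h2
    · filter_upwards [hN, hd.eventually_ge_atTop 17] with n hn hdn
      have hB : (1 : ℝ) ≤ (T n).B := by exact_mod_cast NeZero.one_le (n := (T n).B)
      set D := (T n).effDim 0 with hD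
      have hBD : 0 < (T n).B * D := by positivity
      have hu : Real.log (17 * (T n).B) ≤ 2 * Real.log ((T n).B * D) := by
        rw [← Real.log_rpow hBD, Real.rpow_two]
        refine Real.log_le_log (by positivity) ?_
        have h2 : 17 * ((T n).B : ℝ) ≤ (T n).B * D := by nlinarith
        have h3 : 1 ≤ (T n).B * D := by nlinarith
        nlinarith
      have h := GaussianTasks.risk_div_naiveRisk_le (h0 n) hu (by linarith) (hX n) (hw n)
        (hτ n).le (hς n)
      refine h.trans ?_
      have hexp : 128 * ((T n).B : ℝ) * Real.exp (-(2 * Real.log ((T n).B * D)) / 2)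
          = 128 * D⁻¹ := by
        rw [show -(2 * Real.log ((T n).B * D)) / 2 = -Real.log ((T n).B * D) by ring, Real.exp_neg,
          Real.exp_log hBD]
        field_simp
      rw [hexp]
      have hτ' : 0 < τ n / (1 + τ n) := div_pos (hτ n) (by linarith [hτ n])
      have hge := GaussianTasks.oracleRisk_relAggVariance_ge (h0 n) (hτ n).le (hς n)
      have hr0 : 0 ≤ ratio n := by
        have := hς n
        simp only [hratio]
        positivity
      have hsq : 128 * ς n * √(2 * Real.log ((T n).B * D) / D)
          = 128 * √2 * ratio n * (τ n / (1 + τ n)) := by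
        simp only [hratio]
        rw [mul_assoc _ (_ / _) (τ n / (1 + τ n)), div_mul_cancel₀ _ hτ'.ne', mul_div_assoc,
          Real.sqrt_mul zero_le_two]
        ring
      have hDi : 0 ≤ D⁻¹ := by positivity
      rw [hsq, mul_assoc (1 + 128 * D⁻¹), one_add_mul (128 * √2 * ratio n)]
      gcongr
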